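/- Let $A$ be a fixed finite alphabet (of constant size). For a non-negative integer $k$, say that a word $u$ over $A$ has a $k$-error border if $u$ has a suffix that differs from the prefix of $u$ of the same length in exactly $k$ positions. Then there is an algorithm on the unit-cost word RAM which, given a word $u$ of length $n$ over $A$ and a non-negative integer $k$, decides whether $u$ has a $k$-error border in time $O(kn)$ and space $O(n)$. Precisely: the time is at most $C(kn+1)$ steps and the space is at most $C(n+1)$ machine words of $O(\log(n+k+2))$ bits each, where the algorithm and the constants depend only on the size of $A$, not on $u$, $n$ or $k$. -/

import Mathlib

/-- A word `u` has a `k`-error border if some suffix `v` of `u` and the prefix `w` of `u` of the same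
length `m` differ in exactly `k` positions. The suffix may be any suffix of `u`. -/
def HasErrorBorder {A : Type*} [DecidableEq A] (k : ℕ) (u : List A) : Prop :=
  ∃ (m : ℕ) (v w : Fin m → A), List.ofFn v <:+ u ∧ List.ofFn w <+: u ∧ hammingDist v w = k

/-! ### The machine model: a unit-cost word RAM

The memory consists of registers and of random-access arrays, each named by a natural number; a
program is a fixed text, so it mentions only finitely many of either. Every cell holds one word.
The parameters of a run are the word bound `W` (every value that is computed, read or written has to
be smaller than `W`) and the array length `S` (every array index that is used has to be smaller than
`S`). A program that would exceed one of these bounds gets stuck: it has no run. -/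

namespace WordRAM

/-- The binary machine operations, on natural numbers. Subtraction is truncated at `0`, division
rounds down, comparisons return `1` for true and `0` for false. -/
inductive Op where
  | add | sub | mul | div | mod | lt | eq

def Op.apply : Op → ℕ → ℕ → ℕ
  | .add, a, b => a + b
  | .sub, a, b => a - b
  | .mul, a, b => a * b
  | .div, a, b => a / b
  | .mod, a, b => a % b
  | .lt, a, b => if a < b then 1 else 0
  | .eq, a, b => if a = b then 1 else 0

/-- Expressions: constants, registers, array cells `a[e]`, and operations. -/
inductive Expr where
  | const (c : ℕ)
  | reg (x : ℕ)
  | get (a : ℕ) (e : Expr)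
  | op (o : Op) (e f : Expr)

/-- Programs: assignment `x := e` to a register, assignment `a[i] := e` to an array cell,
sequencing, branching and looping (a condition holds if its value is not `0`). -/
inductive Prog where
  | skip
  | assign (x : ℕ) (e : Expr)
  | store (a : ℕ) (i e : Expr)
  | seq (p q : Prog)
  | cond (b : Expr) (p q : Prog)
  | loop (b : Expr) (p : Prog)

/-- The contents of the memory. -/
structure State where
  reg : ℕ → ℕ
  arr : ℕ → ℕ → ℕ

def State.setReg (σ : State) (x v : ℕ) : State :=
  { σ with reg := Function.update σ.reg x v }

def State.setArr (σ : State) (a i v : ℕ) : State :=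
  { σ with arr := Function.update σ.arr a (Function.update (σ.arr a) i v) }

namespace Expr

/-- The value of an expression. -/
def val (σ : State) : Expr → ℕ
  | const c => c
  | reg x => σ.reg x
  | get a e => σ.arr a (e.val σ)
  | op o e f => o.apply (e.val σ) (f.val σ)

/-- The evaluation stays within the bounds: all values, including the intermediate ones, are smaller
than `W`, and all array indices are smaller than `S`. -/
def Ok (W S : ℕ) (σ : State) : Expr → Prop
  | const c => c < W
  | reg x => σ.reg x < W
  | get a e => e.Ok W S σ ∧ e.val σ < S ∧ σ.arr a (e.val σ) < W
  | op o e f => e.Ok W S σ ∧ f.Ok W S σ ∧ o.apply (e.val σ) (f.val σ) < W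

/-- The time to evaluate an expression: one step for each constant, register access, array access
and operation. -/
def cost : Expr → ℕ
  | const _ => 1
  | reg _ => 1
  | get _ e => e.cost + 1
  | op _ e f => e.cost + f.cost + 1

/-- All registers in the expression have names smaller than this number. -/
def numRegs : Expr → ℕ
  | const _ => 0
  | reg x => x + 1
  | get _ e => e.numRegs
  | op _ e f => max e.numRegs f.numRegs

/-- All arrays in the expression have names smaller than this number. -/
def numArrs : Expr → ℕ
  | const _ => 0
  | reg _ => 0
  | get a e => max (a + 1) e.numArrs
  | op _ e f => max e.numArrs f.numArrs

end Expr

namespace Prog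

/-- All registers in the program have names smaller than this number. -/
def numRegs : Prog → ℕ
  | skip => 0
  | assign x e => max (x + 1) e.numRegs
  | store _ i e => max i.numRegs e.numRegs
  | seq p q => max p.numRegs q.numRegs
  | cond b p q => max b.numRegs (max p.numRegs q.numRegs)
  | loop b p => max b.numRegs p.numRegs

/-- All arrays in the program have names smaller than this number. -/
def numArrs : Prog → ℕ
  | skip => 0
  | assign _ e => e.numArrs
  | store a i e => max (a + 1) (max i.numArrs e.numArrs)
  | seq p q => max p.numArrs q.numArrs
  | cond b p q => max b.numArrs (max p.numArrs q.numArrs)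
  | loop b p => max b.numArrs p.numArrs

/-- The space, in words, of the program when its arrays have length `S`. It counts the cells that
hold the input, too. -/
def space (p : Prog) (S : ℕ) : ℕ := p.numRegs + p.numArrs * S

end Prog

/-- `Exec W S p σ t σ'`: started in the state `σ`, the program `p` halts after exactly `t` steps in
the state `σ'`, and the run stays within the word bound `W` and the array length `S`. -/
inductive Exec (W S : ℕ) : Prog → State → ℕ → State → Prop where
  | skip (σ : State) : Exec W S .skip σ 1 σ
  | assign (σ : State) (x : ℕ) (e : Expr) (he : e.Ok W S σ) :
      Exec W S (.assign x e) σ (e.cost + 1) (σ.setReg x (e.val σ))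
  | store (σ : State) (a : ℕ) (i e : Expr) (hi : i.Ok W S σ) (he : e.Ok W S σ)
      (hS : i.val σ < S) :
      Exec W S (.store a i e) σ (i.cost + e.cost + 1) (σ.setArr a (i.val σ) (e.val σ))
  | seq (p q : Prog) (σ τ ρ : State) (s t : ℕ) (hp : Exec W S p σ s τ) (hq : Exec W S q τ t ρ) :
      Exec W S (.seq p q) σ (s + t) ρ
  | condTrue (b : Expr) (p q : Prog) (σ τ : State) (t : ℕ) (hb : b.Ok W S σ) (h : b.val σ ≠ 0)
      (hp : Exec W S p σ t τ) :
      Exec W S (.cond b p q) σ (b.cost + 1 + t) τ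
  | condFalse (b : Expr) (p q : Prog) (σ τ : State) (t : ℕ) (hb : b.Ok W S σ) (h : b.val σ = 0)
      (hq : Exec W S q σ t τ) :
      Exec W S (.cond b p q) σ (b.cost + 1 + t) τ
  | loopTrue (b : Expr) (p : Prog) (σ τ ρ : State) (s t : ℕ) (hb : b.Ok W S σ) (h : b.val σ ≠ 0)
      (hp : Exec W S p σ s τ) (hl : Exec W S (.loop b p) τ t ρ) :
      Exec W S (.loop b p) σ (b.cost + 1 + s + t) ρ
  | loopFalse (b : Expr) (p : Prog) (σ : State) (hb : b.Ok W S σ) (h : b.val σ = 0) :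
      Exec W S (.loop b p) σ (b.cost + 1) σ

/-- The initial state for a word `x` of natural numbers and a number `k`: register `0` holds the
length of `x`, register `1` holds `k`, array `0` holds the letters of `x`, and every other cell
is `0`. -/
def input (x : List ℕ) (k : ℕ) : State where
  reg j := if j = 0 then x.length else if j = 1 then k else 0
  arr a i := if a = 0 then x.getD i 0 else 0

end WordRAM

/-! A border of length m compares the word with itself at the shift p = n - m. For k > 0 the
question is therefore whether some shift 0 < p < n has exactly k mismatches
(`hasErrorBorder_iff_exists_shift`). The empty border settles k = 0, and k > n is impossible. For a
fixed shift the mismatches are visited by jumps: a longest-common-prefix query at the current pair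
of positions leads to the next mismatch, and counting stops at k + 1 (`jumpLoop_spec`). With queries
in constant time this costs O(k) per shift and O(kn) in all (`search_spec`).

It remains to prepare for such queries in linear time. The suffixes are ranked by the skew
algorithm. Positions not divisible by 3 are named by their triples of letters, which gives a text of
about two thirds of the length whose suffix order is the order of the sampled suffixes
(`IsReduced.sufLt`). The other suffixes are sorted by their first letter and the sampled suffix
behind it, and the two lists are merged (`liftStep_spec`). Common prefixes of neighbours in the
suffix order come from Kasai's scan (`LcpInv.next`), and that of any two suffixes is a minimum over
an interval of ranks (`isLcp_of_isMin`). For these minima the ranks are cut into blocks of length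
about log n. Inside a block a bit mask records a monotone stack (`IsMask.isMin`); across blocks a
table over powers of two has linear size because there are only about n / log n blocks
(`tableLoop_spec`, `minQuery_spec`).

Correctness and time are proved for unbounded runs (`Tri`), and the word and space bounds follow
from the program text: if no assignment exceeds the largest number in memory by more than g, then
memory stays below its initial bound plus g times the running time (`Run.exec`). The preparation
runs for O(n) steps, so its numbers and indices are O(n). The search runs for O(kn) steps and
therefore needs g = 0; for this its values are capped by a number of order n kept in register 2. -/

namespace WordRAM

/-! ### Runs without bounds -/

/-- `Run p σ t σ'`: started in `σ`, the program halts after `t` steps in `σ'`, with no bound on the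
words and the array indices. -/
inductive Run : Prog → State → ℕ → State → Prop where
  | skip (σ : State) : Run .skip σ 1 σ
  | assign (σ : State) (x : ℕ) (e : Expr) : Run (.assign x e) σ (e.cost + 1) (σ.setReg x (e.val σ))
  | store (σ : State) (a : ℕ) (i e : Expr) :
      Run (.store a i e) σ (i.cost + e.cost + 1) (σ.setArr a (i.val σ) (e.val σ))
  | seq (p q : Prog) (σ τ ρ : State) (s t : ℕ) (hp : Run p σ s τ) (hq : Run q τ t ρ) :
      Run (.seq p q) σ (s + t) ρ
  | condTrue (b : Expr) (p q : Prog) (σ τ : State) (t : ℕ) (h : b.val σ ≠ 0)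
      (hp : Run p σ t τ) : Run (.cond b p q) σ (b.cost + 1 + t) τ
  | condFalse (b : Expr) (p q : Prog) (σ τ : State) (t : ℕ) (h : b.val σ = 0)
      (hq : Run q σ t τ) : Run (.cond b p q) σ (b.cost + 1 + t) τ
  | loopTrue (b : Expr) (p : Prog) (σ τ ρ : State) (s t : ℕ) (h : b.val σ ≠ 0)
      (hp : Run p σ s τ) (hl : Run (.loop b p) τ t ρ) :
      Run (.loop b p) σ (b.cost + 1 + s + t) ρ
  | loopFalse (b : Expr) (p : Prog) (σ : State) (h : b.val σ = 0) :
      Run (.loop b p) σ (b.cost + 1) σ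

/-! ### Syntactic bounds on the values -/

namespace Expr

/-- A lower bound for the value. -/
def lo : Expr → ℕ
  | const c => c
  | _ => 0

/-- An upper bound for the value if the memory holds numbers up to `M`. -/
def bd (M : ℕ) : Expr → ℕ
  | const c => c
  | reg _ => M
  | get _ _ => M
  | op .add e f => e.bd M + f.bd M
  | op .sub e _ => e.bd M
  | op .mul e f => e.bd M * f.bd M
  -- A constant divisor has to count: the length `(reg 4 + 2) / 3 * 2` of a reduced text must get a
  -- bound of at most M + 2. Otherwise 1 is used, which is sound even for the divisor 0, where the
  -- quotient is 0.
  | op .div e f => e.bd M / max 1 f.lo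
  | op .mod e _ => e.bd M
  | op .lt _ _ => 1
  | op .eq _ _ => 1

/-- All array indices are at most linear in the numbers that the memory holds. -/
def Safe (L : ℕ) : Expr → Prop
  | const _ => True
  | reg _ => True
  | get _ e => e.Safe L ∧ ∀ M, e.bd M ≤ L * (M + 1)
  | op _ e f => e.Safe L ∧ f.Safe L

/-- An exponent that bounds all intermediate values. -/
def wt : Expr → ℕ
  | const c => c + 1
  | reg _ => 1
  | get _ e => e.wt
  | op _ e f => e.wt + f.wt

theorem one_le_wt (e : Expr) : 1 ≤ e.wt := by
  induction e <;> simp_all [wt]; omega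

end Expr

/-- All cells hold numbers up to `M`. -/
def Bounded (σ : State) (M : ℕ) : Prop := (∀ x, σ.reg x ≤ M) ∧ ∀ a i, σ.arr a i ≤ M

theorem Bounded.mono {σ : State} {M M' : ℕ} (h : Bounded σ M) (hM : M ≤ M') : Bounded σ M' :=
  ⟨fun x => (h.1 x).trans hM, fun a i => (h.2 a i).trans hM⟩

namespace Expr

theorem lo_le_val (σ : State) (e : Expr) : e.lo ≤ e.val σ := by
  cases e <;> simp [lo, val]

theorem val_le_bd {σ : State} {M : ℕ} (h : Bounded σ M) (e : Expr) : e.val σ ≤ e.bd M := by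
  induction e with
  | const c => simp [val, bd]
  | reg x => simpa [val, bd] using h.1 x
  | get a e _ => simpa [val, bd] using h.2 a _
  | op o e f he hf =>
    cases o with
    | add => simp only [val, bd, Op.apply]; omega
    | sub => simp only [val, bd, Op.apply]; omega
    | mul => simp only [val, bd, Op.apply]; exact Nat.mul_le_mul he hf
    | div =>
      simp only [val, bd, Op.apply]
      rcases Nat.eq_zero_or_pos (f.val σ) with h0 | h0
      · simp [h0]
      · exact Nat.div_le_div he (max_le h0 (lo_le_val σ f)) (by positivity)
    | mod => simp only [val, bd, Op.apply]; exact (Nat.mod_le _ _).trans he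
    | lt => simp only [val, bd, Op.apply]; split <;> simp
    | eq => simp only [val, bd, Op.apply]; split <;> simp

/-- Powers of M + 2 with positive exponent are at least 2, and for two numbers of size at least 2
the sum is at most the product. So an exponent that adds up over operations serves additions and
multiplications alike. -/
theorem val_le_pow {σ : State} {M : ℕ} (h : Bounded σ M) (e : Expr) :
    e.val σ ≤ (M + 2) ^ e.wt := by
  have key : ∀ a b : ℕ, 1 ≤ a → 1 ≤ b →
      (M + 2) ^ a + (M + 2) ^ b ≤ (M + 2) ^ (a + b) := by
    intro a b ha hb
    have h1 : 2 ≤ (M + 2) ^ a := by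
      calc 2 ≤ M + 2 := by omega
        _ ≤ _ := Nat.le_self_pow (by omega) _
    have h2 : 2 ≤ (M + 2) ^ b := by
      calc 2 ≤ M + 2 := by omega
        _ ≤ _ := Nat.le_self_pow (by omega) _
    rw [pow_add]
    nlinarith
  induction e with
  | const c =>
    simp only [val, wt]
    calc c ≤ 2 ^ c := Nat.lt_two_pow_self.le
      _ ≤ (M + 2) ^ c := Nat.pow_le_pow_left (by omega) c
      _ ≤ _ := Nat.pow_le_pow_right (by omega) (by omega)
  | reg x => simp only [val, wt, pow_one]; have := h.1 x; omega
  | get a e _ =>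
    simp only [val, wt]
    have h1 : M + 2 ≤ (M + 2) ^ e.wt := Nat.le_self_pow (by have := e.one_le_wt; omega) _
    have := h.2 a (e.val σ)
    omega
  | op o e f he hf =>
    have hk := key _ _ e.one_le_wt f.one_le_wt
    simp only [val, wt]
    cases o with
    | add => simp only [Op.apply]; omega
    | sub => simp only [Op.apply]; omega
    | mul => simp only [Op.apply]; rw [pow_add]; exact Nat.mul_le_mul he hf
    | div => simp only [Op.apply]; have := Nat.div_le_self (e.val σ) (f.val σ); omega
    | mod => simp only [Op.apply]; have := Nat.mod_le (e.val σ) (f.val σ); omega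
    | lt =>
      simp only [Op.apply]
      have := Nat.one_le_pow (e.wt + f.wt) (M + 2) (by omega)
      split <;> omega
    | eq =>
      simp only [Op.apply]
      have := Nat.one_le_pow (e.wt + f.wt) (M + 2) (by omega)
      split <;> omega

/-- The two bounds differ in strength. Intermediate values may be polynomial in M, because W may be
a large power; indices have to be linear in M, because S is paid for as space. -/
theorem ok_of_safe {σ : State} {M W S L : ℕ} (h : Bounded σ M) (e : Expr) (hs : e.Safe L)
    (hW : (M + 2) ^ e.wt < W) (hS : L * (M + 1) < S) : e.Ok W S σ := by
  induction e with
  | const c => exact (val_le_pow h (const c)).trans_lt hW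
  | reg x => exact (val_le_pow h (reg x)).trans_lt hW
  | get a e ih =>
    exact ⟨ih hs.1 hW, ((val_le_bd h e).trans (hs.2 M)).trans_lt hS,
      (val_le_pow h (get a e)).trans_lt hW⟩
  | op o e f he hf =>
    refine ⟨he hs.1 (lt_of_le_of_lt ?_ hW), hf hs.2 (lt_of_le_of_lt ?_ hW),
      (val_le_pow h (op o e f)).trans_lt hW⟩
    · exact Nat.pow_le_pow_right (by omega) (by simp [wt])
    · exact Nat.pow_le_pow_right (by omega) (by simp [wt])

end Expr

namespace Prog

/-- Every stored value exceeds the largest number in the memory by at most `g`, and array indices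
are at most linear in that number. -/
def Tame (g L : ℕ) : Prog → Prop
  | skip => True
  | assign _ e => e.Safe L ∧ ∀ M, e.bd M ≤ M + g
  | store _ i e => i.Safe L ∧ e.Safe L ∧ (∀ M, i.bd M ≤ L * (M + 1)) ∧ ∀ M, e.bd M ≤ M + g
  | seq p q => p.Tame g L ∧ q.Tame g L
  | cond b p q => b.Safe L ∧ p.Tame g L ∧ q.Tame g L
  | loop b p => b.Safe L ∧ p.Tame g L

/-- An exponent that bounds all intermediate values. -/
def wt : Prog → ℕ
  | skip => 0
  | assign _ e => e.wt
  | store _ i e => i.wt + e.wt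
  | seq p q => p.wt + q.wt
  | cond b p q => b.wt + p.wt + q.wt
  | loop b p => b.wt + p.wt

end Prog

theorem State.bounded_setReg {σ : State} {M x v : ℕ} (h : Bounded σ M) (hv : v ≤ M) :
    Bounded (σ.setReg x v) M := by
  refine ⟨fun y => ?_, h.2⟩
  by_cases hy : y = x
  · subst hy; simpa [State.setReg] using hv
  · simpa [State.setReg, hy] using h.1 y

theorem State.bounded_setArr {σ : State} {M a i v : ℕ} (h : Bounded σ M) (hv : v ≤ M) :
    Bounded (σ.setArr a i v) M := by
  refine ⟨h.1, fun b j => ?_⟩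
  by_cases hb : b = a
  · subst hb
    by_cases hj : j = i
    · subst hj; simpa [State.setArr] using hv
    · simpa [State.setArr, hj] using h.2 b j
  · simpa [State.setArr, hb] using h.2 b j

/-- A run of a tame program stays within bounds that grow linearly with the time. -/
theorem Run.exec {p : Prog} {σ σ' : State} {t : ℕ} (h : Run p σ t σ') {g L M M' W S : ℕ}
    (hT : p.Tame g L) (hb : Bounded σ M) (hM : M + g * t ≤ M') (hW : (M' + 2) ^ p.wt < W)
    (hS : L * (M' + 1) < S) : Exec W S p σ t σ' ∧ Bounded σ' (M + g * t) := by
  have ok : ∀ {σ : State} {M : ℕ} (e : Expr), e.Safe L → Bounded σ M → M ≤ M' →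
      ∀ w, (M' + 2) ^ w < W → e.wt ≤ w → e.Ok W S σ := by
    intro σ M e hs hb hM w hw hew
    refine Expr.ok_of_safe (hb.mono hM) e hs (lt_of_le_of_lt ?_ hw) hS
    exact Nat.pow_le_pow_right (by omega) hew
  have pw : ∀ {a b : ℕ}, (M' + 2) ^ b < W → a ≤ b → (M' + 2) ^ a < W := by
    intro a b hb hab
    exact lt_of_le_of_lt (Nat.pow_le_pow_right (by omega) hab) hb
  -- M is the bound for the memory at the start of a subrun and grows along the run, while M' is one
  -- fixed bound for the whole run, from which W and S are measured.
  induction h generalizing M with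
  | skip σ => exact ⟨.skip σ, hb.mono (by omega)⟩
  | assign σ x e =>
    refine ⟨.assign σ x e (ok e hT.1 hb (by omega) _ hW le_rfl), ?_⟩
    refine State.bounded_setReg (hb.mono (by omega)) ?_
    have h1 := (Expr.val_le_bd hb e).trans (hT.2 M)
    -- Every write takes at least one step, and this step pays for the growth g.
    have : g ≤ g * (e.cost + 1) := Nat.le_mul_of_pos_right _ (by omega)
    omega
  | store σ a i e =>
    have hMM : M ≤ M' := by omega
    refine ⟨.store σ a i e (ok i hT.1 hb hMM _ hW (by simp [Prog.wt]))
      (ok e hT.2.1 hb hMM _ hW (by simp [Prog.wt])) ?_, ?_⟩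
    · exact ((Expr.val_le_bd (hb.mono hMM) i).trans (hT.2.2.1 M')).trans_lt hS
    · refine State.bounded_setArr (hb.mono (by omega)) ?_
      have h1 := (Expr.val_le_bd hb e).trans (hT.2.2.2 M)
      have : g ≤ g * (i.cost + e.cost + 1) := Nat.le_mul_of_pos_right _ (by omega)
      omega
  | seq p q σ τ ρ s t _ _ ihp ihq =>
    rw [Nat.mul_add] at hM
    obtain ⟨h1, h2⟩ := ihp hT.1 hb (by omega) (pw hW (by simp [Prog.wt]))
    obtain ⟨h3, h4⟩ := ihq hT.2 h2 (by omega) (pw hW (by simp [Prog.wt]))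
    exact ⟨.seq _ _ _ _ _ _ _ h1 h3, h4.mono (by rw [Nat.mul_add]; omega)⟩
  | condTrue b p q σ τ t h _ ih =>
    rw [Nat.mul_add] at hM
    obtain ⟨h1, h2⟩ := ih hT.2.1 hb (by omega) (pw hW (by simp [Prog.wt]; omega))
    exact ⟨.condTrue _ _ _ _ _ _ (ok b hT.1 hb (by omega) _ hW (by simp [Prog.wt]; omega)) h h1,
      h2.mono (by rw [Nat.mul_add]; omega)⟩
  | condFalse b p q σ τ t h _ ih =>
    rw [Nat.mul_add] at hM
    obtain ⟨h1, h2⟩ := ih hT.2.2 hb (by omega) (pw hW (by simp [Prog.wt]))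
    exact ⟨.condFalse _ _ _ _ _ _ (ok b hT.1 hb (by omega) _ hW (by simp [Prog.wt]; omega)) h h1,
      h2.mono (by rw [Nat.mul_add]; omega)⟩
  | loopTrue b p σ τ ρ s t h _ _ ihp ihl =>
    rw [Nat.mul_add, Nat.mul_add] at hM
    obtain ⟨h1, h2⟩ := ihp hT.2 hb (by omega) (pw hW (by simp [Prog.wt]))
    obtain ⟨h3, h4⟩ := ihl hT h2 (by omega) hW
    exact ⟨.loopTrue _ _ _ _ _ _ _ (ok b hT.1 hb (by omega) _ hW (by simp [Prog.wt])) h h1 h3,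
      h4.mono (by rw [Nat.mul_add, Nat.mul_add]; omega)⟩
  | loopFalse b p σ h =>
    exact ⟨.loopFalse _ _ _ (ok b hT.1 hb (by omega) _ hW (by simp [Prog.wt])) h,
      hb.mono (by omega)⟩

/-! ### Total correctness with a time bound -/

namespace Prog

/-- Whether the program writes to the register `x`. -/
def writesReg (x : ℕ) : Prog → Bool
  | skip => false
  | assign y _ => y == x
  | store _ _ _ => false
  | seq p q => p.writesReg x || q.writesReg x
  | cond _ p q => p.writesReg x || q.writesReg x
  | loop _ p => p.writesReg x

/-- Whether the program writes to the array `a`. -/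
def writesArr (a : ℕ) : Prog → Bool
  | skip => false
  | assign _ _ => false
  | store b _ _ => b == a
  | seq p q => p.writesArr a || q.writesArr a
  | cond _ p q => p.writesArr a || q.writesArr a
  | loop _ p => p.writesArr a

/-- The final state of a program without loops. -/
def eval : Prog → State → State
  | skip, σ => σ
  | assign x e, σ => σ.setReg x (e.val σ)
  | store a i e, σ => σ.setArr a (i.val σ) (e.val σ)
  | seq p q, σ => q.eval (p.eval σ)
  | cond b p q, σ => if b.val σ ≠ 0 then p.eval σ else q.eval σ
  -- A default value: `eval` is applied only to programs without loops.
  | loop _ _, σ => σ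

/-- Whether the program has no loops. -/
def loopFree : Prog → Bool
  | skip => true
  | assign _ _ => true
  | store _ _ _ => true
  | seq p q => p.loopFree && q.loopFree
  | cond _ p q => p.loopFree && q.loopFree
  | loop _ _ => false

/-- A bound for the time of a program without loops. -/
def maxCost : Prog → ℕ
  | skip => 1
  | assign _ e => e.cost + 1
  | store _ i e => i.cost + e.cost + 1
  | seq p q => p.maxCost + q.maxCost
  | cond b p q => b.cost + 1 + p.maxCost + q.maxCost
  | loop _ _ => 0

end Prog

/-- The states `σ` and `τ` agree on all that the program `p` does not write. -/
structure Frame (p : Prog) (σ τ : State) : Prop where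
  reg : ∀ x, p.writesReg x = false → τ.reg x = σ.reg x
  arr : ∀ a, p.writesArr a = false → τ.arr a = σ.arr a

theorem Frame.refl (p : Prog) (σ : State) : Frame p σ σ := ⟨fun _ _ => rfl, fun _ _ => rfl⟩

theorem Frame.trans {p : Prog} {σ τ ρ : State} (h : Frame p σ τ) (h' : Frame p τ ρ) :
    Frame p σ ρ :=
  ⟨fun x hx => (h'.reg x hx).trans (h.reg x hx), fun a ha => (h'.arr a ha).trans (h.arr a ha)⟩

theorem Frame.weaken {p q : Prog} {σ τ : State} (h : Frame p σ τ)
    (h1 : ∀ x, q.writesReg x = false → p.writesReg x = false)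
    (h2 : ∀ a, q.writesArr a = false → p.writesArr a = false) : Frame q σ τ :=
  ⟨fun x hx => h.reg x (h1 x hx), fun a ha => h.arr a (h2 a ha)⟩

/-- Both `writesReg` and `writesArr` compute, so that the persistence of a register or an array
across a program is proved by `rfl`. -/
theorem Run.frame {p : Prog} {σ σ' : State} {t : ℕ} (h : Run p σ t σ') : Frame p σ σ' := by
  induction h with
  | skip σ => exact .refl _ _
  | assign σ x e =>
    refine ⟨fun y hy => ?_, fun _ _ => rfl⟩
    have : y ≠ x := by rintro rfl; simp [Prog.writesReg] at hy
    simp [State.setReg, this]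
  | store σ a i e =>
    refine ⟨fun _ _ => rfl, fun b hb => ?_⟩
    have : b ≠ a := by rintro rfl; simp [Prog.writesArr] at hb
    simp [State.setArr, this]
  | seq p q σ τ ρ s t _ _ ihp ihq =>
    exact (ihp.weaken (by simp +contextual [Prog.writesReg])
      (by simp +contextual [Prog.writesArr])).trans
      (ihq.weaken (by simp +contextual [Prog.writesReg]) (by simp +contextual [Prog.writesArr]))
  | condTrue b p q σ τ t h _ ih =>
    exact ih.weaken (by simp +contextual [Prog.writesReg]) (by simp +contextual [Prog.writesArr])
  | condFalse b p q σ τ t h _ ih =>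
    exact ih.weaken (by simp +contextual [Prog.writesReg]) (by simp +contextual [Prog.writesArr])
  | loopTrue b p σ τ ρ s t h _ _ ihp ihl =>
    exact (ihp.weaken (by simp [Prog.writesReg]) (by simp [Prog.writesArr])).trans ihl
  | loopFalse b p σ h => exact .refl _ _

/-- Started in `σ`, the program `p` halts after at most `T` steps in a state that satisfies `Q`. -/
def Tri (p : Prog) (T : ℕ) (σ : State) (Q : State → Prop) : Prop :=
  ∃ t τ, Run p σ t τ ∧ t ≤ T ∧ Q τ

namespace Tri

variable {p q : Prog} {T T' : ℕ} {σ : State} {Q Q' : State → Prop}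

/-- The rule of consequence supplies the frame, so specifications only need to mention the cells
that change. -/
theorem mono (h : Tri p T σ Q) (hT : T ≤ T') (hQ : ∀ τ, Frame p σ τ → Q τ → Q' τ) :
    Tri p T' σ Q' := by
  obtain ⟨t, τ, h1, h2, h3⟩ := h
  exact ⟨t, τ, h1, h2.trans hT, hQ τ h1.frame h3⟩

theorem imp (h : Tri p T σ Q) (hQ : ∀ τ, Frame p σ τ → Q τ → Q' τ) : Tri p T σ Q' :=
  h.mono le_rfl hQ

theorem le (h : Tri p T σ Q) (hT : T ≤ T') : Tri p T' σ Q := h.mono hT fun _ _ h => h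

theorem seq {T₁ T₂ : ℕ} (h : Tri p T₁ σ fun τ => Tri q T₂ τ Q) :
    Tri (.seq p q) (T₁ + T₂) σ Q := by
  obtain ⟨s, τ, h1, h2, t, ρ, h3, h4, h5⟩ := h
  exact ⟨s + t, ρ, .seq _ _ _ _ _ _ _ h1 h3, by omega, h5⟩

theorem assign {x : ℕ} {e : Expr} (h : Q (σ.setReg x (e.val σ))) :
    Tri (.assign x e) (e.cost + 1) σ Q :=
  ⟨_, _, .assign σ x e, le_rfl, h⟩

/-- Code without loops needs no reasoning about runs: the final state is obtained by simplifying
`eval`, and the time by computing `maxCost`. -/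
theorem straight (h : p.loopFree = true) (hT : p.maxCost ≤ T) (hQ : Q (p.eval σ)) :
    Tri p T σ Q := by
  refine le ?_ hT
  suffices H : ∀ σ, ∃ t, Run p σ t (p.eval σ) ∧ t ≤ p.maxCost by
    obtain ⟨t, h1, h2⟩ := H σ
    exact ⟨t, _, h1, h2, hQ⟩
  clear hQ hT
  induction p with
  | skip => exact fun σ => ⟨_, .skip σ, le_rfl⟩
  | assign x e => exact fun σ => ⟨_, .assign σ x e, le_rfl⟩
  | store a i e => exact fun σ => ⟨_, .store σ a i e, le_rfl⟩
  | seq p q ihp ihq =>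
    intro σ
    simp only [Prog.loopFree, Bool.and_eq_true] at h
    obtain ⟨s, h1, h2⟩ := ihp h.1 σ
    obtain ⟨t, h3, h4⟩ := ihq h.2 (p.eval σ)
    exact ⟨s + t, .seq _ _ _ _ _ _ _ h1 h3, by simp only [Prog.maxCost]; omega⟩
  | cond b p q ihp ihq =>
    intro σ
    simp only [Prog.loopFree, Bool.and_eq_true] at h
    by_cases hb : b.val σ = 0
    · obtain ⟨t, h3, h4⟩ := ihq h.2 σ
      refine ⟨_, .condFalse _ _ _ _ _ t hb ?_, ?_⟩
      · simpa [Prog.eval, hb] using h3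
      · simp only [Prog.maxCost]; omega
    · obtain ⟨t, h3, h4⟩ := ihp h.1 σ
      refine ⟨_, .condTrue _ _ _ _ _ t hb ?_, ?_⟩
      · simpa [Prog.eval, hb] using h3
      · simp only [Prog.maxCost]; omega
  | loop b p _ => simp [Prog.loopFree] at h

/-- A loop with an invariant and a potential that pays for the time. -/
theorem loop {b : Expr} (I : State → Prop) (pot : State → ℕ) (h0 : I σ)
    (hstep : ∀ τ, Frame p σ τ → I τ → b.val τ ≠ 0 →
      ∃ T, Tri p T τ fun ρ => I ρ ∧ pot ρ + T + b.cost + 1 ≤ pot τ)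
    (hQ : ∀ τ, Frame p σ τ → I τ → b.val τ = 0 → Q τ) :
    Tri (.loop b p) (pot σ + b.cost + 1) σ Q := by
  -- Induction on a bound for the potential. It drops strictly in every round, because the test of
  -- the condition alone costs a step; with potential 0 no round is possible.
  suffices H : ∀ (m : ℕ) (τ : State), pot τ ≤ m → Frame p σ τ → I τ →
      Tri (.loop b p) (pot τ + b.cost + 1) τ Q from H _ σ le_rfl (.refl _ _) h0
  intro m
  induction m with
  | zero =>
    intro τ hm hf hI
    by_cases hb : b.val τ = 0
    · exact ⟨_, τ, .loopFalse _ _ _ hb, by omega, hQ τ hf hI hb⟩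
    · obtain ⟨T, t, ρ, -, -, -, h⟩ := hstep τ hf hI hb
      omega
  | succ m ih =>
    intro τ hm hf hI
    by_cases hb : b.val τ = 0
    · exact ⟨_, τ, .loopFalse _ _ _ hb, by omega, hQ τ hf hI hb⟩
    · obtain ⟨T, t, ρ, h1, h2, h3, h4⟩ := hstep τ hf hI hb
      obtain ⟨t', ρ', h5, h6, h7⟩ := ih ρ (by omega) (hf.trans h1.frame) h3
      exact ⟨_, ρ', .loopTrue _ _ _ _ _ _ _ hb h1 h5, by omega, h7⟩

end Tri

/-! ### Notation for programs -/

instance : Add Expr := ⟨Expr.op .add⟩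
instance : Sub Expr := ⟨Expr.op .sub⟩
instance : Mul Expr := ⟨Expr.op .mul⟩
instance : Div Expr := ⟨Expr.op .div⟩
instance : Mod Expr := ⟨Expr.op .mod⟩
instance (c : ℕ) : OfNat Expr c := ⟨Expr.const c⟩

namespace Expr

/-- The comparison `e < f`. -/
def lt (e f : Expr) : Expr := op .lt e f
/-- The comparison `e = f`. -/
def eq (e f : Expr) : Expr := op .eq e f

variable (σ : State) (e f : Expr) (M L : ℕ)

@[simp] theorem val_const (c : ℕ) : (const c).val σ = c := rfl
@[simp] theorem val_reg (x : ℕ) : (reg x).val σ = σ.reg x := rfl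
@[simp] theorem val_get (a : ℕ) : (get a e).val σ = σ.arr a (e.val σ) := rfl
@[simp] theorem val_add : (e + f).val σ = e.val σ + f.val σ := rfl
@[simp] theorem val_sub : (e - f).val σ = e.val σ - f.val σ := rfl
@[simp] theorem val_mul : (e * f).val σ = e.val σ * f.val σ := rfl
@[simp] theorem val_div : (e / f).val σ = e.val σ / f.val σ := rfl
@[simp] theorem val_mod : (e % f).val σ = e.val σ % f.val σ := rfl
@[simp] theorem val_lt : (lt e f).val σ = if e.val σ < f.val σ then 1 else 0 := rfl
@[simp] theorem val_eq : (eq e f).val σ = if e.val σ = f.val σ then 1 else 0 := rfl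
@[simp] theorem val_ofNat (c : ℕ) : (no_index (OfNat.ofNat c : Expr)).val σ = c := rfl

@[simp] theorem bd_const (c : ℕ) : (const c).bd M = c := rfl
@[simp] theorem bd_reg (x : ℕ) : (reg x).bd M = M := rfl
@[simp] theorem bd_get (a : ℕ) : (get a e).bd M = M := rfl
@[simp] theorem bd_add : (e + f).bd M = e.bd M + f.bd M := rfl
@[simp] theorem bd_sub : (e - f).bd M = e.bd M := rfl
@[simp] theorem bd_mul : (e * f).bd M = e.bd M * f.bd M := rfl
@[simp] theorem bd_div : (e / f).bd M = e.bd M / max 1 f.lo := rfl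
@[simp] theorem bd_mod : (e % f).bd M = e.bd M := rfl
@[simp] theorem bd_lt : (lt e f).bd M = 1 := rfl
@[simp] theorem bd_eq : (eq e f).bd M = 1 := rfl
@[simp] theorem bd_ofNat (c : ℕ) : (no_index (OfNat.ofNat c : Expr)).bd M = c := rfl
@[simp] theorem lo_ofNat (c : ℕ) : (no_index (OfNat.ofNat c : Expr)).lo = c := rfl
@[simp] theorem lo_reg (x : ℕ) : (reg x).lo = 0 := rfl

@[simp] theorem safe_const (c : ℕ) : (const c).Safe L ↔ True := Iff.rfl
@[simp] theorem safe_reg (x : ℕ) : (reg x).Safe L ↔ True := Iff.rfl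
@[simp] theorem safe_get (a : ℕ) :
    (get a e).Safe L ↔ e.Safe L ∧ ∀ M, e.bd M ≤ L * (M + 1) := Iff.rfl
@[simp] theorem safe_add : (e + f).Safe L ↔ e.Safe L ∧ f.Safe L := Iff.rfl
@[simp] theorem safe_sub : (e - f).Safe L ↔ e.Safe L ∧ f.Safe L := Iff.rfl
@[simp] theorem safe_mul : (e * f).Safe L ↔ e.Safe L ∧ f.Safe L := Iff.rfl
@[simp] theorem safe_div : (e / f).Safe L ↔ e.Safe L ∧ f.Safe L := Iff.rfl
@[simp] theorem safe_mod : (e % f).Safe L ↔ e.Safe L ∧ f.Safe L := Iff.rfl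
@[simp] theorem safe_lt : (lt e f).Safe L ↔ e.Safe L ∧ f.Safe L := Iff.rfl
@[simp] theorem safe_eq : (eq e f).Safe L ↔ e.Safe L ∧ f.Safe L := Iff.rfl
@[simp] theorem safe_ofNat (c : ℕ) : (no_index (OfNat.ofNat c : Expr)).Safe L ↔ True := Iff.rfl

end Expr

infixr:60 " ;; " => Prog.seq
infix:62 " ::= " => Prog.assign

@[simp] theorem State.reg_setReg (σ : State) (x v y : ℕ) :
    (σ.setReg x v).reg y = if y = x then v else σ.reg y := by
  simp [State.setReg, Function.update_apply]

@[simp] theorem State.arr_setReg (σ : State) (x v : ℕ) : (σ.setReg x v).arr = σ.arr := rfl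

@[simp] theorem State.reg_setArr (σ : State) (a i v : ℕ) : (σ.setArr a i v).reg = σ.reg := rfl

@[simp] theorem State.arr_setArr (σ : State) (a i v b : ℕ) :
    (σ.setArr a i v).arr b = if b = a then Function.update (σ.arr b) i v else σ.arr b := by
  by_cases h : b = a
  · subst h; simp [State.setArr]
  · simp [State.setArr, h]

/-- The loop `for i := 0, …, e - 1`. -/
def Prog.forUp (i : ℕ) (e : Expr) (p : Prog) : Prog :=
  i ::= 0 ;; .loop (Expr.lt (.reg i) e) (p ;; i ::= .reg i + 1)

/-- The surcharge of 20 per round covers the increment (4 steps) and the test (at most 13, as `e`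
costs at most 10). The additional round in N + 1 covers the initialisation and the last test. -/
theorem Tri.forUp {i : ℕ} {e : Expr} {p : Prog} {σ : State} {Q : State → Prop} (N T : ℕ)
    (I : ℕ → State → Prop) (he : e.cost ≤ 10) (hi : p.writesReg i = false)
    (hN : ∀ τ, Frame (.forUp i e p) σ τ → e.val τ = N)
    (h0 : I 0 (σ.setReg i 0))
    (hstep : ∀ v τ, v < N → τ.reg i = v → Frame (.forUp i e p) σ τ → I v τ →
      Tri p T τ fun ρ => I (v + 1) (ρ.setReg i (v + 1)))
    (hQ : ∀ τ, τ.reg i = N → Frame (.forUp i e p) σ τ → I N τ → Q τ) :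
    Tri (.forUp i e p) ((N + 1) * (T + 20)) σ Q := by
  have hfr : ∀ τ, Frame (p ;; i ::= .reg i + 1) (σ.setReg i 0) τ → Frame (.forUp i e p) σ τ := by
    intro τ h
    refine ⟨fun x hx => ?_, fun a ha => ?_⟩
    · simp only [Prog.forUp, Prog.writesReg, Bool.or_eq_false_iff] at hx
      rw [h.reg x (by simp [Prog.writesReg, hx])]
      have : x ≠ i := by rintro rfl; simp at hx
      simp [this]
    · simp only [Prog.forUp, Prog.writesArr, Bool.or_eq_false_iff] at ha
      rw [h.arr a (by simp [Prog.writesArr, ha])]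
      simp
  have hle : 1 + 1 + ((N - (σ.setReg i 0).reg i) * (T + 20) +
      (Expr.lt (.reg i) e).cost + 1) ≤ (N + 1) * (T + 20) := by
    simp only [State.reg_setReg, if_true, Nat.sub_zero, Expr.lt, Expr.cost, Nat.add_mul, one_mul]
    omega
  refine Tri.le (Tri.seq (Tri.assign (e := 0) (Tri.loop
    (fun τ => τ.reg i ≤ N ∧ I (τ.reg i) τ) (fun τ => (N - τ.reg i) * (T + 20))
    ?_ ?_ ?_))) hle
  · simpa using h0
  · rintro τ hf ⟨h1, h2⟩ hb
    have hf' := hfr τ hf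
    have hlt : τ.reg i < N := by
      have := hN τ hf'
      by_contra hcon
      exact hb (by simp [this, hcon])
    refine ⟨T + 4, Tri.seq (T₂ := 4) ((hstep _ τ hlt rfl hf' h2).imp fun ρ hfρ h3 => ?_)⟩
    have hρ : ρ.reg i = τ.reg i := hfρ.reg i hi
    refine Tri.assign (e := .reg i + 1) ?_
    simp only [Expr.val_add, Expr.val_reg, Expr.val_ofNat, State.reg_setReg, if_true, hρ]
    refine ⟨⟨hlt, h3⟩, ?_⟩
    have : N - τ.reg i = (N - (τ.reg i + 1)) + 1 := by omega
    rw [this, Nat.add_mul]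
    simp only [Expr.lt, Expr.cost]
    omega
  · rintro τ hf ⟨h1, h2⟩ hb
    have hf' := hfr τ hf
    have : τ.reg i = N := by
      have := hN τ hf'
      simp [this] at hb
      omega
    exact hQ τ this hf' (this ▸ h2)

open Prog WordRAM.Expr

/-! ### Stable counting sort -/

/-- `ρ` lists the numbers below `m` sorted by their keys, with ties in increasing order. -/
structure IsStableSort (key : ℕ → ℕ) (m : ℕ) (ρ : ℕ → ℕ) : Prop where
  lt : ∀ j < m, ρ j < m
  mono : ∀ i j, i < j → j < m → key (ρ i) < key (ρ j) ∨ key (ρ i) = key (ρ j) ∧ ρ i < ρ j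

theorem surj_of_inj {m : ℕ} {ρ : ℕ → ℕ} (h : ∀ j < m, ρ j < m)
    (hi : ∀ i j, i < j → j < m → ρ i ≠ ρ j) {t : ℕ} (ht : t < m) : ∃ j < m, ρ j = t := by
  have := Finset.surj_on_of_inj_on_of_card_le (s := Finset.range m) (t := Finset.range m)
    (fun j _ => ρ j) (fun j hj => by simpa using h j (by simpa using hj))
    (fun i j hi' hj' hij => by
      rcases lt_trichotomy i j with hlt | heq | hlt
      · exact absurd hij (hi i j hlt (by simpa using hj'))
      · exact heq
      · exact absurd hij.symm (hi j i hlt (by simpa using hi'))) le_rfl t (by simpa using ht)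
  obtain ⟨j, hj, h⟩ := this
  exact ⟨j, by simpa using hj, h.symm⟩

theorem IsStableSort.inj {key : ℕ → ℕ} {m : ℕ} {ρ : ℕ → ℕ} (h : IsStableSort key m ρ) :
    ∀ i j, i < j → j < m → ρ i ≠ ρ j := by
  intro i j hij hj heq
  have := h.mono i j hij hj
  rw [heq] at this
  omega

theorem IsStableSort.surj {key : ℕ → ℕ} {m : ℕ} {ρ : ℕ → ℕ} (h : IsStableSort key m ρ) {t : ℕ}
    (ht : t < m) : ∃ j < m, ρ j = t :=
  surj_of_inj h.lt h.inj ht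

/-- How many of the first `m` keys are smaller than `w`. -/
def ltCount (key : ℕ → ℕ) (m w : ℕ) : ℕ := ((Finset.range m).filter (key · < w)).card

/-- How many of the first `m` keys equal `w`. -/
def eqCount (key : ℕ → ℕ) (m w : ℕ) : ℕ := ((Finset.range m).filter (key · = w)).card

section
variable (key : ℕ → ℕ) (m w : ℕ)

@[simp] theorem eqCount_zero : eqCount key 0 w = 0 := by simp [eqCount]

theorem eqCount_succ : eqCount key (m + 1) w = eqCount key m w + if key m = w then 1 else 0 := by
  unfold eqCount
  rw [Finset.range_add_one, Finset.filter_insert]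
  split <;> simp

@[simp] theorem ltCount_zero : ltCount key m 0 = 0 := by simp [ltCount]

theorem ltCount_succ : ltCount key m (w + 1) = ltCount key m w + eqCount key m w := by
  unfold ltCount eqCount
  rw [← Finset.card_union_of_disjoint]
  · congr 1; ext t; simp; omega
  · rw [Finset.disjoint_filter]; intros; omega

theorem ltCount_le : ltCount key m w ≤ m := by
  simpa [ltCount] using Finset.card_filter_le (Finset.range m) (key · < w)

theorem ltCount_mono {w w' : ℕ} (h : w ≤ w') : ltCount key m w ≤ ltCount key m w' := by
  apply Finset.card_le_card
  intro t; simp; omega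

theorem eqCount_mono {m m' : ℕ} (h : m ≤ m') : eqCount key m w ≤ eqCount key m' w := by
  apply Finset.card_le_card
  intro t; simp; omega

/-- The position of the item `t` after a stable sort. -/
def sortPos (t : ℕ) : ℕ := ltCount key m (key t) + eqCount key t (key t)

theorem sortPos_lt_of_eq {t t' : ℕ} (h : key t = key t') (ht : t < t') :
    sortPos key m t < sortPos key m t' := by
  have h1 := eqCount_mono key (key t) (show t + 1 ≤ t' from ht)
  rw [eqCount_succ, if_pos rfl] at h1
  simp only [sortPos, ← h]
  omega

theorem sortPos_lt_of_lt {t t' : ℕ} (ht : t < m) (h : key t < key t') :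
    sortPos key m t < sortPos key m t' := by
  have h1 := eqCount_mono key (key t) (show t + 1 ≤ m from ht)
  rw [eqCount_succ, if_pos rfl] at h1
  have h2 := ltCount_mono key m (show key t + 1 ≤ key t' from h)
  rw [ltCount_succ] at h2
  simp only [sortPos]
  omega

theorem sortPos_lt {t : ℕ} (ht : t < m) : sortPos key m t < m := by
  have h1 := eqCount_mono key (key t) (show t + 1 ≤ m from ht)
  rw [eqCount_succ, if_pos rfl] at h1
  have h2 := ltCount_le key m (key t + 1)
  rw [ltCount_succ] at h2
  simp only [sortPos]
  omega

/-- `sortPos` separates any two items, by their keys or, for equal keys, by their indices; being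
injective it permutes the numbers below m, and ρ is its inverse. The second conjunct links ρ to the
cells into which a counting sort writes. -/
theorem exists_isStableSort :
    ∃ ρ, IsStableSort key m ρ ∧ ∀ t < m, ρ (sortPos key m t) = t := by
  have hsurj : ∀ j : ℕ, ∃ t, j < m → t < m ∧ sortPos key m t = j := by
    intro j
    by_cases hj : j < m
    · obtain ⟨t, ht, h⟩ := surj_of_inj (ρ := sortPos key m) (fun t ht => sortPos_lt key m ht)
        (fun t t' htt ht' heq => by
          rcases lt_trichotomy (key t) (key t') with h | h | h
          · have := sortPos_lt_of_lt key m (htt.trans ht') h; omega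
          · have := sortPos_lt_of_eq key m h htt; omega
          · have := sortPos_lt_of_lt key m ht' h; omega) hj
      exact ⟨t, fun _ => ⟨ht, h⟩⟩
    · exact ⟨0, fun h => absurd h hj⟩
  choose ρ hρ using hsurj
  have hmono : ∀ t t', t < m → t' < m → sortPos key m t < sortPos key m t' →
      key t < key t' ∨ key t = key t' ∧ t < t' := by
    intro t t' ht ht' h
    by_contra hcon
    rcases lt_trichotomy (key t) (key t') with h1 | h1 | h1
    · exact hcon (Or.inl h1)
    · rcases lt_trichotomy t t' with h2 | h2 | h2
      · exact hcon (Or.inr ⟨h1, h2⟩)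
      · subst h2; omega
      · have := sortPos_lt_of_eq key m h1.symm h2; omega
    · have := sortPos_lt_of_lt key m ht' h1; omega
  refine ⟨ρ, ⟨fun j hj => (hρ j hj).1, fun i j hij hj => ?_⟩, fun t ht => ?_⟩
  · have hi := hρ i (by omega)
    have hj := hρ j hj
    exact hmono _ _ hi.1 hj.1 (by omega)
  · have h := hρ _ (sortPos_lt key m ht)
    rcases lt_trichotomy (ρ (sortPos key m t)) t with h2 | h2 | h2
    · have := hmono _ _ h.1 ht
      rcases lt_trichotomy (key (ρ (sortPos key m t))) (key t) with h3 | h3 | h3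
      · have := sortPos_lt_of_lt key m h.1 h3; omega
      · have := sortPos_lt_of_eq key m h3 h2; omega
      · have := sortPos_lt_of_lt key m ht h3; omega
    · exact h2
    · rcases lt_trichotomy (key (ρ (sortPos key m t))) (key t) with h3 | h3 | h3
      · have := sortPos_lt_of_lt key m h.1 h3; omega
      · have := sortPos_lt_of_eq key m h3.symm h2; omega
      · have := sortPos_lt_of_lt key m ht h3; omega

end

/-- Sorts the list in array 4, of the length in register 7, stably by the keys in array 7, which are
smaller than register 8. -/
def csort : Prog :=
  forUp 9 (reg 8 + 1) (.store 6 (reg 9) 0) ;;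
  forUp 9 (reg 7) (.store 6 (get 7 (reg 9) + 1) (get 6 (get 7 (reg 9) + 1) + 1)) ;;
  forUp 9 (reg 8)
    (.store 6 (reg 9 + 1) (reg 2 - (reg 2 - (get 6 (reg 9 + 1) + get 6 (reg 9))))) ;;
  forUp 9 (reg 7)
    (.store 5 (get 6 (get 7 (reg 9))) (get 4 (reg 9)) ;;
     .store 6 (get 7 (reg 9)) (get 6 (get 7 (reg 9)) + 1)) ;;
  forUp 9 (reg 7) (.store 4 (reg 9) (get 5 (reg 9)))

/-- The factor 8 is shared by all programs: no index exceeds 3M + 6 if the memory holds numbers up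
to M. -/
theorem csort_tame : csort.Tame 1 8 := by
  simp [csort, forUp, Tame]
  omega

/-- Array 6 successively holds zeros, the counts of the keys, the numbers of smaller keys, and
finally the next free place for each key. Items are placed in list order, which makes the sort
stable. -/
theorem csort_spec (σ : State) (m B : ℕ) (hm : σ.reg 7 = m) (hB : σ.reg 8 = B)
    (hlim : m ≤ σ.reg 2) (hkey : ∀ t < m, σ.arr 7 t < B) :
    Tri csort (200 * (m + B + 2)) σ fun τ => ∃ ρ, IsStableSort (σ.arr 7) m ρ ∧
      ∀ j < m, τ.arr 4 j = σ.arr 4 (ρ j) := by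
  set key := σ.arr 7 with hk
  obtain ⟨ρ, hρ, hρ'⟩ := exists_isStableSort key m
  have hle : (B + 1 + 1) * (10 + 20) + ((m + 1) * (20 + 20) + ((B + 1) * (20 + 20) +
      ((m + 1) * (20 + 20) + (m + 1) * (20 + 20)))) ≤ 200 * (m + B + 2) := by omega
  refine Tri.le (Tri.seq ?_) hle
  refine Tri.forUp (B + 1) 10 (fun v τ => ∀ w < v, τ.arr 6 w = 0) (by decide) (by rfl)
    (fun τ hf => by simp [hf.reg 8 rfl, hB]) (by simp) ?_ ?_
  · intro v τ hv hi hf hI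
    refine Tri.straight rfl (by decide) ?_
    intro w hw
    simp only [eval, State.arr_setReg, State.arr_setArr, if_true, val_reg, hi, val_ofNat,
      Function.update_apply]
    split_ifs with h
    · rfl
    · exact hI w (by omega)
  rintro τ₁ - hf₁ hI₁
  refine Tri.seq ?_
  -- The counts are stored one place to the right. The prefix sums then give the number of keys
  -- strictly below w in cell w.
  refine Tri.forUp m 20 (fun v τ => ∀ w ≤ B, τ.arr 6 w = eqCount (fun t => key t + 1) v w)
    (by decide) (by rfl) (fun τ hf => by simp [hf.reg 7 rfl, hf₁.reg 7 rfl, hm])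
    (by simpa using fun w hw => hI₁ w (by omega)) ?_ ?_
  · intro v τ hv hi hf hI
    have h7 : τ.arr 7 = key := by rw [hf.arr 7 rfl, hf₁.arr 7 rfl]
    refine Tri.straight rfl (by decide) ?_
    intro w hw
    simp only [eval, State.arr_setReg, State.arr_setArr, if_true, val_reg, hi, val_ofNat, h7,
      Function.update_apply, val_get, val_add, eqCount_succ]
    have := hkey v hv
    split_ifs with h h' h'
    · rw [hI _ (by omega), h]
    · omega
    · omega
    · rw [hI w hw]; rfl
  rintro τ₂ - hf₂ hI₂
  have hs : ∀ w, eqCount (fun t => key t + 1) m (w + 1) = eqCount key m w := by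
    intro w; simp [eqCount]
  refine Tri.seq ?_
  refine Tri.forUp B 20 (fun v τ => (∀ w ≤ v, τ.arr 6 w = ltCount key m w) ∧
      ∀ w, v < w → w ≤ B → τ.arr 6 w = eqCount key m (w - 1))
    (by decide) (by rfl) (fun τ hf => by simp [hf.reg 8 rfl, hf₂.reg 8 rfl, hf₁.reg 8 rfl, hB])
    ?_ ?_ ?_
  · refine ⟨fun w hw => ?_, fun w hw hw' => ?_⟩
    · obtain rfl : w = 0 := by omega
      simp only [State.arr_setReg, ltCount_zero]
      rw [hI₂ 0 (by omega)]
      simp [eqCount]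
    · obtain ⟨w, rfl⟩ : ∃ x, w = x + 1 := ⟨w - 1, by omega⟩
      simp only [State.arr_setReg]
      rw [hI₂ _ hw', hs]; simp
  · rintro v τ hv hi hf ⟨hI, hI'⟩
    have h2 : τ.reg 2 = σ.reg 2 := by rw [hf.reg 2 rfl, hf₂.reg 2 rfl, hf₁.reg 2 rfl]
    refine Tri.straight rfl (by decide) ?_
    simp only [eval, State.arr_setReg, State.arr_setArr, if_true, val_reg, hi, val_ofNat, h2,
      Function.update_apply, val_get, val_add, val_sub]
    rw [hI v le_rfl, hI' (v + 1) (by omega) (by omega)]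
    -- The truncated subtractions in the program compute a minimum with register 2. It has no
    -- effect, since the sum is at most m; its purpose is to bound the stored value syntactically.
    have h3 : eqCount key m (v + 1 - 1) + ltCount key m v = ltCount key m (v + 1) := by
      rw [ltCount_succ, Nat.add_sub_cancel]; omega
    have h4 := ltCount_le key m (v + 1)
    refine ⟨fun w hw => ?_, fun w hw hw' => ?_⟩
    · split_ifs with h
      · rw [h, h3]; omega
      · exact hI w (by omega)
    · rw [if_neg (by omega)]
      exact hI' w (by omega) hw'
  rintro τ₃ - hf₃ ⟨hI₃, -⟩
  refine Tri.seq ?_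
  -- After v items, cell w points behind the items with key w that are already placed. For the key
  -- of item v this is exactly `sortPos key m v`.
  refine Tri.forUp m 20 (fun v τ => (∀ w < B, τ.arr 6 w = ltCount key m w + eqCount key v w) ∧
      ∀ t < v, τ.arr 5 (sortPos key m t) = σ.arr 4 t)
    (by decide) (by rfl)
    (fun τ hf => by simp [hf.reg 7 rfl, hf₃.reg 7 rfl, hf₂.reg 7 rfl, hf₁.reg 7 rfl, hm])
    ?_ ?_ ?_
  · refine ⟨fun w hw => ?_, by simp⟩
    simp [hI₃ w (by omega)]
  · rintro v τ hv hi hf ⟨hI, hI'⟩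
    have h7 : τ.arr 7 = key := by rw [hf.arr 7 rfl, hf₃.arr 7 rfl, hf₂.arr 7 rfl, hf₁.arr 7 rfl]
    have h4 : τ.arr 4 = σ.arr 4 := by
      rw [hf.arr 4 rfl, hf₃.arr 4 rfl, hf₂.arr 4 rfl, hf₁.arr 4 rfl]
    refine Tri.straight rfl (by decide) ?_
    have hkv := hkey v hv
    simp [eval, hi, h7, h4, Function.update_apply, hI _ hkv, eqCount_succ]
    refine ⟨fun w hw => ?_, fun t ht => ?_⟩
    · split_ifs with h h' h'
      · rw [h]; omega
      · omega
      · omega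
      · exact hI w hw
    · split_ifs with h
      · rcases Nat.lt_or_eq_of_le ht with h' | h'
        · change sortPos key m t = sortPos key m v at h
          have h1 := hρ' t (by omega)
          rw [h, hρ' v hv] at h1
          omega
        · rw [h']
      · rcases Nat.lt_or_eq_of_le ht with h' | h'
        · exact hI' t h'
        · subst h'; exact absurd rfl h
  rintro τ₄ - hf₄ ⟨-, hI₄⟩
  refine Tri.forUp m 20 (fun v τ => ∀ j < v, τ.arr 4 j = σ.arr 4 (ρ j))
    (by decide) (by rfl) (fun τ hf => by
      simp [hf.reg 7 rfl, hf₄.reg 7 rfl, hf₃.reg 7 rfl, hf₂.reg 7 rfl, hf₁.reg 7 rfl, hm])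
    (by simp) ?_ ?_
  · rintro v τ hv hi hf hI
    have h5 : τ.arr 5 = τ₄.arr 5 := hf.arr 5 rfl
    refine Tri.straight rfl (by decide) ?_
    intro w hw
    simp only [eval, State.arr_setReg, State.arr_setArr, if_true, val_reg, hi, h5,
      Function.update_apply, val_get]
    split_ifs with h
    · subst h
      have h1 := hI₄ (ρ w) (hρ.lt w hv)
      -- ρ is known as a left inverse of `sortPos`; surjectivity makes it a right inverse.
      have h2 : sortPos key m (ρ w) = w := by
        obtain ⟨t, ht, h3⟩ := surj_of_inj (ρ := sortPos key m) (fun t ht => sortPos_lt key m ht)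
          (fun i j hij hj h => by
            have h1 := hρ' i (by omega)
            rw [h, hρ' j hj] at h1
            omega) hv
        rw [← h3, hρ' t ht]
      rw [← h1, h2]
    · exact hI w (by omega)
  · intro τ _ _ hI
    exact ⟨ρ, hρ, hI⟩

/-! ### Suffix order -/

/-- The sequence `s` holds a text of length `N`: positive letters, followed by zeros. -/
structure IsText (s : ℕ → ℕ) (N : ℕ) : Prop where
  pos : ∀ i < N, 0 < s i
  zero : ∀ i, N ≤ i → s i = 0

/-- The suffix of `s` at `i` is lexicographically smaller than the one at `j`. -/
def SufLt (s : ℕ → ℕ) (i j : ℕ) : Prop :=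
  ∃ d, (∀ e < d, s (i + e) = s (j + e)) ∧ s (i + d) < s (j + d)

theorem SufLt.irrefl {s : ℕ → ℕ} (i : ℕ) : ¬ SufLt s i i := by
  rintro ⟨d, -, h⟩
  exact lt_irrefl _ h

theorem SufLt.trans {s : ℕ → ℕ} {i j k : ℕ} (h : SufLt s i j) (h' : SufLt s j k) :
    SufLt s i k := by
  obtain ⟨d, h1, h2⟩ := h
  obtain ⟨d', h3, h4⟩ := h'
  rcases lt_trichotomy d d' with hd | hd | hd
  · exact ⟨d, fun e he => (h1 e he).trans (h3 e (by omega)), by rw [← h3 d hd]; exact h2⟩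
  · subst hd
    exact ⟨d, fun e he => (h1 e he).trans (h3 e he), h2.trans h4⟩
  · exact ⟨d', fun e he => (h1 e (by omega)).trans (h3 e he), by rw [h1 d' hd]; exact h4⟩

theorem SufLt.asymm {s : ℕ → ℕ} {i j : ℕ} (h : SufLt s i j) : ¬ SufLt s j i :=
  fun h' => SufLt.irrefl i (h.trans h')

theorem sufLt_iff {s : ℕ → ℕ} {i j : ℕ} :
    SufLt s i j ↔ s i < s j ∨ s i = s j ∧ SufLt s (i + 1) (j + 1) := by
  constructor
  · rintro ⟨d, h1, h2⟩
    rcases d with _ | d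
    · exact Or.inl (by simpa using h2)
    · refine Or.inr ⟨by simpa using h1 0 (by omega), d, fun e he => ?_, ?_⟩
      · have := h1 (e + 1) (by omega)
        rwa [show i + 1 + e = i + (e + 1) by omega, show j + 1 + e = j + (e + 1) by omega]
      · rwa [show i + 1 + d = i + (d + 1) by omega, show j + 1 + d = j + (d + 1) by omega]
  · rintro (h | ⟨h, d, h1, h2⟩)
    · exact ⟨0, by simp, by simpa using h⟩
    · refine ⟨d + 1, fun e he => ?_, ?_⟩
      · rcases e with _ | e
        · simpa using h
        · have := h1 e (by omega)
          rwa [show i + 1 + e = i + (e + 1) by omega,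
            show j + 1 + e = j + (e + 1) by omega] at this
      · rwa [show i + 1 + d = i + (d + 1) by omega,
          show j + 1 + d = j + (d + 1) by omega] at h2

/-- The shorter suffix reaches its terminating zeros while the longer one still has a positive
letter. Hence the suffix order is total, and the empty suffix at N is included. -/
theorem IsText.exists_ne {s : ℕ → ℕ} {N i j : ℕ} (hs : IsText s N) (hi : i ≤ N) (hj : j ≤ N)
    (h : i ≠ j) : ∃ d, s (i + d) ≠ s (j + d) := by
  rcases lt_or_gt_of_ne h with h | h
  · refine ⟨N - j, ?_⟩
    have h1 := hs.pos (i + (N - j)) (by omega)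
    have h2 := hs.zero (j + (N - j)) (by omega)
    omega
  · refine ⟨N - i, ?_⟩
    have h1 := hs.pos (j + (N - i)) (by omega)
    have h2 := hs.zero (i + (N - i)) (by omega)
    omega

theorem IsText.sufLt_or {s : ℕ → ℕ} {N i j : ℕ} (hs : IsText s N) (hi : i ≤ N) (hj : j ≤ N)
    (h : i ≠ j) : SufLt s i j ∨ SufLt s j i := by
  classical
  have hex := hs.exists_ne hi hj h
  have h1 := Nat.find_spec hex
  have h2 : ∀ e < Nat.find hex, s (i + e) = s (j + e) := fun e he => by
    simpa using Nat.find_min hex he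
  rcases lt_or_gt_of_ne h1 with h3 | h3
  · exact Or.inl ⟨_, h2, h3⟩
  · exact Or.inr ⟨_, fun e he => (h2 e he).symm, h3⟩

/-- `rk` ranks the suffixes of the text `s` of length `N`. -/
structure IsRank (s : ℕ → ℕ) (N : ℕ) (rk : ℕ → ℕ) : Prop where
  lt : ∀ i < N, rk i < N
  mono : ∀ i j, i < N → j < N → SufLt s i j → rk i < rk j

namespace IsRank

variable {s : ℕ → ℕ} {N : ℕ} {rk : ℕ → ℕ}

theorem inj (h : IsRank s N rk) (hs : IsText s N) {i j : ℕ} (hi : i < N) (hj : j < N)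
    (hij : rk i = rk j) : i = j := by
  by_contra hne
  rcases hs.sufLt_or hi.le hj.le hne with h1 | h1
  · have := h.mono _ _ hi hj h1; omega
  · have := h.mono _ _ hj hi h1; omega

theorem lt_iff (h : IsRank s N rk) (hs : IsText s N) {i j : ℕ} (hi : i < N) (hj : j < N) :
    rk i < rk j ↔ SufLt s i j := by
  refine ⟨fun hlt => ?_, h.mono _ _ hi hj⟩
  rcases hs.sufLt_or hi.le hj.le (by rintro rfl; omega) with h1 | h1
  · exact h1
  · have := h.mono _ _ hj hi h1; omega

theorem surj (h : IsRank s N rk) (hs : IsText s N) {t : ℕ} (ht : t < N) : ∃ i < N, rk i = t :=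
  surj_of_inj h.lt (fun i j hij hj heq => by
    have := h.inj hs (by omega) hj heq
    omega) ht

end IsRank

/-! ### The reduction to two thirds of the positions -/

/-- The three letters at a position, in the lexicographic order. -/
def triple (s : ℕ → ℕ) (p : ℕ) : ℕ ×ₗ (ℕ ×ₗ ℕ) := toLex (s p, toLex (s (p + 1), s (p + 2)))

theorem triple_lt {s : ℕ → ℕ} {p p' : ℕ} : triple s p < triple s p' ↔
    s p < s p' ∨ s p = s p' ∧ (s (p + 1) < s (p' + 1) ∨
      s (p + 1) = s (p' + 1) ∧ s (p + 2) < s (p' + 2)) := by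
  simp [triple, Prod.Lex.toLex_lt_toLex]

theorem triple_eq {s : ℕ → ℕ} {p p' : ℕ} : triple s p = triple s p' ↔
    s p = s p' ∧ s (p + 1) = s (p' + 1) ∧ s (p + 2) = s (p' + 2) := by
  simp [triple]

/-- The position in the text of the `a`-th sampled position: first those that are `1` modulo `3`,
then those that are `2` modulo `3`. -/
def samplePos (q a : ℕ) : ℕ := if a < q then 3 * a + 1 else 3 * (a - q) + 2

/-- The text `r` of length `2q` is an order preserving naming of the triples of letters at the
sampled positions of `s`. -/
structure IsReduced (s : ℕ → ℕ) (q : ℕ) (r : ℕ → ℕ) : Prop where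
  text : IsText r (2 * q)
  lt : ∀ a b, a < 2 * q → b < 2 * q →
    triple s (samplePos q a) < triple s (samplePos q b) → r a < r b
  eq : ∀ a b, a < 2 * q → b < 2 * q →
    triple s (samplePos q a) = triple s (samplePos q b) → r a = r b

theorem samplePos_inj {q a b : ℕ} (h : samplePos q a = samplePos q b) : a = b := by
  unfold samplePos at h
  split_ifs at h <;> omega

theorem samplePos_lt {q a : ℕ} (h : a < 2 * q) : samplePos q a < 3 * q := by
  unfold samplePos
  split_ifs <;> omega

theorem exists_samplePos {q p : ℕ} (hp : p < 3 * q) (h : p % 3 ≠ 0) :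
    ∃ a < 2 * q, samplePos q a = p := by
  rcases Nat.lt_or_ge (p % 3) 2 with h1 | h1
  · exact ⟨p / 3, by omega, by unfold samplePos; split_ifs <;> omega⟩
  · exact ⟨q + p / 3, by omega, by unfold samplePos; split_ifs <;> omega⟩

theorem samplePos_mod (q a : ℕ) : samplePos q a % 3 ≠ 0 := by
  unfold samplePos
  split_ifs <;> omega

/-- The sampled suffixes are read in steps of three letters. The only danger is that a comparison in
r runs from the first half of the sample into the second. This cannot happen: the last triple of
either residue class reaches beyond the text, so it contains a zero and the comparison has been
decided by then. -/
theorem IsReduced.sufLt {s : ℕ → ℕ} {N q : ℕ} {r : ℕ → ℕ} (h : IsReduced s q r)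
    (hs : IsText s N) (hq : N ≤ 3 * q) {a b : ℕ} (ha : a < 2 * q) (hb : b < 2 * q)
    (hab : SufLt s (samplePos q a) (samplePos q b)) : SufLt r a b := by
  obtain ⟨d, h1, h2⟩ := hab
  induction d using Nat.strong_induction_on generalizing a b with
  | _ d ih =>
  by_cases hd : d < 3
  · refine sufLt_iff.2 (Or.inl (h.lt a b ha hb (triple_lt.2 ?_)))
    interval_cases d
    · exact Or.inl h2
    · exact Or.inr ⟨h1 0 (by omega), Or.inl h2⟩
    · exact Or.inr ⟨h1 0 (by omega), Or.inr ⟨h1 1 (by omega), h2⟩⟩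
  · have hbd : samplePos q b + d < N := by
      by_contra hcon
      rw [hs.zero _ (by omega : N ≤ samplePos q b + d)] at h2
      omega
    -- The deciding letter at b is positive, so the triple at b lies inside the text; the triple at
    -- a has the same letters, so it does as well.
    have ha2 : samplePos q a + 2 < N := by
      by_contra hcon
      have h3 := h1 2 (by omega)
      have h4 := hs.pos (samplePos q b + 2) (by omega)
      rw [hs.zero _ (by omega : N ≤ samplePos q a + 2)] at h3
      omega
    have hsa : a + 1 < 2 * q ∧ samplePos q (a + 1) = samplePos q a + 3 := by
      unfold samplePos at ha2 ⊢
      split_ifs at ha2 ⊢ <;> omega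
    have hsb : b + 1 < 2 * q ∧ samplePos q (b + 1) = samplePos q b + 3 := by
      unfold samplePos at hbd ⊢
      split_ifs at hbd ⊢ <;> omega
    refine sufLt_iff.2 (Or.inr ⟨h.eq a b ha hb (triple_eq.2
      ⟨h1 0 (by omega), h1 1 (by omega), h1 2 (by omega)⟩), ?_⟩)
    refine ih (d - 3) (by omega) hsa.1 hsb.1 (fun e he => ?_) ?_
    · rw [hsa.2, hsb.2]
      have := h1 (e + 3) (by omega)
      rwa [show samplePos q a + 3 + e = samplePos q a + (e + 3) by omega,
        show samplePos q b + 3 + e = samplePos q b + (e + 3) by omega]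
    · rw [hsa.2, hsb.2]
      rwa [show samplePos q a + 3 + (d - 3) = samplePos q a + d by omega,
        show samplePos q b + 3 + (d - 3) = samplePos q b + d by omega]

/-- `rp` orders the suffixes of `s` at the sampled positions up to `N`. -/
def IsSampleRank (s : ℕ → ℕ) (N : ℕ) (rp : ℕ → ℕ) : Prop :=
  ∀ i j, i ≤ N → j ≤ N → i % 3 ≠ 0 → j % 3 ≠ 0 → (rp i < rp j ↔ SufLt s i j)

/-- Preservation of the strict order suffices, the converse being totality. The position N is
admitted because the merge looks one or two places behind a position of the text; if it is not
divisible by 3, it is still below 3q and thus sampled. -/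
theorem IsReduced.isSampleRank {s : ℕ → ℕ} {N q : ℕ} {r rk rp : ℕ → ℕ} (h : IsReduced s q r)
    (hs : IsText s N) (hq : N ≤ 3 * q) (hrk : IsRank r (2 * q) rk)
    (hrp : ∀ a < 2 * q, rp (samplePos q a) = rk a) : IsSampleRank s N rp := by
  have key : ∀ i j, i ≤ N → j ≤ N → i % 3 ≠ 0 → j % 3 ≠ 0 → SufLt s i j → rp i < rp j := by
    intro i j hi hj hi3 hj3 hij
    obtain ⟨a, ha, rfl⟩ := exists_samplePos (q := q) (by omega) hi3
    obtain ⟨b, hb, rfl⟩ := exists_samplePos (q := q) (by omega) hj3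
    rw [hrp a ha, hrp b hb]
    exact hrk.mono a b ha hb (h.sufLt hs hq ha hb hij)
  intro i j hi hj hi3 hj3
  refine ⟨fun hlt => ?_, key i j hi hj hi3 hj3⟩
  rcases hs.sufLt_or hi hj (by rintro rfl; omega) with h1 | h1
  · exact h1
  · have := key j i hj hi hj3 hi3 h1; omega

theorem IsSampleRank.sufLt_iff_one {s rp : ℕ → ℕ} {N i j : ℕ} (h : IsSampleRank s N rp)
    (hi : i < N) (hj : j < N) (hi3 : (i + 1) % 3 ≠ 0) (hj3 : (j + 1) % 3 ≠ 0) :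
    SufLt s i j ↔ s i < s j ∨ s i = s j ∧ rp (i + 1) < rp (j + 1) := by
  rw [sufLt_iff, h (i + 1) (j + 1) hi hj hi3 hj3]

/-- Equal second letters put both second positions inside the text: a zero never equals a letter of
the text, and i ≠ j excludes that both are at N. So the sampled positions i + 2 and j + 2 do not
exceed N. -/
theorem IsSampleRank.sufLt_iff_two {s rp : ℕ → ℕ} {N i j : ℕ} (h : IsSampleRank s N rp)
    (hs : IsText s N) (hi : i < N) (hj : j < N) (hij : i ≠ j) (hi3 : (i + 2) % 3 ≠ 0)
    (hj3 : (j + 2) % 3 ≠ 0) :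
    SufLt s i j ↔ s i < s j ∨ s i = s j ∧ (s (i + 1) < s (j + 1) ∨
      s (i + 1) = s (j + 1) ∧ rp (i + 2) < rp (j + 2)) := by
  rw [sufLt_iff, sufLt_iff (i := i + 1)]
  refine or_congr Iff.rfl (and_congr Iff.rfl (or_congr Iff.rfl (and_congr_right fun heq => ?_)))
  have : i + 2 ≤ N ∧ j + 2 ≤ N := by
    rcases Nat.lt_or_ge (i + 1) N with h1 | h1 <;> rcases Nat.lt_or_ge (j + 1) N with h2 | h2
    · omega
    · have h3 := hs.pos _ h1
      rw [heq, hs.zero _ h2] at h3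
      omega
    · have h3 := hs.pos _ h2
      rw [← heq, hs.zero _ h1] at h3
      omega
    · omega
  exact (h (i + 2) (j + 2) this.1 this.2 hi3 hj3).symm

/-! ### Names in a sorted list -/

/-- The names `1, 2, …` of the values of `f`, where a value different from the previous one gets the
next name. -/
def nameOf {α : Type*} [DecidableEq α] (f : ℕ → α) : ℕ → ℕ
  | 0 => 1
  | j + 1 => nameOf f j + if f (j + 1) = f j then 0 else 1

section
variable {α : Type*} [LinearOrder α] {f : ℕ → α} {m : ℕ}

theorem nameOf_mono {i j : ℕ} (hij : i ≤ j) : nameOf f i ≤ nameOf f j := by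
  induction j, hij using Nat.le_induction with
  | base => rfl
  | succ j _ ih => exact ih.trans (by simp [nameOf])

theorem nameOf_pos (j : ℕ) : 0 < nameOf f j := by
  have := nameOf_mono (f := f) (Nat.zero_le j)
  simp only [nameOf] at this
  omega

theorem nameOf_le (j : ℕ) : nameOf f j ≤ j + 1 := by
  induction j with
  | zero => simp [nameOf]
  | succ j ih => simp only [nameOf]; split_ifs <;> omega

theorem nameOf_eq (hf : ∀ i j, i < j → j < m → f i ≤ f j) {i j : ℕ} (hij : i ≤ j) (hj : j < m)
    (h : f i = f j) : nameOf f i = nameOf f j := by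
  induction j, hij using Nat.le_induction with
  | base => rfl
  | succ j hij ih =>
    have h1 : f i ≤ f j := by
      rcases hij.lt_or_eq with h1 | rfl
      · exact hf _ _ h1 (by omega)
      · exact le_rfl
    have h2 := hf j (j + 1) (by omega) hj
    have h3 : f i = f j := le_antisymm h1 (h ▸ h2)
    rw [ih (by omega) h3]
    simp [nameOf, ← h, h3]

/-- Sortedness plays no role here: if the values at i and j differ, then the value changes somewhere
in between, and names never decrease. -/
theorem nameOf_lt {i j : ℕ} (hij : i ≤ j) (h : f i ≠ f j) : nameOf f i < nameOf f j := by
  induction j, hij using Nat.le_induction with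
  | base => exact absurd rfl h
  | succ j hij ih =>
    by_cases h1 : f i = f j
    · have h2 := nameOf_mono (f := f) hij
      have h3 : f (j + 1) ≠ f j := by rw [← h1]; exact h.symm
      simp only [nameOf, h3, if_false]
      omega
    · exact (ih h1).trans_le (nameOf_mono (by omega))

theorem nameOf_lt_of_lt (hf : ∀ i j, i < j → j < m → f i ≤ f j) {i j : ℕ} (hi : i < m)
    (h : f i < f j) : nameOf f i < nameOf f j := by
  refine nameOf_lt ?_ h.ne
  by_contra hcon
  exact absurd (hf j i (by omega) hi) (not_le.2 h)

theorem nameOf_eq_of_eq (hf : ∀ i j, i < j → j < m → f i ≤ f j) {i j : ℕ} (hi : i < m)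
    (hj : j < m) (h : f i = f j) : nameOf f i = nameOf f j := by
  rcases le_total i j with h1 | h1
  · exact nameOf_eq hf h1 hj h
  · exact (nameOf_eq hf h1 hi h.symm).symm

end

/-! ### Filtering and merging sorted lists -/

/-- The first `x` entries of `X` are the values of `f` at those of the first `v` entries of `S` that
satisfy `P`, in the same order. -/
structure IsFilter (S : ℕ → ℕ) (P : ℕ → Prop) (f : ℕ → ℕ) (v x : ℕ) (X : ℕ → ℕ) : Prop where
  le : x ≤ v
  mem : ∀ t < x, ∃ j < v, P (S j) ∧ X t = f (S j)
  mono : ∀ t t', t < t' → t' < x →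
    ∃ j j', j < j' ∧ j' < v ∧ P (S j) ∧ P (S j') ∧ X t = f (S j) ∧ X t' = f (S j')
  cover : ∀ j < v, P (S j) → ∃ t < x, X t = f (S j)

namespace IsFilter

variable {S : ℕ → ℕ} {P : ℕ → Prop} {f : ℕ → ℕ} {v x : ℕ} {X X' : ℕ → ℕ}

theorem zero : IsFilter S P f 0 0 X := ⟨by simp, by simp, by simp, by simp⟩

theorem skip (h : IsFilter S P f v x X) (hP : ¬ P (S v)) : IsFilter S P f (v + 1) x X := by
  refine ⟨by have := h.le; omega, fun t ht => ?_, fun t t' ht ht' => ?_, fun j hj hj' => ?_⟩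
  · obtain ⟨j, hj, h'⟩ := h.mem t ht
    exact ⟨j, by omega, h'⟩
  · obtain ⟨j, j', h1, h2, h3⟩ := h.mono t t' ht ht'
    exact ⟨j, j', h1, by omega, h3⟩
  · rcases Nat.lt_or_ge j v with h1 | h1
    · exact h.cover j h1 hj'
    · obtain rfl : j = v := by omega
      exact absurd hj' hP

theorem push (h : IsFilter S P f v x X) (hP : P (S v)) :
    IsFilter S P f (v + 1) (x + 1) (Function.update X x (f (S v))) := by
  refine ⟨by have := h.le; omega, fun t ht => ?_, fun t t' ht ht' => ?_, fun j hj hj' => ?_⟩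
  · rcases Nat.lt_or_ge t x with h1 | h1
    · obtain ⟨j, hj, h'⟩ := h.mem t h1
      exact ⟨j, by omega, by rwa [Function.update_of_ne (by omega)]⟩
    · obtain rfl : t = x := by omega
      exact ⟨v, by omega, hP, by simp⟩
  · rcases Nat.lt_or_ge t' x with h1 | h1
    · obtain ⟨j, j', h2, h3, h4⟩ := h.mono t t' ht h1
      refine ⟨j, j', h2, by omega, ?_⟩
      rwa [Function.update_of_ne (by omega), Function.update_of_ne (by omega)]
    · obtain rfl : t' = x := by omega
      obtain ⟨j, hj, h2, h3⟩ := h.mem t ht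
      refine ⟨j, v, hj, by omega, h2, hP, ?_, by simp⟩
      rwa [Function.update_of_ne (by omega)]
  · rcases Nat.lt_or_ge j v with h1 | h1
    · obtain ⟨t, ht, h2⟩ := h.cover j h1 hj'
      exact ⟨t, by omega, by rwa [Function.update_of_ne (by omega)]⟩
    · obtain rfl : j = v := by omega
      exact ⟨x, by omega, by simp⟩

end IsFilter

/-- The suffixes in `A` are the smallest ones, and `rk` is their rank, up to `t`. -/
structure IsPartialRank (s : ℕ → ℕ) (N : ℕ) (A : ℕ → Prop) (rk : ℕ → ℕ) (t : ℕ) : Prop where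
  lt : ∀ u, A u → u < N ∧ rk u < t
  low : ∀ u v, A u → v < N → ¬ A v → SufLt s u v
  mono : ∀ u v, A u → A v → SufLt s u v → rk u < rk v
  surj : ∀ i < t, ∃ u, A u ∧ rk u = i

namespace IsPartialRank

variable {s : ℕ → ℕ} {N t : ℕ} {A A' : ℕ → Prop} {rk : ℕ → ℕ}

theorem zero (hA : ∀ u, ¬ A u) : IsPartialRank s N A rk 0 :=
  ⟨fun u hu => absurd hu (hA u), fun u _ hu => absurd hu (hA u), fun u _ hu => absurd hu (hA u),
    by simp⟩

/-- This is one step of a merge: the smallest suffix not yet ranked receives the next rank. -/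
theorem push (h : IsPartialRank s N A rk t) {w : ℕ} (hw : w < N) (hwA : ¬ A w)
    (hmin : ∀ v < N, ¬ A v → v ≠ w → SufLt s w v) (hA' : ∀ u, A' u ↔ A u ∨ u = w) :
    IsPartialRank s N A' (Function.update rk w t) (t + 1) := by
  have hne : ∀ u, A u → u ≠ w := by rintro u hu rfl; exact hwA hu
  refine ⟨fun u hu => ?_, fun u v hu hv hvA => ?_, fun u v hu hv huv => ?_, fun i hi => ?_⟩
  · rcases (hA' u).1 hu with h1 | rfl
    · rw [Function.update_of_ne (hne u h1)]
      have := h.lt u h1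
      omega
    · simpa using hw
  · rw [hA'] at hvA
    push Not at hvA
    rcases (hA' u).1 hu with h1 | rfl
    · exact h.low u v h1 hv hvA.1
    · exact hmin v hv hvA.1 hvA.2
  · rcases (hA' u).1 hu with h1 | rfl <;> rcases (hA' v).1 hv with h2 | rfl
    · rw [Function.update_of_ne (hne u h1), Function.update_of_ne (hne v h2)]
      exact h.mono u v h1 h2 huv
    · rw [Function.update_of_ne (hne u h1)]
      simpa using (h.lt u h1).2
    · exact absurd huv (h.low v u h2 hw hwA).asymm
    · exact absurd huv (SufLt.irrefl _)
  · rcases Nat.lt_or_ge i t with h1 | h1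
    · obtain ⟨u, hu, h2⟩ := h.surj i h1
      exact ⟨u, (hA' u).2 (Or.inl hu), by rwa [Function.update_of_ne (hne u hu)]⟩
    · obtain rfl : i = t := by omega
      exact ⟨w, (hA' w).2 (Or.inr rfl), by simp⟩

theorem isRank (h : IsPartialRank s N A rk t) (hA : ∀ u < N, A u) : IsRank s N rk := by
  -- The ranks below t belong to t distinct suffixes; this is what the field `surj` is for.
  have ht : t ≤ N := by
    choose! f hf using h.surj
    have := Finset.card_le_card_of_injOn (s := Finset.range t) (t := Finset.range N) f
      (fun i hi => by
        simp only [Finset.coe_range, Set.mem_Iio] at hi ⊢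
        exact (h.lt _ (hf i hi).1).1)
      (fun i hi j hj hij => by
        simp only [Finset.coe_range, Set.mem_Iio] at hi hj
        rw [← (hf i hi).2, ← (hf j hj).2, hij])
    simpa using this
  exact ⟨fun i hi => (h.lt i (hA i hi)).2.trans_le ht,
    fun i j hi hj => h.mono i j (hA i hi) (hA j hj)⟩

end IsPartialRank

/-! ### Ranking short texts -/

/-- The number with the digits `s i, …, s (i + k - 1)` to the base `B`. -/
def digits (B : ℕ) (s : ℕ → ℕ) : ℕ → ℕ → ℕ
  | 0, _ => 0
  | k + 1, i => s i * B ^ k + digits B s k (i + 1)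

theorem digits_lt {B : ℕ} {s : ℕ → ℕ} (hB : ∀ i, s i < B) (k i : ℕ) : digits B s k i < B ^ k := by
  induction k generalizing i with
  | zero => simp [digits]
  | succ k ih =>
    have h1 := ih (i + 1)
    have h2 : (s i + 1) * B ^ k ≤ B * B ^ k := Nat.mul_le_mul_right _ (hB i)
    simp only [digits, pow_succ']
    rw [Nat.add_mul, one_mul] at h2
    omega

/-- At the first difference the larger digit wins, because the remaining digits amount to less than
one unit of its place (`digits_lt`). -/
theorem digits_lt_digits {B : ℕ} {s : ℕ → ℕ} (hB : ∀ i, s i < B) {d k i j : ℕ} (hd : d < k)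
    (h1 : ∀ e < d, s (i + e) = s (j + e)) (h2 : s (i + d) < s (j + d)) :
    digits B s k i < digits B s k j := by
  induction k generalizing d i j with
  | zero => omega
  | succ k ih =>
    simp only [digits]
    rcases d with _ | d
    · have h3 := digits_lt hB k (i + 1)
      have h4 : (s i + 1) * B ^ k ≤ s j * B ^ k := Nat.mul_le_mul_right _ (by simpa using h2)
      rw [Nat.add_mul, one_mul] at h4
      omega
    · have h3 := h1 0 (by omega)
      simp only [add_zero] at h3
      rw [h3]
      have := @ih d (i + 1) (j + 1) (by omega) (fun e he => by
        have := h1 (e + 1) (by omega)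
        rwa [show i + 1 + e = i + (e + 1) by omega, show j + 1 + e = j + (e + 1) by omega])
        (by rwa [show i + 1 + d = i + (d + 1) by omega, show j + 1 + d = j + (d + 1) by omega])
      omega

/-- The letter that makes a suffix larger is positive, hence inside the text and among the first N ≤
k letters of the suffix. So k digits decide every comparison, and counting smaller codes gives the
rank. -/
theorem IsText.isRank_of_short {s rk : ℕ → ℕ} {N B k : ℕ} (hs : IsText s N) (hB : ∀ i, s i < B)
    (hk : N ≤ k) (hrk : ∀ i < N, rk i = ltCount (digits B s k) N (digits B s k i)) :
    IsRank s N rk := by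
  set key := digits B s k
  have h1 : ∀ i < N, ltCount key N (key i) < ltCount key N (key i + 1) := by
    intro i hi
    have h1 := eqCount_mono key (key i) (show i + 1 ≤ N from hi)
    rw [eqCount_succ, if_pos rfl] at h1
    rw [ltCount_succ]
    omega
  refine ⟨fun i hi => ?_, fun i j hi hj hij => ?_⟩
  · rw [hrk i hi]
    exact (h1 i hi).trans_le (ltCount_le _ _ _)
  · rw [hrk i hi, hrk j hj]
    refine (h1 i hi).trans_le (ltCount_mono _ _ ?_)
    obtain ⟨d, h2, h3⟩ := hij
    refine digits_lt_digits hB (d := d) ?_ h2 h3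
    by_contra hcon
    rw [hs.zero (j + d) (by omega)] at h3
    omega

/-! ### Going down: from a text to the reduced text -/

/-- The value of `e`, but at most the number in register 2. -/
def Expr.cap (e : Expr) : Expr := reg 2 - (reg 2 - e)

@[simp] theorem Expr.val_cap (e : Expr) (σ : State) :
    (cap e).val σ = min (σ.reg 2) (e.val σ) := by
  simp only [cap, val_sub, val_reg]
  omega

-- The point of capping: the syntactic bound of a truncated subtraction is that of its first
-- argument, so a capped value never increases the largest number in the memory.
@[simp] theorem Expr.bd_cap (e : Expr) (M : ℕ) : (cap e).bd M = M := rfl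

@[simp] theorem Expr.safe_cap (e : Expr) (L : ℕ) : (cap e).Safe L ↔ e.Safe L := by
  simp [cap]

theorem IsStableSort.congr {key key' : ℕ → ℕ} {m : ℕ} {ρ : ℕ → ℕ} (h : IsStableSort key m ρ)
    (hk : ∀ t < m, key t = key' t) : IsStableSort key' m ρ := by
  refine ⟨h.lt, fun i j hij hj => ?_⟩
  rw [← hk _ (h.lt i (by omega)), ← hk _ (h.lt j hj)]
  exact h.mono i j hij hj

/-- Sorts the list of positions in array 4 stably by the letters at the distance `δ`. -/
def sortBy (δ : ℕ) : Prog :=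
  forUp 9 (reg 7) (.store 7 (reg 9) (get 1 (reg 5 + get 4 (reg 9) + const δ))) ;; csort

theorem sortBy_tame {δ : ℕ} (h : δ ≤ 2) : (sortBy δ).Tame 1 8 := by
  have := csort_tame
  simp [sortBy, forUp, Tame, this]
  constructorm* _ ∧ _ <;> intros <;> omega

theorem sortBy_spec (δ : ℕ) (σ : State) (m B : ℕ) (hm : σ.reg 7 = m) (hB : σ.reg 8 = B)
    (hlim : m ≤ σ.reg 2) (hkey : ∀ t < m, σ.arr 1 (σ.reg 5 + σ.arr 4 t + δ) < B) :
    Tri (sortBy δ) (300 * (m + B + 2)) σ fun τ => ∃ ρ,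
      IsStableSort (fun t => σ.arr 1 (σ.reg 5 + σ.arr 4 t + δ)) m ρ ∧
      ∀ j < m, τ.arr 4 j = σ.arr 4 (ρ j) := by
  have hle : (m + 1) * (20 + 20) + 200 * (m + B + 2) ≤ 300 * (m + B + 2) := by omega
  refine Tri.le (Tri.seq ?_) hle
  refine Tri.forUp m 20
    (fun v τ => ∀ t < v, τ.arr 7 t = σ.arr 1 (σ.reg 5 + σ.arr 4 t + δ)) (by decide) (by rfl)
    (fun τ hf => by simp [hf.reg 7 rfl, hm]) (by simp) ?_ ?_
  · intro v τ hv hi hf hI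
    refine Tri.straight rfl (by simp [maxCost, cost]) ?_
    intro t ht
    simp only [eval, State.arr_setReg, State.arr_setArr, if_true, val_reg, hi, val_get, val_add,
      val_const, Function.update_apply, hf.arr 4 rfl, hf.arr 1 rfl, hf.reg 5 rfl]
    split_ifs with h
    · rw [h]
    · exact hI t (by omega)
  · intro τ _ hf hI
    refine (csort_spec τ m B (by rw [hf.reg 7 rfl, hm]) (by rw [hf.reg 8 rfl, hB])
      (by rw [hf.reg 2 rfl]; exact hlim)
      (fun t ht => by rw [hI t ht]; exact hkey t ht)).imp fun ρ _ h => ?_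
    obtain ⟨π, h1, h2⟩ := h
    refine ⟨π, h1.congr hI, fun j hj => ?_⟩
    rw [h2 j hj, hf.arr 4 rfl]

/-- The memory `mem` holds the text `s` of length `N`, and four zeros behind it, at `o`. -/
def Holds (mem : ℕ → ℕ) (o N : ℕ) (s : ℕ → ℕ) : Prop := ∀ i < N + 4, mem (o + i) = s i

/-- Sorts the list of positions in array 4 by the triples of letters. -/
def tripleSort : Prog := sortBy 2 ;; sortBy 1 ;; sortBy 0

theorem tripleSort_tame : tripleSort.Tame 1 8 :=
  ⟨sortBy_tame (by omega), sortBy_tame (by omega), sortBy_tame (by omega)⟩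

/-- Radix sort from the last letter to the first: a stable pass keeps the order of the earlier
passes among equal letters. The list is permuted by the composition of the three sorting
permutations. -/
theorem tripleSort_spec (σ : State) (m B N : ℕ) (s : ℕ → ℕ) (hm : σ.reg 7 = m)
    (hB : σ.reg 8 = B) (hlim : m ≤ σ.reg 2) (hs : Holds (σ.arr 1) (σ.reg 5) N s)
    (hsB : ∀ i, s i < B) (hX : ∀ t < m, σ.arr 4 t < N + 2) :
    Tri tripleSort (900 * (m + B + 2)) σ fun τ => ∃ ρ : ℕ → ℕ, (∀ j < m, ρ j < m) ∧
      (∀ i j, i < j → j < m → ρ i ≠ ρ j) ∧ (∀ j < m, τ.arr 4 j = σ.arr 4 (ρ j)) ∧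
      ∀ i j, i < j → j < m → triple s (τ.arr 4 i) ≤ triple s (τ.arr 4 j) := by
  have hle : 300 * (m + B + 2) + (300 * (m + B + 2) + 300 * (m + B + 2)) ≤
    900 * (m + B + 2) := by omega
  have hkey : ∀ (τ : State), τ.arr 1 = σ.arr 1 → τ.reg 5 = σ.reg 5 → (∀ t < m, τ.arr 4 t < N + 2) →
      ∀ δ ≤ 2, ∀ t < m, τ.arr 1 (τ.reg 5 + τ.arr 4 t + δ) = s (τ.arr 4 t + δ) := by
    intro τ h1 h5 h4 δ hδ t ht
    have := h4 t ht
    rw [h1, h5, add_assoc, hs _ (by omega)]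
  refine Tri.le (Tri.seq ?_) hle
  refine (sortBy_spec 2 σ m B hm hB hlim ?_).imp ?_
  · intro t ht; rw [hkey σ rfl rfl hX 2 le_rfl t ht]; exact hsB _
  rintro τ₁ hf₁ ⟨ρ₁, h1, h2⟩
  replace h1 := h1.congr (hkey σ rfl rfl hX 2 le_rfl)
  have hX₁ : ∀ t < m, τ₁.arr 4 t < N + 2 := fun t ht => by rw [h2 t ht]; exact hX _ (h1.lt t ht)
  have hk₁ := hkey τ₁ (hf₁.arr 1 rfl) (hf₁.reg 5 rfl) hX₁ 1 (by omega)
  refine Tri.seq ?_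
  refine (sortBy_spec 1 τ₁ m B (by rw [hf₁.reg 7 rfl, hm]) (by rw [hf₁.reg 8 rfl, hB])
    (by rwa [hf₁.reg 2 rfl]) ?_).imp ?_
  · intro t ht; rw [hk₁ t ht]; exact hsB _
  rintro τ₂ hf₂ ⟨ρ₂, h3, h4⟩
  replace h3 := h3.congr hk₁
  have hX₂ : ∀ t < m, τ₂.arr 4 t < N + 2 := fun t ht => by rw [h4 t ht]; exact hX₁ _ (h3.lt t ht)
  have hk₂ := hkey τ₂ ((hf₂.arr 1 rfl).trans (hf₁.arr 1 rfl))
    ((hf₂.reg 5 rfl).trans (hf₁.reg 5 rfl)) hX₂ 0 (by omega)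
  refine (sortBy_spec 0 τ₂ m B (by rw [hf₂.reg 7 rfl, hf₁.reg 7 rfl, hm])
    (by rw [hf₂.reg 8 rfl, hf₁.reg 8 rfl, hB])
    (by rwa [hf₂.reg 2 rfl, hf₁.reg 2 rfl]) ?_).imp ?_
  · intro t ht; rw [hk₂ t ht]; exact hsB _
  rintro τ₃ hf₃ ⟨ρ₃, h5, h6⟩
  replace h5 := h5.congr hk₂
  refine ⟨fun j => ρ₁ (ρ₂ (ρ₃ j)), fun j hj => h1.lt _ (h3.lt _ (h5.lt j hj)),
    fun i j hij hj => ?_, fun j hj => ?_, fun i j hij hj => ?_⟩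
  · have a1 := h5.inj i j hij hj
    have hi := h5.lt i (by omega)
    have hj := h5.lt j hj
    have a2 : ρ₂ (ρ₃ i) ≠ ρ₂ (ρ₃ j) := by
      rcases lt_or_gt_of_ne a1 with h | h
      · exact h3.inj _ _ h hj
      · exact (h3.inj _ _ h hi).symm
    rcases lt_or_gt_of_ne a2 with h | h
    · exact h1.inj _ _ h (h3.lt _ hj)
    · exact (h1.inj _ _ h (h3.lt _ hi)).symm
  · rw [h6 j hj, h4 _ (h5.lt j hj), h2 _ (h3.lt _ (h5.lt j hj))]
  · have b5 := h5.mono i j hij hj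
    have b3 := h3.mono (ρ₃ i) (ρ₃ j)
    have b1 := h1.mono (ρ₂ (ρ₃ i)) (ρ₂ (ρ₃ j))
    have hi' := h5.lt i (by omega)
    have hj' := h5.lt j hj
    have hi'' := h3.lt _ hi'
    have hj'' := h3.lt _ hj'
    -- All facts are transported to the final list. A tie in one pass is broken by the index in the
    -- list before it, which is what the fact about the preceding pass needs as its hypothesis.
    rw [← h4 _ hi', ← h4 _ hj'] at b3
    rw [← h2 _ hi'', ← h2 _ hj'', ← h4 _ hi', ← h4 _ hj'] at b1
    rw [← h6 _ hj, ← h6 _ (by omega)] at b5 b3 b1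
    simp only [add_zero] at b5
    rw [← not_lt, triple_lt]
    intro hcon
    omega

/-- The letter at the distance `δ` from the position in register `x`. -/
def Expr.letter (x δ : ℕ) : Expr := get 1 (reg 5 + reg x + const δ)

/-- Names the triples of letters at the positions listed in array 4, and writes the names to the
place that starts at register 13. -/
def nameLoop : Prog :=
  12 ::= 0 ;;
  forUp 9 (reg 7)
    (10 ::= get 4 (reg 9) ;; 14 ::= get 4 (reg 9 - 1) ;;
     .cond (lt 0 (reg 9) * (eq (letter 10 0) (letter 14 0) * (eq (letter 10 1) (letter 14 1) *
        eq (letter 10 2) (letter 14 2)))) .skip (12 ::= reg 12 + 1) ;;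
     .cond (eq (reg 10 % 3) 1) (.store 1 (reg 13 + reg 10 / 3) (reg 12))
       (.store 1 (reg 13 + reg 6 + reg 10 / 3) (reg 12)))

theorem nameLoop_tame : nameLoop.Tame 1 8 := by
  simp [nameLoop, forUp, Tame, letter]
  constructorm* _ ∧ _ <;> intros <;> omega

/-- The names go to a region behind the text and its four zeros, so writing them does not disturb
the letters that are still to be compared. Quotient and residue modulo 3 recover the index in the
sample from the position. -/
theorem nameLoop_spec (σ : State) (q N : ℕ) (s : ℕ → ℕ) (hq : σ.reg 6 = q)
    (hm : σ.reg 7 = 2 * q) (hs : Holds (σ.arr 1) (σ.reg 5) N s)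
    (hO : σ.reg 5 + N + 4 ≤ σ.reg 13) (hX : ∀ t < 2 * q, σ.arr 4 t < N + 2)
    (hpos : ∀ j < 2 * q, ∃ a < 2 * q, σ.arr 4 j = samplePos q a)
    (hcover : ∀ a < 2 * q, ∃ j < 2 * q, σ.arr 4 j = samplePos q a)
    (hinj : ∀ i j, i < j → j < 2 * q → σ.arr 4 i ≠ σ.arr 4 j)
    (hsort : ∀ i j, i < j → j < 2 * q → triple s (σ.arr 4 i) ≤ triple s (σ.arr 4 j)) :
    Tri nameLoop (300 * (q + 1)) σ fun τ => ∃ r, IsReduced s q r ∧ (∀ i, r i ≤ 2 * q) ∧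
      (∀ i < 2 * q, τ.arr 1 (σ.reg 13 + i) = r i) ∧
      ∀ i, (i < σ.reg 13 ∨ σ.reg 13 + 2 * q ≤ i) → τ.arr 1 i = σ.arr 1 i := by
  set f : ℕ → ℕ ×ₗ (ℕ ×ₗ ℕ) := fun j => triple s (σ.arr 4 j) with hf
  have hle : 2 + (2 * q + 1) * (120 + 20) ≤ 300 * (q + 1) := by omega
  refine Tri.le (Tri.seq (Tri.assign (e := 0) ?_)) hle
  -- The counter starts at 0, one below the first name. In the first round the index of the
  -- predecessor truncates to the current one, so the factor `lt 0 (reg 9)` is needed to force a new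
  -- name.
  refine Tri.forUp (2 * q) 120 (fun v τ => (τ.reg 12 = if v = 0 then 0 else nameOf f (v - 1)) ∧
    (∀ j < v, ∀ a < 2 * q, σ.arr 4 j = samplePos q a → τ.arr 1 (σ.reg 13 + a) = nameOf f j) ∧
    ∀ i, (i < σ.reg 13 ∨ σ.reg 13 + 2 * q ≤ i) → τ.arr 1 i = σ.arr 1 i) (by decide) (by rfl)
    (fun τ hf => by simp [hf.reg 7 rfl, hm]) (by simp) ?_ ?_
  · rintro v τ hv hi hfr ⟨hI1, hI2, hI3⟩
    obtain ⟨a, ha, hpa⟩ := hpos v hv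
    have h4 : τ.arr 4 = σ.arr 4 := hfr.arr 4 rfl
    have h5 : τ.reg 5 = σ.reg 5 := by rw [hfr.reg 5 rfl]; simp
    have h6 : τ.reg 6 = q := by rw [hfr.reg 6 rfl]; simpa using hq
    have h13 : τ.reg 13 = σ.reg 13 := by rw [hfr.reg 13 rfl]; simp
    have hl : ∀ j < 2 * q, ∀ δ ≤ 2, τ.arr 1 (σ.reg 5 + σ.arr 4 j + δ) = s (σ.arr 4 j + δ) := by
      intro j hj δ hδ
      have := hX j hj
      rw [hI3 _ (by omega), add_assoc, hs _ (by omega)]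
    -- the name
    have hstep1 : Tri (.cond (lt 0 (reg 9) * (eq (letter 10 0) (letter 14 0) *
        (eq (letter 10 1) (letter 14 1) * eq (letter 10 2) (letter 14 2)))) .skip
        (12 ::= reg 12 + 1)) 60 ((τ.setReg 10 (σ.arr 4 v)).setReg 14 (σ.arr 4 (v - 1)))
        fun ρ => ρ.reg 12 = nameOf f v ∧ ρ.arr = τ.arr := by
      set τ' := (τ.setReg 10 (σ.arr 4 v)).setReg 14 (σ.arr 4 (v - 1)) with hτ'
      have e1 : ∀ δ ≤ 2, (letter 10 δ).val τ' = s (σ.arr 4 v + δ) := fun δ hδ => by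
        simp [hτ', letter, h5, hl v hv δ hδ]
      have e2 : ∀ δ ≤ 2, (letter 14 δ).val τ' = s (σ.arr 4 (v - 1) + δ) := fun δ hδ => by
        simp [hτ', letter, h5, hl (v - 1) (by omega) δ hδ]
      have e9 : τ'.reg 9 = v := by simp [hτ', hi]
      have e12 : τ'.reg 12 = if v = 0 then 0 else nameOf f (v - 1) := by simp [hτ', hI1]
      have hiff : f v = f (v - 1) ↔ _ := triple_eq
      have hval : (lt 0 (reg 9) * (eq (letter 10 0) (letter 14 0) *
          (eq (letter 10 1) (letter 14 1) * eq (letter 10 2) (letter 14 2)))).val τ' ≠ 0 ↔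
          0 < v ∧ f v = f (v - 1) := by
        simp only [val_mul, val_lt, val_eq, val_ofNat, val_reg, e9, e1 0 (by omega),
          e1 1 (by omega), e1 2 le_rfl, e2 0 (by omega), e2 1 (by omega), e2 2 le_rfl, hiff]
        simp
        omega
      refine Tri.straight rfl (by decide) ?_
      rw [eval]
      split_ifs with h
      · rw [hval] at h
        obtain ⟨v, rfl⟩ : ∃ w, v = w + 1 := ⟨v - 1, by omega⟩
        refine ⟨?_, rfl⟩
        simp only [Nat.add_sub_cancel] at h e12
        simp [eval, e12, nameOf, h]
      · rw [hval] at h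
        refine ⟨?_, rfl⟩
        rcases v with _ | v
        · simp [eval, e12, nameOf]
        · simp only [Nat.add_sub_cancel] at h e12
          have : f (v + 1) ≠ f v := fun h' => h ⟨by omega, h'⟩
          simp [eval, e12, nameOf, this]
    refine Tri.le (Tri.seq (T₁ := 3) (T₂ := 105) (Tri.assign (e := get 4 (reg 9)) ?_)) (by omega)
    refine Tri.le (Tri.seq (T₁ := 5) (T₂ := 100) (Tri.assign (e := get 4 (reg 9 - 1)) ?_)) (by omega)
    simp only [val_get, val_reg, val_sub, val_ofNat, hi, h4, State.arr_setReg, State.reg_setReg,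
      show (9 : ℕ) ≠ 10 by decide, if_false]
    refine Tri.le (Tri.seq (T₁ := 60) (T₂ := 40) (hstep1.imp ?_)) (by omega)
    rintro ρ hfρ ⟨h12, harr⟩
    have g10 : ρ.reg 10 = σ.arr 4 v := by rw [hfρ.reg 10 rfl]; simp
    have g6 : ρ.reg 6 = q := by rw [hfρ.reg 6 rfl]; simp [h6]
    have g13 : ρ.reg 13 = σ.reg 13 := by rw [hfρ.reg 13 rfl]; simp [h13]
    have hst : Tri (.cond (eq (reg 10 % 3) 1) (.store 1 (reg 13 + reg 10 / 3) (reg 12))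
       (.store 1 (reg 13 + reg 6 + reg 10 / 3) (reg 12))) 40 ρ fun ρ' =>
        ρ' = ρ.setArr 1 (σ.reg 13 + a) (nameOf f v) := by
      refine Tri.straight rfl (by decide) ?_
      simp only [eval, val_eq, val_mod, val_div, val_add, val_reg, val_ofNat, g10, g6, g13, h12,
        hpa]
      by_cases h1 : a < q
      · have h2 : samplePos q a = 3 * a + 1 := if_pos h1
        rw [h2, show (3 * a + 1) % 3 = 1 by omega, show (3 * a + 1) / 3 = a by omega]
        simp
      · have h2 : samplePos q a = 3 * (a - q) + 2 := if_neg h1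
        rw [h2, show (3 * (a - q) + 2) % 3 = 2 by omega,
          show σ.reg 13 + q + (3 * (a - q) + 2) / 3 = σ.reg 13 + a by omega]
        simp
    refine hst.imp ?_
    rintro _ - rfl
    refine ⟨?_, ?_, ?_⟩
    · simp [h12]
    · intro j hj b hb hjb
      simp only [State.arr_setArr, if_true, Function.update_apply, harr]
      rcases Nat.lt_or_ge j v with h1 | h1
      · have : b ≠ a := by
          rintro rfl
          exact hinj j v h1 hv (hjb.trans hpa.symm)
        rw [if_neg (by omega)]
        exact hI2 j h1 b hb hjb
      · obtain rfl : j = v := by omega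
        rw [hpa] at hjb
        rw [samplePos_inj hjb, if_pos rfl]
    · intro i h
      simp only [State.arr_setArr, if_true, Function.update_apply, harr]
      rw [if_neg (by omega)]
      exact hI3 i h
  · rintro τ - - ⟨-, hI2, hI3⟩
    -- The reduced text is read off the memory and continued by zeros.
    refine ⟨fun i => if i < 2 * q then τ.arr 1 (σ.reg 13 + i) else 0, ⟨⟨?_, ?_⟩, ?_, ?_⟩, ?_, ?_,
      fun i hi => ?_⟩
    · intro i hi
      obtain ⟨j, hj, h⟩ := hcover i hi
      simp only [hi, if_true]
      rw [hI2 j hj i hi h]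
      exact nameOf_pos j
    · intro i hi
      simp [not_lt.2 hi]
    · intro a b ha hb hab
      obtain ⟨i, hi, h⟩ := hcover a ha
      obtain ⟨j, hj, h'⟩ := hcover b hb
      simp only [ha, hb, if_true]
      rw [hI2 i hi a ha h, hI2 j hj b hb h']
      rw [← h, ← h'] at hab
      exact nameOf_lt_of_lt (f := f) hsort hi hab
    · intro a b ha hb hab
      obtain ⟨i, hi, h⟩ := hcover a ha
      obtain ⟨j, hj, h'⟩ := hcover b hb
      simp only [ha, hb, if_true]
      rw [hI2 i hi a ha h, hI2 j hj b hb h']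
      rw [← h, ← h'] at hab
      exact nameOf_eq_of_eq (f := f) hsort hi hj hab
    · intro i
      by_cases hi : i < 2 * q
      · obtain ⟨j, hj, h⟩ := hcover i hi
        simp only [hi, if_true]
        rw [hI2 j hj i hi h]
        exact (nameOf_le j).trans (by omega)
      · simp [hi]
    · intro i hi
      simp [hi]
    · exact hI3 i hi

theorem Prog.Tame.mono {p : Prog} {g g' L : ℕ} (h : p.Tame g L) (hg : g ≤ g') : p.Tame g' L := by
  induction p with
  | skip => trivial
  | assign x e => exact ⟨h.1, fun M => (h.2 M).trans (by omega)⟩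
  | store a i e => exact ⟨h.1, h.2.1, h.2.2.1, fun M => (h.2.2.2 M).trans (by omega)⟩
  | seq p q ihp ihq => exact ⟨ihp h.1, ihq h.2⟩
  | cond b p q ihp ihq => exact ⟨h.1, ihp h.2.1, ihq h.2.2⟩
  | loop b p ih => exact ⟨h.1, ih h.2⟩

/-- Prepares the registers for a text whose length is in register 4. -/
def setupLevel : Prog :=
  6 ::= (reg 4 + 2) / 3 ;; 7 ::= (reg 4 + 2) / 3 * 2 ;; 8 ::= cap (reg 4 + reg 3 + 2)

/-- Lists the sampled positions in array 4. -/
def sampleLoop : Prog :=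
  forUp 9 (reg 6) (.store 4 (reg 9) (cap (3 * reg 9 + 1)) ;;
    .store 4 (reg 6 + reg 9) (cap (3 * reg 9 + 2)))

/-- Writes the reduced text behind the current one, and makes it the current one. -/
def reduceStep : Prog :=
  setupLevel ;; sampleLoop ;; tripleSort ;; 13 ::= cap (reg 5 + reg 4 + 5) ;; nameLoop ;;
  11 ::= reg 11 + 1 ;; 5 ::= reg 13 ;; 4 ::= reg 7 ;;
  .store 2 (reg 11) (reg 4) ;; .store 3 (reg 11) (reg 5)

theorem setupLevel_tame : setupLevel.Tame 2 8 := by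
  simp [setupLevel, Tame]
  constructorm* _ ∧ _ <;> intros <;> omega

theorem reduceStep_tame : reduceStep.Tame 2 8 := by
  have h1 := setupLevel_tame
  have h2 := tripleSort_tame.mono (show 1 ≤ 2 by omega)
  have h3 := nameLoop_tame.mono (show 1 ≤ 2 by omega)
  simp [reduceStep, sampleLoop, forUp, Tame, h1, h2, h3]
  constructorm* _ ∧ _ <;> intros <;> omega

theorem sampleLoop_spec (σ : State) (q : ℕ) (hq : σ.reg 6 = q) (hlim : 3 * q ≤ σ.reg 2) :
    Tri sampleLoop (60 * (q + 1)) σ fun τ => ∀ a < 2 * q, τ.arr 4 a = samplePos q a := by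
  refine Tri.le (Tri.forUp q 40 (fun v τ => ∀ a, (a < v ∨ q ≤ a ∧ a < q + v) →
    τ.arr 4 a = samplePos q a) (by decide) (by rfl) (fun τ hf => by simp [hf.reg 6 rfl, hq])
    (by intro a; omega) ?_ ?_) (by omega)
  · intro v τ hv hi hf hI
    refine Tri.straight rfl (by decide) ?_
    have h2 : τ.reg 2 = σ.reg 2 := hf.reg 2 rfl
    have h6 : τ.reg 6 = q := by rw [hf.reg 6 rfl, hq]
    intro a ha
    simp only [eval, State.arr_setReg, State.arr_setArr, if_true, val_reg, hi, val_add, h2, h6,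
      Function.update_apply, val_cap, val_mul, val_ofNat, State.reg_setArr]
    split_ifs with h h'
    · rw [samplePos, if_neg (by omega)]; omega
    · rw [samplePos, if_pos (by omega)]; omega
    · exact hI a (by omega)
  · intro τ _ _ hI a ha
    exact hI a (by omega)

/-- The cells behind the current text are still zero, so the new text finds its terminating zeros
already in place. The offset N + 5 leaves room for the four zeros of the old text. Letters stay
below length + al + 2 on every level, since names are at most the new length, and this keeps
counting sort linear. -/
theorem reduceStep_spec (σ : State) (N al q : ℕ) (s : ℕ → ℕ) (hN : σ.reg 4 = N)
    (hq : q = (N + 2) / 3)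
    (hal : σ.reg 3 = al) (hs : Holds (σ.arr 1) (σ.reg 5) N s)
    (hsB : ∀ i, s i < N + al + 2) (hlim : σ.reg 5 + 3 * N + al + 20 ≤ σ.reg 2)
    (hzero : ∀ i, σ.reg 5 + N ≤ i → σ.arr 1 i = 0) :
    Tri reduceStep (5000 * (N + al + 2)) σ fun τ => ∃ r, IsReduced s q r ∧ (∀ i, r i ≤ 2 * q) ∧
      Holds (τ.arr 1) (σ.reg 5 + N + 5) (2 * q) r ∧
      (∀ i < σ.reg 5 + N + 5, τ.arr 1 i = σ.arr 1 i) ∧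
      (∀ i, σ.reg 5 + N + 5 + 2 * q ≤ i → τ.arr 1 i = 0) ∧
      τ.reg 4 = 2 * q ∧ τ.reg 5 = σ.reg 5 + N + 5 ∧ τ.reg 11 = σ.reg 11 + 1 ∧
      τ.arr 2 = Function.update (σ.arr 2) (σ.reg 11 + 1) (2 * q) ∧
      τ.arr 3 = Function.update (σ.arr 3) (σ.reg 11 + 1) (σ.reg 5 + N + 5) := by
  have hle : 40 + (60 * (q + 1) + (900 * (2 * q + (N + al + 2) + 2) + (20 +
    (300 * (q + 1) + 60)))) ≤ 5000 * (N + al + 2) := by omega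
  refine Tri.le (Tri.seq (Tri.straight rfl (by decide) ?_)) hle
  set σ₁ := eval setupLevel σ with hσ₁
  have e6 : σ₁.reg 6 = q := by simp [hσ₁, setupLevel, eval, hN, hq]
  have e7 : σ₁.reg 7 = 2 * q := by simp [hσ₁, setupLevel, eval, hN, hq]; omega
  have e8 : σ₁.reg 8 = N + al + 2 := by simp [hσ₁, setupLevel, eval, hN, hal]; omega
  have e0 : ∀ x, x ≠ 6 → x ≠ 7 → x ≠ 8 → σ₁.reg x = σ.reg x := by
    intro x h6 h7 h8
    simp [hσ₁, setupLevel, eval, h6, h7, h8]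
  have ea : σ₁.arr = σ.arr := by simp [hσ₁, setupLevel, eval]
  clear_value σ₁
  have e2 := e0 2 (by decide) (by decide) (by decide)
  have e4 := e0 4 (by decide) (by decide) (by decide)
  have e5 := e0 5 (by decide) (by decide) (by decide)
  have e11 := e0 11 (by decide) (by decide) (by decide)
  refine Tri.seq ((sampleLoop_spec σ₁ q e6 (by omega)).imp fun σ₂ hf₂ hX => ?_)
  have hXlt : ∀ t < 2 * q, samplePos q t < N + 2 := fun t ht => by
    have := samplePos_lt ht; omega
  refine Tri.seq ((tripleSort_spec σ₂ (2 * q) (N + al + 2) N s (by rw [hf₂.reg 7 rfl, e7])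
    (by rw [hf₂.reg 8 rfl, e8]) (by rw [hf₂.reg 2 rfl, e2]; omega)
    (by rwa [hf₂.arr 1 rfl, ea, hf₂.reg 5 rfl, e5]) hsB
    (fun t ht => by rw [hX t ht]; exact hXlt t ht)).imp ?_)
  rintro σ₃ hf₃ ⟨ρ, hρ1, hρ2, hρ3, hρ4⟩
  have hX₃ : ∀ j < 2 * q, σ₃.arr 4 j = samplePos q (ρ j) := fun j hj => by
    rw [hρ3 j hj, hX _ (hρ1 j hj)]
  refine Tri.seq (Tri.straight rfl (by decide) ?_)
  have h13 : min (σ₃.reg 2) (σ₃.reg 5 + σ₃.reg 4 + 5) = σ.reg 5 + N + 5 := by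
    rw [hf₃.reg 2 rfl, hf₃.reg 4 rfl, hf₃.reg 5 rfl, hf₂.reg 2 rfl, hf₂.reg 4 rfl, hf₂.reg 5 rfl,
      e2, e4, e5]
    omega
  have h15 : σ₃.arr 1 = σ.arr 1 := by rw [hf₃.arr 1 rfl, hf₂.arr 1 rfl, ea]
  have h55 : σ₃.reg 5 = σ.reg 5 := by rw [hf₃.reg 5 rfl, hf₂.reg 5 rfl, e5]
  simp only [eval, val_cap, val_add, val_reg, val_ofNat, h13]
  set σ₄ := σ₃.setReg 13 (σ.reg 5 + N + 5) with hσ₄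
  have f13 : σ₄.reg 13 = σ.reg 5 + N + 5 := by simp [hσ₄]
  refine Tri.seq ((nameLoop_spec σ₄ q N s (by simp [hσ₄, hf₃.reg 6 rfl, hf₂.reg 6 rfl, e6])
    (by simp [hσ₄, hf₃.reg 7 rfl, hf₂.reg 7 rfl, e7])
    (by simpa [hσ₄, h15, h55] using hs) (by simp [hσ₄, h55])
    (fun t ht => by simp [hσ₄, hX₃ t ht, hXlt _ (hρ1 t ht)])
    (fun j hj => ⟨ρ j, hρ1 j hj, by simp [hσ₄, hX₃ j hj]⟩) (fun a ha => ?_) (fun i j hij hj => ?_)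
    (by simpa [hσ₄] using hρ4)).imp ?_)
  · obtain ⟨j, hj, h⟩ := surj_of_inj hρ1 hρ2 ha
    exact ⟨j, hj, by simp [hσ₄, hX₃ j hj, h]⟩
  · simp only [hσ₄, State.arr_setReg]
    rw [hX₃ i (by omega), hX₃ j hj]
    intro h
    exact hρ2 i j hij hj (samplePos_inj h)
  rintro σ₅ hf₅ ⟨r, hr1, hr2, hr3, hr4⟩
  rw [f13] at hr3 hr4
  have f4 : σ₄.arr 1 = σ.arr 1 := by simp [hσ₄, h15]
  refine Tri.straight rfl (by decide) ?_
  have g11 : σ₅.reg 11 = σ.reg 11 := by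
    rw [hf₅.reg 11 rfl]; simp [hσ₄, hf₃.reg 11 rfl, hf₂.reg 11 rfl, e11]
  have g13 : σ₅.reg 13 = σ.reg 5 + N + 5 := by rw [hf₅.reg 13 rfl, f13]
  have g7 : σ₅.reg 7 = 2 * q := by
    rw [hf₅.reg 7 rfl]; simp [hσ₄, hf₃.reg 7 rfl, hf₂.reg 7 rfl, e7]
  have ga2 : σ₅.arr 2 = σ.arr 2 := by
    rw [hf₅.arr 2 rfl]; simp [hσ₄, hf₃.arr 2 rfl, hf₂.arr 2 rfl, ea]
  have ga3 : σ₅.arr 3 = σ.arr 3 := by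
    rw [hf₅.arr 3 rfl]; simp [hσ₄, hf₃.arr 3 rfl, hf₂.arr 3 rfl, ea]
  refine ⟨r, hr1, hr2, ?_, ?_, ?_, ?_⟩
  · intro i hi
    simp only [eval, State.arr_setArr, State.arr_setReg, State.reg_setReg, val_reg, val_add]
    simp only [show (1 : ℕ) ≠ 3 by decide, show (1 : ℕ) ≠ 2 by decide, if_false]
    rcases Nat.lt_or_ge i (2 * q) with h | h
    · exact hr3 i h
    · rw [hr4 _ (by omega), f4, hzero _ (by omega), hr1.text.zero i h]
  · intro i hi
    simp [eval, hr4 i (by omega), f4]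
  · intro i hi
    simp only [eval, State.arr_setArr, State.arr_setReg, State.reg_setReg, val_reg, val_add]
    simp only [show (1 : ℕ) ≠ 3 by decide, show (1 : ℕ) ≠ 2 by decide, if_false]
    rw [hr4 i (by omega), f4, hzero _ (by omega)]
  · simp [eval, g11, g13, g7, ga2, ga3]

/-! ### All levels of the recursion side by side in one array -/

/-- The texts on the levels `0, …, l` and the memory that holds them: `NL` has the lengths and `OL`
the places. -/
structure IsTower (al : ℕ) (mem NL OL : ℕ → ℕ) (s : ℕ → ℕ → ℕ) (l : ℕ) : Prop where
  text : ∀ i ≤ l, IsText (s i) (NL i)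
  holds : ∀ i ≤ l, Holds mem (OL i) (NL i) (s i)
  bound : ∀ i ≤ l, ∀ x, s i x < NL i + al + 2
  red : ∀ i < l, IsReduced (s i) ((NL i + 2) / 3) (s (i + 1))
  size : ∀ i < l, NL (i + 1) = 2 * ((NL i + 2) / 3)
  off : ∀ i < l, OL (i + 1) = OL i + NL i + 5

theorem IsTower.off_le {al : ℕ} {mem NL OL : ℕ → ℕ} {s : ℕ → ℕ → ℕ} {l : ℕ}
    (h : IsTower al mem NL OL s l) {i : ℕ} (hi : i < l) : OL i + NL i + 5 ≤ OL l := by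
  induction l, hi using Nat.le_induction with
  | base => exact (h.off i (by omega)).ge
  | succ l hl ih =>
    have h1 := ih ⟨fun i hi => h.text i (by omega), fun i hi => h.holds i (by omega),
      fun i hi => h.bound i (by omega), fun i hi => h.red i (by omega),
      fun i hi => h.size i (by omega), fun i hi => h.off i (by omega)⟩
    have := h.off l (by omega)
    omega

/-- Reduces the text until at most four letters are left. -/
def reduceLoop : Prog := .loop (lt 4 (reg 4)) reduceStep

/-- A round on N letters takes at most 5001 (al + 2) N steps, and the length shrinks by at least N /
15. So 15 · 5001 = 75015 per letter pays for all rounds. Likewise the new offset adds N + 5 ≤ 2N,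
which the factor 30 in the invariant compensates; hence all levels together fit into linear space.
-/
theorem reduceLoop_spec (σ : State) (n al : ℕ) (s₀ : ℕ → ℕ) (hn : 0 < n) (h4 : σ.reg 4 = n)
    (h5 : σ.reg 5 = 0) (h11 : σ.reg 11 = 0) (h3 : σ.reg 3 = al) (ha2 : σ.arr 2 0 = n)
    (ha3 : σ.arr 3 0 = 0) (hs : IsText s₀ n) (hmem : σ.arr 1 = s₀)
    (hsB : ∀ i, s₀ i < n + al + 2)
    (hlim : 40 * n + al + 20 ≤ σ.reg 2) :
    Tri reduceLoop (75015 * (al + 2) * n + 10) σ fun τ => ∃ s l, s 0 = s₀ ∧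
      IsTower al (τ.arr 1) (τ.arr 2) (τ.arr 3) s l ∧ τ.arr 2 0 = n ∧ τ.arr 3 0 = 0 ∧
      τ.reg 11 = l ∧ τ.reg 4 = τ.arr 2 l ∧ τ.reg 5 = τ.arr 3 l ∧
      0 < τ.reg 4 ∧ τ.reg 4 ≤ 4 ∧ (∀ i, τ.reg 5 + τ.reg 4 ≤ i → τ.arr 1 i = 0) ∧
      τ.reg 5 ≤ 30 * n := by
  refine Tri.le (Tri.loop (fun τ => ∃ s, s 0 = s₀ ∧
    IsTower al (τ.arr 1) (τ.arr 2) (τ.arr 3) s (τ.reg 11) ∧ τ.arr 2 0 = n ∧ τ.arr 3 0 = 0 ∧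
      τ.reg 4 = τ.arr 2 (τ.reg 11) ∧ τ.reg 5 = τ.arr 3 (τ.reg 11) ∧
      0 < τ.reg 4 ∧ (∀ i, τ.reg 5 + τ.reg 4 ≤ i → τ.arr 1 i = 0) ∧
      τ.reg 5 + 30 * τ.reg 4 ≤ 30 * n) (fun τ => 75015 * (al + 2) * τ.reg 4) ?_ ?_ ?_) ?_
  · refine ⟨fun _ => s₀, rfl, ⟨?_, ?_, ?_, ?_, ?_, ?_⟩, ?_⟩
    · intro i hi; obtain rfl : i = 0 := by omega
      rwa [ha2]
    · intro i hi j _; obtain rfl : i = 0 := by omega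
      simp [ha3, hmem]
    · intro i hi; obtain rfl : i = 0 := by omega
      rwa [ha2]
    · omega
    · omega
    · omega
    · simp only [h11, ha2, ha3, h4, h5, hmem, hn]
      exact ⟨trivial, trivial, trivial, trivial, trivial, by simpa using hs.zero, by omega⟩
  · rintro τ hf ⟨s, hs0, hT, ha2, ha3, h4, h5, hpos, hz, hle⟩ hb
    have hN : 4 < τ.reg 4 := by
      by_contra hcon
      exact hb (by simp [hcon])
    have hTl := hT.holds _ le_rfl
    rw [← h4, ← h5] at hTl
    have hTb := hT.bound _ le_rfl
    rw [← h4] at hTb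
    refine ⟨_, (reduceStep_spec τ (τ.reg 4) al _ (s (τ.reg 11)) rfl rfl (by rw [hf.reg 3 rfl, h3])
      hTl hTb (by rw [hf.reg 2 rfl]; omega) hz).imp ?_⟩
    rintro ρ - ⟨r, hr1, hr2, hr3, hr4, hr5, g4, g5, g11, ga2, ga3⟩
    set l := τ.reg 11
    set N := τ.reg 4 with hNdef
    set q := (N + 2) / 3 with hq
    have hu2 : ∀ i ≤ l, ρ.arr 2 i = τ.arr 2 i := fun i hi => by
      rw [ga2, Function.update_of_ne (by omega)]
    have hu3 : ∀ i ≤ l, ρ.arr 3 i = τ.arr 3 i := fun i hi => by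
      rw [ga3, Function.update_of_ne (by omega)]
    have hv2 : ρ.arr 2 (l + 1) = 2 * q := by simp [ga2]
    have hv3 : ρ.arr 3 (l + 1) = τ.reg 5 + N + 5 := by simp [ga3]
    have hus : ∀ i ≤ l, Function.update s (l + 1) r i = s i := fun i hi => by
      rw [Function.update_of_ne (by omega)]
    have hoff : ∀ i ≤ l, τ.arr 3 i + τ.arr 2 i ≤ τ.reg 5 + N := by
      intro i hi
      rcases hi.lt_or_eq with h | rfl
      · have := hT.off_le h; omega
      · omega
    have hd : 75015 * (al + 2) * N =
        15 * (5001 * (al + 2) * N) := by ring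
    -- This needs N > 4: the worst case is N = 7 with a reduced length of 6, whereas a text of 4
    -- letters would not get shorter at all.
    have h6 : 15 * (2 * q) + N ≤ 15 * N := by omega
    have h7 := Nat.mul_le_mul_left (5001 * (al + 2)) h6
    refine ⟨⟨Function.update s (l + 1) r, ?_, ⟨?_, ?_, ?_, ?_, ?_, ?_⟩, ?_⟩, ?_⟩
    · rw [hus 0 (by omega), hs0]
    · intro i hi
      rw [g11] at hi
      rcases Nat.lt_or_ge l i with h | h
      · obtain rfl : i = l + 1 := by omega
        rw [hv2]; simpa using hr1.text
      · rw [hu2 i h, hus i h]; exact hT.text i h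
    · intro i hi
      rw [g11] at hi
      rcases Nat.lt_or_ge l i with h | h
      · obtain rfl : i = l + 1 := by omega
        rw [hv2, hv3]; simpa using hr3
      · rw [hu2 i h, hu3 i h, hus i h]
        intro j hj
        have := hoff i h
        rw [hr4 _ (by omega)]
        exact hT.holds i h j hj
    · intro i hi
      rw [g11] at hi
      rcases Nat.lt_or_ge l i with h | h
      · obtain rfl : i = l + 1 := by omega
        rw [hv2]
        intro x
        have := hr2 x
        simp only [Function.update_self]
        omega
      · rw [hu2 i h, hus i h]; exact hT.bound i h
    · intro i hi
      rw [g11] at hi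
      rw [hu2 i (by omega), hus i (by omega)]
      rcases Nat.lt_or_ge i l with h | h
      · rw [hus (i + 1) (by omega)]; exact hT.red i h
      · obtain rfl : i = l := by omega
        rw [Function.update_self, ← h4]
        exact hr1
    · intro i hi
      rw [g11] at hi
      rw [hu2 i (by omega)]
      rcases Nat.lt_or_ge i l with h | h
      · rw [hu2 (i + 1) (by omega)]; exact hT.size i h
      · obtain rfl : i = l := by omega
        rw [hv2, ← h4]
    · intro i hi
      rw [g11] at hi
      rw [hu2 i (by omega), hu3 i (by omega)]
      rcases Nat.lt_or_ge i l with h | h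
      · rw [hu3 (i + 1) (by omega)]; exact hT.off i h
      · obtain rfl : i = l := by omega
        rw [hv3, ← h4, ← h5]
    · rw [hu2 0 (by omega), hu3 0 (by omega), g4, g5, g11, hv2, hv3]
      exact ⟨ha2, ha3, rfl, rfl, by omega, hr5, by omega⟩
    · rw [g4]
      have h8 : N + al + 2 ≤ (al + 2) * N := by nlinarith
      have h9 : 75015 * (al + 2) * (2 * q) = 5001 * (al + 2) * (15 * (2 * q)) := by ring
      have h10 : 75015 * (al + 2) * N = 5001 * (al + 2) * (15 * N) := by ring
      rw [h9, h10]
      rw [Nat.mul_add] at h7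
      have h11 : 5001 * (al + 2) * N = 5000 * ((al + 2) * N) + (al + 2) * N := by ring
      simp only [lt, cost]
      change _ + 5000 * (N + al + 2) + (1 + 1 + 1) + 1 ≤ _
      omega
  · rintro τ hf ⟨s, hs0, hT, ha2, ha3, h4, h5, hpos, hz, hle⟩ hb
    have hN : τ.reg 4 ≤ 4 := by
      by_contra hcon
      simp [not_le.1 hcon] at hb
    exact ⟨s, τ.reg 11, hs0, hT, ha2, ha3, rfl, h4, h5, hpos, hN, hz, by omega⟩
  · rw [h4]
    have : (lt 4 (reg 4)).cost = 3 := rfl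
    omega

/-! ### Going up: from the ranks of the reduced text to the ranks of the text -/

/-- The number with the `k` letters from position `i` of the current text as digits. -/
def Expr.code (i : ℕ) : Expr :=
  get 1 (reg 5 + const i) * (reg 8 * reg 8 * reg 8) +
    (get 1 (reg 5 + const (i + 1)) * (reg 8 * reg 8) +
      (get 1 (reg 5 + const (i + 2)) * reg 8 + get 1 (reg 5 + const (i + 3))))

/-- The number of suffixes before the one at `i`, in a text of length at most four. -/
def Expr.shortRank (i : ℕ) : Expr :=
  lt 0 (reg 4) * lt (code 0) (code i) + (lt 1 (reg 4) * lt (code 1) (code i) +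
    (lt 2 (reg 4) * lt (code 2) (code i) + lt 3 (reg 4) * lt (code 3) (code i)))

/-- Ranks the suffixes of a text of length at most four. -/
def baseRank : Prog :=
  setupLevel ;; .store 8 0 (shortRank 0) ;; .store 8 1 (shortRank 1) ;;
    .store 8 2 (shortRank 2) ;; .store 8 3 (shortRank 3)

theorem baseRank_tame : baseRank.Tame 4 8 := by
  have h1 := setupLevel_tame.mono (show 2 ≤ 4 by omega)
  simp [baseRank, Tame, h1, shortRank, code]
  constructorm* _ ∧ _ <;> intros <;> omega

theorem baseRank_spec (σ : State) (N al : ℕ) (s : ℕ → ℕ) (hN : σ.reg 4 = N) (hN4 : N ≤ 4)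
    (hal : σ.reg 3 = al) (hs : IsText s N) (hh : Holds (σ.arr 1) (σ.reg 5) N s)
    (hsB : ∀ i, s i < N + al + 2) (hlim : N + al + 20 ≤ σ.reg 2)
    (hzero : ∀ i, σ.reg 5 + N ≤ i → σ.arr 1 i = 0) :
    Tri baseRank 2000 σ fun τ => IsRank s N (τ.arr 8) := by
  -- The four codes read seven cells, more than `Holds` covers for N ≤ 2; the zeros behind the text
  -- supply the rest.
  have hl : ∀ i, σ.arr 1 (σ.reg 5 + i) = s i := by
    intro i
    rcases Nat.lt_or_ge i N with h | h
    · exact hh i (by omega)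
    · rw [hzero _ (by omega), hs.zero _ h]
  refine Tri.le (Tri.seq (T₁ := 60) (T₂ := 1900) (Tri.straight rfl (by decide) ?_)) (by omega)
  set σ₁ := eval setupLevel σ with hσ₁
  have e8 : σ₁.reg 8 = N + al + 2 := by simp [hσ₁, setupLevel, eval, hN, hal]; omega
  have e4 : σ₁.reg 4 = N := by simp [hσ₁, setupLevel, eval, hN]
  have e5 : σ₁.reg 5 = σ.reg 5 := by simp [hσ₁, setupLevel, eval]
  have ea : σ₁.arr 1 = σ.arr 1 := by simp [hσ₁, setupLevel, eval]
  clear_value σ₁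
  have hcode : ∀ τ : State, τ.reg = σ₁.reg → τ.arr 1 = σ.arr 1 → ∀ i,
      (code i).val τ = digits (N + al + 2) s 4 i := by
    intro τ h1 h2 i
    have hd : digits (N + al + 2) s 4 i = s i * (N + al + 2) ^ 3 + (s (i + 1) * (N + al + 2) ^ 2 +
      (s (i + 2) * (N + al + 2) ^ 1 + (s (i + 3) * (N + al + 2) ^ 0 + 0))) := rfl
    simp only [code, val_add, val_mul, val_get, val_reg, val_const, h1, h2, e5, e8, hl, hd]
    ring
  have hrank : ∀ τ : State, τ.reg = σ₁.reg → τ.arr 1 = σ.arr 1 → ∀ i,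
      (shortRank i).val τ =
        ltCount (digits (N + al + 2) s 4) N (digits (N + al + 2) s 4 i) := by
    intro τ h1 h2 i
    simp only [shortRank, val_add, val_mul, val_lt, val_reg, val_ofNat, hcode τ h1 h2, h1, e4]
    generalize digits (N + al + 2) s 4 = key
    simp only [ltCount, Finset.card_filter]
    interval_cases N <;>
      simp [Finset.sum_range_succ, add_assoc, -Finset.sum_boole]
  refine Tri.straight rfl (Nat.le_of_ble_eq_true rfl) ?_
  simp only [eval]
  refine hs.isRank_of_short hsB hN4 fun i hi => ?_
  have hi4 : i < 4 := by omega
  rw [hrank _ rfl ea, hrank _ (by simp) (by simp [ea]), hrank _ (by simp) (by simp [ea]),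
    hrank _ (by simp) (by simp [ea])]
  simp only [State.arr_setArr, if_true, val_ofNat]
  interval_cases i <;> simp

/-- Inverts the ranks of the sampled suffixes, and stores them by position. -/
def invertLoop : Prog :=
  forUp 9 (reg 7) (10 ::= get 8 (reg 9) ;; .store 10 (reg 10) (reg 9) ;;
    .cond (lt (reg 9) (reg 6)) (.store 9 (3 * reg 9 + 1) (reg 10))
      (.store 9 (3 * (reg 9 - reg 6) + 2) (reg 10)))

theorem invertLoop_tame : invertLoop.Tame 1 8 := by
  simp [invertLoop, forUp, Tame]
  constructorm* _ ∧ _ <;> intros <;> omega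

theorem invertLoop_spec (σ : State) (q : ℕ) (hq : σ.reg 6 = q) (hm : σ.reg 7 = 2 * q)
    (hinj : ∀ a b, a < 2 * q → b < 2 * q → σ.arr 8 a = σ.arr 8 b → a = b) :
    Tri invertLoop (200 * (q + 1)) σ fun τ =>
      (∀ a < 2 * q, τ.arr 10 (σ.arr 8 a) = a) ∧
      ∀ a < 2 * q, τ.arr 9 (samplePos q a) = σ.arr 8 a := by
  refine Tri.le (Tri.forUp (2 * q) 60 (fun v τ => (∀ a < v, τ.arr 10 (σ.arr 8 a) = a) ∧
    ∀ a < v, τ.arr 9 (samplePos q a) = σ.arr 8 a) (by decide) (by rfl)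
    (fun τ hf => by simp [hf.reg 7 rfl, hm]) (by simp) ?_ ?_) (by omega)
  · rintro v τ hv hi hf ⟨hI1, hI2⟩
    have h8 : τ.arr 8 = σ.arr 8 := hf.arr 8 rfl
    have h6 : τ.reg 6 = q := by rw [hf.reg 6 rfl, hq]
    refine Tri.straight rfl (by decide) ?_
    have he : ∀ τ' : State, τ' = eval (10 ::= get 8 (reg 9) ;; .store 10 (reg 10) (reg 9) ;;
        .cond (lt (reg 9) (reg 6)) (.store 9 (3 * reg 9 + 1) (reg 10))
        (.store 9 (3 * (reg 9 - reg 6) + 2) (reg 10))) τ →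
        τ'.arr 10 = Function.update (τ.arr 10) (σ.arr 8 v) v ∧
        τ'.arr 9 = Function.update (τ.arr 9) (samplePos q v) (σ.arr 8 v) := by
      rintro _ rfl
      by_cases h : v < q
      · simp [eval, hi, h8, h6, h, samplePos]
      · simp [eval, hi, h8, h6, h, samplePos]
    obtain ⟨h9, h10⟩ := he _ rfl
    simp only [State.arr_setReg, h9, h10, Function.update_apply]
    refine ⟨fun a ha => ?_, fun a ha => ?_⟩
    · split_ifs with h
      · exact (hinj _ _ (by omega) hv h).symm
      · refine hI1 a (lt_of_le_of_ne (by omega) ?_)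
        rintro rfl; exact h rfl
    · split_ifs with h
      · rw [samplePos_inj h]
      · refine hI2 a (lt_of_le_of_ne (by omega) ?_)
        rintro rfl; exact h rfl
  · rintro τ _ _ hI
    exact hI

/-- Lists the positions `0` modulo `3`, in the order of the suffixes behind them, in array 4, and the
sampled positions in the order of their suffixes in array 11. -/
def filterLoop : Prog :=
  12 ::= 0 ;; 13 ::= 0 ;;
  forUp 9 (reg 7) (10 ::= get 10 (reg 9) ;;
    .cond (lt (reg 10) (reg 6))
      (.store 4 (reg 12) (cap (3 * reg 10)) ;; 12 ::= reg 12 + 1 ;; 14 ::= cap (3 * reg 10 + 1))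
      (14 ::= cap (3 * (reg 10 - reg 6) + 2)) ;;
    .cond (lt (reg 14) (reg 4)) (.store 11 (reg 13) (reg 14) ;; 13 ::= reg 13 + 1) .skip)

theorem filterLoop_tame : filterLoop.Tame 1 8 := by
  simp [filterLoop, forUp, Tame]
  intros; omega

/-- Running through the sample in the order of ranks lists the positions 3a by the suffixes at 3a +
1, so that a single stable pass by first letters will sort them. Sampled positions from N on are
padding and are dropped from the other list. -/
theorem filterLoop_spec (σ : State) (q N : ℕ) (hq : σ.reg 6 = q) (hm : σ.reg 7 = 2 * q)
    (hN : σ.reg 4 = N) (hlim : 3 * q ≤ σ.reg 2) (hS : ∀ j < 2 * q, σ.arr 10 j < 2 * q) :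
    Tri filterLoop (400 * (q + 1)) σ fun τ =>
      IsFilter (σ.arr 10) (· < q) (3 * ·) (2 * q) (τ.reg 12) (τ.arr 4) ∧
      IsFilter (σ.arr 10) (samplePos q · < N) (samplePos q) (2 * q) (τ.reg 13) (τ.arr 11) := by
  have hle : 5 + (5 + (2 * q + 1) * (120 + 20)) ≤ 400 * (q + 1) := by omega
  refine Tri.le (Tri.seq (Tri.straight rfl (by decide) (Tri.seq (Tri.straight rfl (by decide)
    ?_)))) hle
  refine Tri.forUp (2 * q) 120 (fun v τ =>
      IsFilter (σ.arr 10) (· < q) (3 * ·) v (τ.reg 12) (τ.arr 4) ∧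
      IsFilter (σ.arr 10) (samplePos q · < N) (samplePos q) v (τ.reg 13) (τ.arr 11))
    (by decide) (by rfl) (fun τ hf => by simp [hf.reg 7 rfl, hm, eval]) ?_ ?_ ?_
  · simp only [eval, State.reg_setReg, State.arr_setReg]
    exact ⟨IsFilter.zero, IsFilter.zero⟩
  · rintro v τ hv hi hf ⟨hI1, hI2⟩
    have h10 : τ.arr 10 = σ.arr 10 := by rw [hf.arr 10 rfl]; simp [eval]
    have h6 : τ.reg 6 = q := by rw [hf.reg 6 rfl]; simp [eval, hq]
    have h4 : τ.reg 4 = N := by rw [hf.reg 4 rfl]; simp [eval, hN]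
    have h2 : τ.reg 2 = σ.reg 2 := by rw [hf.reg 2 rfl]; simp [eval]
    have hSv := hS v hv
    have hle : 3 + (80 + 30) ≤ 120 := by omega
    refine Tri.le (Tri.seq (Tri.straight rfl (by decide) (Tri.seq ?_))) hle
    set τ₁ := eval (10 ::= get 10 (reg 9)) τ with hτ₁
    have h10' : τ₁.reg 10 = σ.arr 10 v := by simp [hτ₁, eval, h10, hi]
    refine (Tri.straight (Q := fun ρ => ρ.reg 14 = samplePos q (σ.arr 10 v) ∧
      IsFilter (σ.arr 10) (· < q) (3 * ·) (v + 1) (ρ.reg 12) (ρ.arr 4)) rfl (by decide) ?_).imp ?_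
    · have h2' : τ₁.reg 2 = σ.reg 2 := by simp [hτ₁, eval, h2]
      have h6' : τ₁.reg 6 = q := by simp [hτ₁, eval, h6]
      have h12' : τ₁.reg 12 = τ.reg 12 := by simp [hτ₁, eval]
      have h4' : τ₁.arr 4 = τ.arr 4 := by simp [hτ₁, eval]
      by_cases h : σ.arr 10 v < q
      · have := hI1.push h
        have hm : min (σ.reg 2) (3 * σ.arr 10 v) = 3 * σ.arr 10 v := by omega
        simp [eval, h10', h6', h, h12', h4', h2', hm, this]
        rw [samplePos, if_pos h]
        omega
      · have := hI1.skip (P := (· < q)) h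
        simp [eval, h10', h6', h, h12', h4', h2', this]
        rw [samplePos, if_neg h]
        omega
    · rintro ρ hfρ ⟨h14, hF⟩
      have h4' : ρ.reg 4 = N := by rw [hfρ.reg 4 rfl]; simp [hτ₁, eval, h4]
      have h13' : ρ.reg 13 = τ.reg 13 := by rw [hfρ.reg 13 rfl]; simp [hτ₁, eval]
      have h11' : ρ.arr 11 = τ.arr 11 := by rw [hfρ.arr 11 rfl]; simp [hτ₁, eval]
      refine Tri.straight rfl (by decide) ?_
      by_cases h : samplePos q (σ.arr 10 v) < N
      · have := hI2.push h
        simp [eval, h14, h4', h, h13', h11', this, hF]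
      · have := hI2.skip (P := (samplePos q · < N)) h
        simp [eval, h14, h4', h, h13', h11', this, hF]
  · rintro τ _ _ hI
    exact hI

/-- Whether the suffix at register 12 comes before the one at register 14, which is `1` modulo
`3`. -/
def Expr.lessOne : Expr :=
  lt (letter 12 0) (letter 14 0) +
    eq (letter 12 0) (letter 14 0) * lt (get 9 (reg 12 + 1)) (get 9 (reg 14 + 1))

/-- Whether the suffix at register 12 comes before the one at register 14, which is `2` modulo
`3`. -/
def Expr.lessTwo : Expr :=
  lt (letter 12 0) (letter 14 0) + eq (letter 12 0) (letter 14 0) *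
    (lt (letter 12 1) (letter 14 1) + eq (letter 12 1) (letter 14 1) *
      lt (get 9 (reg 12 + 2)) (get 9 (reg 14 + 2)))

/-- Whether the next suffix is taken from array 4. -/
def mergeTest : Prog :=
  .cond (lt (reg 15) (reg 13))
    (.cond (lt (reg 10) (reg 7))
      (.cond (eq (reg 14 % 3) 1) (16 ::= lessOne) (16 ::= lessTwo)) (16 ::= 0)) (16 ::= 1)

/-- One step of the merge. -/
def mergeStep : Prog :=
  12 ::= get 4 (reg 10) ;; 14 ::= get 11 (reg 15) ;; mergeTest ;;
  .cond (reg 16) (.store 8 (reg 12) (reg 9) ;; 10 ::= reg 10 + 1)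
    (.store 8 (reg 14) (reg 9) ;; 15 ::= reg 15 + 1) ;;
  9 ::= reg 9 + 1

/-- Ranks the suffixes by merging the lists in the arrays 4 and 11. -/
def mergeLoop : Prog :=
  10 ::= 0 ;; 15 ::= 0 ;; 9 ::= 0 ;;
  .loop (lt (reg 10) (reg 7) + lt (reg 15) (reg 13)) mergeStep

theorem mergeLoop_tame : mergeLoop.Tame 3 8 := by
  simp [mergeLoop, mergeStep, mergeTest, lessOne, lessTwo, letter, Tame]
  constructorm* _ ∧ _ <;> intros <;> omega

theorem Expr.val_lt_ne_zero {σ : State} {e f : Expr} :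
    (lt e f).val σ ≠ 0 ↔ e.val σ < f.val σ := by
  simp

theorem Expr.val_lex_ne_zero {σ : State} {e f v : Expr} :
    (lt e f + eq e f * v).val σ ≠ 0 ↔
      e.val σ < f.val σ ∨ e.val σ = f.val σ ∧ v.val σ ≠ 0 := by
  simp only [val_add, val_mul, val_lt, val_eq]
  split_ifs <;> simp_all

/-- A list that is used up yields a meaningless entry, so its end is tested before any comparison.
The implication in the conclusion encodes both ends: without sampled suffixes left the other list is
chosen, and without others the sampled one. -/
theorem mergeTest_spec (σ : State) (N x z : ℕ) (s X Z : ℕ → ℕ) (hs : IsText s N)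
    (hh : Holds (σ.arr 1) (σ.reg 5) N s) (hx : σ.reg 7 = x) (hz : σ.reg 13 = z)
    (hX : ∀ t < x, X t < N ∧ X t % 3 = 0) (hZ : ∀ t < z, Z t < N ∧ Z t % 3 ≠ 0)
    (hrp : IsSampleRank s N (σ.arr 9)) (h12 : σ.reg 12 = X (σ.reg 10))
    (h14 : σ.reg 14 = Z (σ.reg 15)) :
    Tri mergeTest 150 σ fun τ => (τ.reg 16 ≠ 0 ↔
      (σ.reg 15 < z → σ.reg 10 < x ∧ SufLt s (X (σ.reg 10)) (Z (σ.reg 15)))) := by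
  refine Tri.straight rfl (by decide) ?_
  by_cases h1 : σ.reg 15 < z
  · by_cases h2 : σ.reg 10 < x
    · obtain ⟨hX1, hX2⟩ := hX _ h2
      obtain ⟨hZ1, hZ2⟩ := hZ _ h1
      rw [← h12] at hX1 hX2 ⊢
      rw [← h14] at hZ1 hZ2 ⊢
      have l1 : ∀ δ ≤ 1, (letter 12 δ).val σ = s (σ.reg 12 + δ) := fun δ hδ => by
        simp only [letter, val_get, val_add, val_reg, val_const]
        rw [add_assoc, hh _ (by omega)]
      have l2 : ∀ δ ≤ 1, (letter 14 δ).val σ = s (σ.reg 14 + δ) := fun δ hδ => by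
        simp only [letter, val_get, val_add, val_reg, val_const]
        rw [add_assoc, hh _ (by omega)]
      by_cases h3 : σ.reg 14 % 3 = 1
      · have hl : lessOne.val σ ≠ 0 ↔ SufLt s (σ.reg 12) (σ.reg 14) := by
          rw [hrp.sufLt_iff_one hX1 hZ1 (by omega) (by omega)]
          simp only [lessOne, val_lex_ne_zero, val_lt_ne_zero, l1 0 (by omega), l2 0 (by omega),
            val_get, val_reg, val_ofNat, add_zero,
            val_add σ (reg _)]
        simpa [mergeTest, eval, hx, hz, h1, h2, h3] using hl
      · have hl : lessTwo.val σ ≠ 0 ↔ SufLt s (σ.reg 12) (σ.reg 14) := by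
          rw [hrp.sufLt_iff_two hs hX1 hZ1 (by omega) (by omega) (by omega)]
          simp only [lessTwo, val_lex_ne_zero, val_lt_ne_zero, l1 0 (by omega), l2 0 (by omega),
            l1 1 le_rfl,
            l2 1 le_rfl, val_get, val_reg, val_ofNat, add_zero, val_add σ (reg _)]
        simpa [mergeTest, eval, hx, hz, h1, h2, h3] using hl
    · simp [mergeTest, eval, hx, hz, h1, h2]
  · simp [mergeTest, eval, hz, h1]

/-- The invariant says that the consumed parts of the two lists are the smallest suffixes. The
smaller of the two heads is the smallest remaining one, by transitivity along its own list and
across to the other. -/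
theorem mergeLoop_spec (σ : State) (N x z : ℕ) (s : ℕ → ℕ) (hs : IsText s N)
    (hh : Holds (σ.arr 1) (σ.reg 5) N s) (hx : σ.reg 7 = x) (hz : σ.reg 13 = z)
    (hX : ∀ t < x, σ.arr 4 t < N ∧ σ.arr 4 t % 3 = 0)
    (hZ : ∀ t < z, σ.arr 11 t < N ∧ σ.arr 11 t % 3 ≠ 0)
    (hXs : ∀ i j, i < j → j < x → SufLt s (σ.arr 4 i) (σ.arr 4 j))
    (hZs : ∀ i j, i < j → j < z → SufLt s (σ.arr 11 i) (σ.arr 11 j))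
    (hcX : ∀ i < N, i % 3 = 0 → ∃ t < x, σ.arr 4 t = i)
    (hcZ : ∀ i < N, i % 3 ≠ 0 → ∃ t < z, σ.arr 11 t = i)
    (hrp : IsSampleRank s N (σ.arr 9)) :
    Tri mergeLoop (300 * (x + z + 1)) σ fun τ => IsRank s N (τ.arr 8) := by
  set X := σ.arr 4 with hXdef
  set Z := σ.arr 11 with hZdef
  have hle : 2 + (2 + (2 + (300 * (x - 0 + (z - 0)) + 7 + 1))) ≤ 300 * (x + z + 1) := by omega
  refine Tri.le (Tri.seq (Tri.straight rfl (by decide) (Tri.seq (Tri.straight rfl (by decide)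
    (Tri.seq (Tri.straight rfl (by decide) (Tri.le (Tri.loop
      (fun τ => IsPartialRank s N (fun u => (∃ t < τ.reg 10, X t = u) ∨ ∃ t < τ.reg 15, Z t = u)
        (τ.arr 8) (τ.reg 9) ∧ τ.reg 10 ≤ x ∧ τ.reg 15 ≤ z)
      (fun τ => 300 * (x - τ.reg 10 + (z - τ.reg 15))) ?_ ?_ ?_) ?_))))))) hle
  · refine ⟨?_, by simp [eval], by simp [eval]⟩
    have : (eval (9 ::= 0) (eval (15 ::= 0) (eval (10 ::= 0) σ))).reg 9 = 0 := by simp [eval]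
    rw [this]
    refine IsPartialRank.zero fun u => ?_
    simp [eval]
  · rintro τ hf ⟨hI, hx', hz'⟩ hb
    have g7 : τ.reg 7 = x := by rw [hf.reg 7 rfl]; simp [eval, hx]
    have g13 : τ.reg 13 = z := by rw [hf.reg 13 rfl]; simp [eval, hz]
    have g5 : τ.reg 5 = σ.reg 5 := by rw [hf.reg 5 rfl]; simp [eval]
    have g1 : τ.arr 1 = σ.arr 1 := by rw [hf.arr 1 rfl]; simp [eval]
    have g4 : τ.arr 4 = X := by rw [hf.arr 4 rfl]; simp [eval, hXdef]
    have g11 : τ.arr 11 = Z := by rw [hf.arr 11 rfl]; simp [eval, hZdef]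
    have g9 : τ.arr 9 = σ.arr 9 := by rw [hf.arr 9 rfl]; simp [eval]
    have hlt : τ.reg 10 < x ∨ τ.reg 15 < z := by
      by_contra hcon
      push Not at hcon
      apply hb
      simp [g7, g13, not_lt.2 hcon.1, not_lt.2 hcon.2]
    refine ⟨3 + (3 + (150 + (30 + 4))), ?_⟩
    have hcost : (lt (reg 10) (reg 7) + lt (reg 15) (reg 13)).cost = 7 := rfl
    refine Tri.seq (Tri.straight rfl (by decide) (Tri.seq (Tri.straight rfl (by decide) ?_)))
    set τ₁ := eval (14 ::= get 11 (reg 15)) (eval (12 ::= get 4 (reg 10)) τ) with hτ₁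
    have e10 : τ₁.reg 10 = τ.reg 10 := by simp [hτ₁, eval]
    have e15 : τ₁.reg 15 = τ.reg 15 := by simp [hτ₁, eval]
    have e9 : τ₁.reg 9 = τ.reg 9 := by simp [hτ₁, eval]
    have e12 : τ₁.reg 12 = X (τ.reg 10) := by simp [hτ₁, eval, g4]
    have e14 : τ₁.reg 14 = Z (τ.reg 15) := by simp [hτ₁, eval, g11]
    refine Tri.seq ((mergeTest_spec τ₁ N x z s X Z hs (by simpa [hτ₁, eval, g1, g5] using hh)
      (by simpa [hτ₁, eval] using g7) (by simpa [hτ₁, eval] using g13) hX hZ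
      (by simpa [hτ₁, eval, g9] using hrp) (by rw [e12, e10]) (by rw [e14, e15])).imp ?_)
    rintro ρ hfρ h16
    rw [e10, e15] at h16
    have f10 : ρ.reg 10 = τ.reg 10 := by rw [hfρ.reg 10 rfl, e10]
    have f15 : ρ.reg 15 = τ.reg 15 := by rw [hfρ.reg 15 rfl, e15]
    have f9 : ρ.reg 9 = τ.reg 9 := by rw [hfρ.reg 9 rfl, e9]
    have f12 : ρ.reg 12 = X (τ.reg 10) := by rw [hfρ.reg 12 rfl, e12]
    have f14 : ρ.reg 14 = Z (τ.reg 15) := by rw [hfρ.reg 14 rfl, e14]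
    have f8 : ρ.arr 8 = τ.arr 8 := by rw [hfρ.arr 8 rfl]; simp [hτ₁, eval]
    have hcover : ∀ v < N, (∃ t < x, X t = v) ∨ ∃ t < z, Z t = v := fun v hv => by
      by_cases h : v % 3 = 0
      · exact Or.inl (hcX v hv h)
      · exact Or.inr (hcZ v hv h)
    have hXinj : ∀ i j, i < x → j < x → X i = X j → i = j := by
      intro i j hi hj hij
      rcases lt_trichotomy i j with h | h | h
      · have := hXs i j h hj; rw [hij] at this; exact absurd this (SufLt.irrefl _)
      · exact h
      · have := hXs j i h hi; rw [hij] at this; exact absurd this (SufLt.irrefl _)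
    have hZinj : ∀ i j, i < z → j < z → Z i = Z j → i = j := by
      intro i j hi hj hij
      rcases lt_trichotomy i j with h | h | h
      · have := hZs i j h hj; rw [hij] at this; exact absurd this (SufLt.irrefl _)
      · exact h
      · have := hZs j i h hi; rw [hij] at this; exact absurd this (SufLt.irrefl _)
    have hXZ : ∀ i j, i < x → j < z → X i ≠ Z j := by
      intro i j hi hj hij
      have := (hX i hi).2
      rw [hij] at this
      exact (hZ j hj).2 this
    refine Tri.seq (Tri.straight rfl (by decide) (Tri.straight rfl (by decide) ?_))
    by_cases htake : ρ.reg 16 ≠ 0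
    · have hc := h16.1 htake
      have hx1 : τ.reg 10 < x := by
        by_contra hcon
        exact hcon (hc (by omega)).1
      have hpush := hI.push (w := X (τ.reg 10)) (hX _ hx1).1 (A' := fun u =>
          (∃ t < τ.reg 10 + 1, X t = u) ∨ ∃ t < τ.reg 15, Z t = u) (by
        rintro (⟨t, ht, h⟩ | ⟨t, ht, h⟩)
        · have := hXinj _ _ (by omega) hx1 h; omega
        · exact hXZ _ _ hx1 (by omega) h.symm) (by
        intro v hv hvA hne
        rcases hcover v hv with ⟨t, ht, rfl⟩ | ⟨t, ht, rfl⟩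
        · refine hXs _ _ ?_ ht
          by_contra hcon
          rcases Nat.lt_or_ge t (τ.reg 10) with h | h
          · exact hvA (Or.inl ⟨t, h, rfl⟩)
          · obtain rfl : t = τ.reg 10 := by omega
            exact hne rfl
        · have htz : τ.reg 15 ≤ t := by
            by_contra hcon
            exact hvA (Or.inr ⟨t, by omega, rfl⟩)
          have h1 := (hc (by omega)).2
          rcases htz.lt_or_eq with h | h
          · exact h1.trans (hZs _ _ h ht)
          · rwa [← h]) (by
        intro u
        constructor
        · rintro (⟨t, ht, h⟩ | h)
          · rcases Nat.lt_or_ge t (τ.reg 10) with h' | h'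
            · exact Or.inl (Or.inl ⟨t, h', h⟩)
            · obtain rfl : t = τ.reg 10 := by omega
              exact Or.inr h.symm
          · exact Or.inl (Or.inr h)
        · rintro ((⟨t, ht, h⟩ | h) | h)
          · exact Or.inl ⟨t, by omega, h⟩
          · exact Or.inr h
          · exact Or.inl ⟨τ.reg 10, by omega, h.symm⟩)
      simp [eval, htake, f10, f15, f9, f12, f8, hcost]
      refine ⟨⟨by simpa only [Nat.lt_add_one_iff] using hpush, by omega, hz'⟩, by omega⟩
    · have hc : τ.reg 15 < z ∧ ¬ (τ.reg 10 < x ∧ SufLt s (X (τ.reg 10)) (Z (τ.reg 15))) := by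
        have := h16.not.1 htake
        push Not at this
        exact ⟨this.1, fun h => this.2 h.1 h.2⟩
      have hz1 := hc.1
      have hpush := hI.push (w := Z (τ.reg 15)) (hZ _ hz1).1 (A' := fun u =>
          (∃ t < τ.reg 10, X t = u) ∨ ∃ t < τ.reg 15 + 1, Z t = u) (by
        rintro (⟨t, ht, h⟩ | ⟨t, ht, h⟩)
        · exact hXZ _ _ (by omega) hz1 h
        · have := hZinj _ _ (by omega) hz1 h; omega) (by
        intro v hv hvA hne
        rcases hcover v hv with ⟨t, ht, rfl⟩ | ⟨t, ht, rfl⟩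
        · have htx : τ.reg 10 ≤ t := by
            by_contra hcon
            exact hvA (Or.inl ⟨t, by omega, rfl⟩)
          have h1 : SufLt s (Z (τ.reg 15)) (X (τ.reg 10)) := by
            have hx1 : τ.reg 10 < x := by omega
            rcases hs.sufLt_or (hX _ hx1).1.le (hZ _ hz1).1.le (hXZ _ _ hx1 hz1) with h | h
            · exact absurd ⟨hx1, h⟩ hc.2
            · exact h
          rcases htx.lt_or_eq with h | h
          · exact h1.trans (hXs _ _ h ht)
          · rwa [← h]
        · refine hZs _ _ ?_ ht
          by_contra hcon
          rcases Nat.lt_or_ge t (τ.reg 15) with h | h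
          · exact hvA (Or.inr ⟨t, h, rfl⟩)
          · obtain rfl : t = τ.reg 15 := by omega
            exact hne rfl) (by
        intro u
        constructor
        · rintro (h | ⟨t, ht, h⟩)
          · exact Or.inl (Or.inl h)
          · rcases Nat.lt_or_ge t (τ.reg 15) with h' | h'
            · exact Or.inl (Or.inr ⟨t, h', h⟩)
            · obtain rfl : t = τ.reg 15 := by omega
              exact Or.inr h.symm
        · rintro ((h | ⟨t, ht, h⟩) | h)
          · exact Or.inl h
          · exact Or.inr ⟨t, by omega, h⟩
          · exact Or.inr ⟨τ.reg 15, by omega, h.symm⟩)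
      simp only [not_not] at htake
      simp [eval, htake, f10, f15, f9, f14, f8, hcost]
      refine ⟨⟨by simpa only [Nat.lt_add_one_iff] using hpush, hx', by omega⟩, by omega⟩
  · rintro τ hf ⟨hI, hx', hz'⟩ hb
    have g7 : τ.reg 7 = x := by rw [hf.reg 7 rfl]; simp [eval, hx]
    have g13 : τ.reg 13 = z := by rw [hf.reg 13 rfl]; simp [eval, hz]
    have hend : x ≤ τ.reg 10 ∧ z ≤ τ.reg 15 := by
      simpa [g7, g13] using hb
    refine hI.isRank fun u hu => ?_
    by_cases h : u % 3 = 0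
    · obtain ⟨t, ht, h'⟩ := hcX u hu h
      exact Or.inl ⟨t, by omega, h'⟩
    · obtain ⟨t, ht, h'⟩ := hcZ u hu h
      exact Or.inr ⟨t, by omega, h'⟩
  · simp only [eval, State.reg_setReg]
    change 300 * (x - 0 + (z - 0)) + 7 + 1 ≤ _
    omega

/-- Computes the ranks for a text from those for its reduced text. -/
def liftStep : Prog :=
  11 ::= reg 11 - 1 ;; 4 ::= get 2 (reg 11) ;; 5 ::= get 3 (reg 11) ;; setupLevel ;;
  invertLoop ;; filterLoop ;; 7 ::= reg 12 ;; sortBy 0 ;; mergeLoop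

theorem liftStep_tame : liftStep.Tame 3 8 := by
  have h1 := setupLevel_tame.mono (show 2 ≤ 3 by omega)
  have h2 := invertLoop_tame.mono (show 1 ≤ 3 by omega)
  have h3 := filterLoop_tame.mono (show 1 ≤ 3 by omega)
  have h4 := (sortBy_tame (show 0 ≤ 2 by omega)).mono (show 1 ≤ 3 by omega)
  have h5 := mergeLoop_tame
  simp [liftStep, Tame, h1, h2, h3, h4, h5]
  intros; omega

/-- The inductive step of the skew algorithm. A suffix at a multiple of 3 is a letter followed by a
sampled suffix, so two such suffixes are compared by one letter and one rank; against a sampled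
suffix one or two letters are needed before both sides are sampled. -/
theorem liftStep_spec (σ : State) (N al q l : ℕ) (s r : ℕ → ℕ) (hl : σ.reg 11 = l + 1)
    (hN : σ.arr 2 l = N) (hN0 : 0 < N) (hq : q = (N + 2) / 3) (hal : σ.reg 3 = al)
    (hs : IsText s N)
    (hh : Holds (σ.arr 1) (σ.arr 3 l) N s) (hsB : ∀ i, s i < N + al + 2)
    (hlim : 3 * N + al + 20 ≤ σ.reg 2) (hr : IsReduced s q r) (hrk : IsRank r (2 * q) (σ.arr 8)) :
    Tri liftStep (5000 * (N + al + 2)) σ fun τ => τ.reg 11 = l ∧ IsRank s N (τ.arr 8) := by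
  have hle : 4 + (3 + (3 + (40 + (200 * (q + 1) + (400 * (q + 1) + (2 +
      (300 * (2 * q + (N + al + 2) + 2) + 300 * (2 * q + 2 * q + 1)))))))) ≤
      5000 * (N + al + 2) := by omega
  refine Tri.le (Tri.seq (Tri.straight rfl (by decide) (Tri.seq (Tri.straight rfl (by decide)
    (Tri.seq (Tri.straight rfl (by decide) (Tri.seq (Tri.straight rfl (by decide) ?_)))))))) hle
  set σ₁ := eval setupLevel (eval (5 ::= get 3 (reg 11)) (eval (4 ::= get 2 (reg 11))
    (eval (11 ::= reg 11 - 1) σ))) with hσ₁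
  have e11 : σ₁.reg 11 = l := by simp [hσ₁, eval, setupLevel, hl]
  have e4 : σ₁.reg 4 = N := by simp [hσ₁, eval, setupLevel, hl, hN]
  have e5 : σ₁.reg 5 = σ.arr 3 l := by simp [hσ₁, eval, setupLevel, hl]
  have e6 : σ₁.reg 6 = q := by simp [hσ₁, eval, setupLevel, hl, hN, hq]
  have e7 : σ₁.reg 7 = 2 * q := by simp [hσ₁, eval, setupLevel, hl, hN, hq]; omega
  have e8 : σ₁.reg 8 = N + al + 2 := by simp [hσ₁, eval, setupLevel, hl, hN, hal]; omega
  have e2 : σ₁.reg 2 = σ.reg 2 := by simp [hσ₁, eval, setupLevel]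
  have ea : σ₁.arr = σ.arr := by simp [hσ₁, eval, setupLevel]
  clear_value σ₁
  have hqN : N ≤ 3 * q := by omega
  refine Tri.seq ((invertLoop_spec σ₁ q e6 e7 (fun a b ha hb h => by
    rw [ea] at h; exact hrk.inj hr.text ha hb h)).imp ?_)
  rintro σ₂ hf₂ ⟨hinv, hrp⟩
  rw [ea] at hinv hrp
  have hS : ∀ j < 2 * q, σ₂.arr 10 j < 2 * q ∧ σ.arr 8 (σ₂.arr 10 j) = j := by
    intro j hj
    obtain ⟨a, ha, rfl⟩ := hrk.surj hr.text hj
    rw [hinv a ha]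
    exact ⟨ha, rfl⟩
  refine Tri.seq ((filterLoop_spec σ₂ q N (by rw [hf₂.reg 6 rfl, e6]) (by rw [hf₂.reg 7 rfl, e7])
    (by rw [hf₂.reg 4 rfl, e4]) (by rw [hf₂.reg 2 rfl, e2]; omega) fun j hj => (hS j hj).1).imp ?_)
  rintro σ₃ hf₃ ⟨hX, hZ⟩
  refine Tri.seq (Tri.straight rfl (by decide) ?_)
  set σ₄ := eval (7 ::= reg 12) σ₃ with hσ₄
  have f7 : σ₄.reg 7 = σ₃.reg 12 := by simp [hσ₄, eval]
  have f8 : σ₄.reg 8 = N + al + 2 := by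
    simp [hσ₄, eval, hf₃.reg 8 rfl, hf₂.reg 8 rfl, e8]
  have f5 : σ₄.reg 5 = σ.arr 3 l := by simp [hσ₄, eval, hf₃.reg 5 rfl, hf₂.reg 5 rfl, e5]
  have f11 : σ₄.reg 11 = l := by simp [hσ₄, eval, hf₃.reg 11 rfl, hf₂.reg 11 rfl, e11]
  have f2 : σ₄.reg 2 = σ.reg 2 := by simp [hσ₄, eval, hf₃.reg 2 rfl, hf₂.reg 2 rfl, e2]
  have f13 : σ₄.reg 13 = σ₃.reg 13 := by simp [hσ₄, eval]
  have fa : σ₄.arr = σ₃.arr := by simp [hσ₄, eval]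
  have f1 : σ₄.arr 1 = σ.arr 1 := by rw [fa, hf₃.arr 1 rfl, hf₂.arr 1 rfl, ea]
  have f9 : σ₄.arr 9 = σ₂.arr 9 := by rw [fa, hf₃.arr 9 rfl]
  clear_value σ₄
  have hsamp : IsSampleRank s N (σ₂.arr 9) := hr.isSampleRank hs hqN hrk hrp
  have hx := hX.le
  have hz := hZ.le
  set x := σ₃.reg 12
  set z := σ₃.reg 13
  clear_value x z
  have hXm : ∀ t < x, σ₃.arr 4 t < N ∧ σ₃.arr 4 t % 3 = 0 := by
    intro t ht
    obtain ⟨j, hj, h1, h2⟩ := hX.mem t ht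
    rw [h2]
    omega
  have hsX : ∀ t < x, s (σ₃.arr 4 t) = σ.arr 1 (σ.arr 3 l + σ₃.arr 4 t + 0) := fun t ht => by
    rw [add_zero, hh _ (by have := (hXm t ht).1; omega)]
  have hrpS : ∀ j < 2 * q, σ₂.arr 9 (samplePos q (σ₂.arr 10 j)) = j := fun j hj => by
    rw [hrp _ (hS j hj).1, (hS j hj).2]
  have hT₁ : 300 * (x + (N + al + 2) + 2) ≤ 300 * (2 * q + (N + al + 2) + 2) :=
    Nat.mul_le_mul_left _ (by omega)
  have hT₂ : 300 * (x + z + 1) ≤ 300 * (2 * q + 2 * q + 1) :=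
    Nat.mul_le_mul_left _ (by omega)
  refine Tri.seq (Tri.le ((sortBy_spec 0 σ₄ x (N + al + 2) f7 f8 (by rw [f2]; omega) (fun t ht => by
    rw [f1, f5, fa, ← hsX t ht]; exact hsB _)).imp ?_) hT₁)
  rintro σ₅ hf₅ ⟨ρ, hρ, hρX⟩
  rw [f1, f5, fa] at hρ
  rw [fa] at hρX
  have g11 : σ₅.arr 11 = σ₃.arr 11 := by rw [hf₅.arr 11 rfl, fa]
  refine Tri.le ((mergeLoop_spec σ₅ N x z s hs (by
    rw [hf₅.arr 1 rfl, hf₅.reg 5 rfl, f1, f5]; exact hh) (by rw [hf₅.reg 7 rfl, f7])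
    (by rw [hf₅.reg 13 rfl, f13]) ?_ ?_ ?_ ?_ ?_ ?_ (by rwa [hf₅.arr 9 rfl, f9])).imp
    fun τ hτ h => ⟨by rw [hτ.reg 11 rfl, hf₅.reg 11 rfl, f11], h⟩) hT₂
  · intro t ht
    rw [hρX t ht]
    exact hXm _ (hρ.lt t ht)
  · intro t ht
    rw [g11]
    obtain ⟨j, hj, h1, h2⟩ := hZ.mem t ht
    rw [h2]
    exact ⟨h1, samplePos_mod q _⟩
  · intro i j hij hj
    rw [hρX i (by omega), hρX j hj]
    have hm := hρ.mono i j hij hj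
    have hi1 := hXm _ (hρ.lt i (by omega))
    have hj1 := hXm _ (hρ.lt j hj)
    rw [hsamp.sufLt_iff_one hi1.1 hj1.1 (by omega) (by omega), hsX _ (hρ.lt i (by omega)),
      hsX _ (hρ.lt j hj)]
    -- For equal first letters the stable sort keeps the list order, which is the order of the ranks
    -- at the next position.
    refine hm.imp id (And.imp id fun h => ?_)
    obtain ⟨a, b, h1, h2, h3, h4, h5, h6⟩ := hX.mono _ _ h (hρ.lt j hj)
    have h7 := hrpS a (by omega)
    have h8 := hrpS b h2
    rw [samplePos, if_pos h3] at h7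
    rw [samplePos, if_pos h4] at h8
    rw [h5, h6, h7, h8]
    exact h1
  · intro i j hij hj
    rw [g11]
    obtain ⟨a, b, h1, h2, h3, h4, h5, h6⟩ := hZ.mono _ _ hij hj
    rw [h5, h6]
    refine (hsamp _ _ h3.le h4.le (samplePos_mod q _) (samplePos_mod q _)).1 ?_
    rw [hrpS a (by omega), hrpS b h2]
    exact h1
  · intro i hi hi3
    -- The position i entered the list through the sampled position i + 1, whose index in the sample
    -- is i / 3.
    obtain ⟨t, ht, h⟩ := hX.cover (σ.arr 8 (i / 3)) (hrk.lt _ (by omega))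
      (by rw [hinv _ (by omega)]; omega)
    rw [hinv _ (by omega)] at h
    obtain ⟨j, hj, rfl⟩ := hρ.surj ht
    exact ⟨j, hj, by rw [hρX j hj, h]; omega⟩
  · intro i hi hi3
    obtain ⟨a, ha, rfl⟩ := exists_samplePos (q := q) (by omega) hi3
    obtain ⟨t, ht, h⟩ := hZ.cover (σ.arr 8 a) (hrk.lt _ ha) (by rw [hinv _ ha]; exact hi)
    rw [hinv _ ha] at h
    exact ⟨t, ht, by rw [g11, h]⟩

/-- Computes the ranks for all texts, from the shortest to the longest. -/
def liftLoop : Prog := .loop (lt 0 (reg 11)) liftStep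

theorem IsTower.pos {al : ℕ} {mem NL OL : ℕ → ℕ} {s : ℕ → ℕ → ℕ} {l : ℕ}
    (h : IsTower al mem NL OL s l) (h0 : 0 < NL 0) {i : ℕ} (hi : i ≤ l) : 0 < NL i := by
  induction i with
  | zero => exact h0
  | succ i ih =>
    have := ih (by omega)
    rw [h.size i (by omega)]
    omega

/-- The offset of the current level serves as potential: it falls by N + 5 on the way from a text to
the one of length N before it, which pays for a step linear in N. The offset of the last level is at
most 30n. -/
theorem liftLoop_spec (σ : State) (n al l : ℕ) (s : ℕ → ℕ → ℕ)
    (hT : IsTower al (σ.arr 1) (σ.arr 2) (σ.arr 3) s l) (h11 : σ.reg 11 = l)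
    (hn : 0 < n) (h0 : σ.arr 2 0 = n)
    (hal : σ.reg 3 = al) (hlim : 100 * n + al + 20 ≤ σ.reg 2) (hoff : σ.arr 3 l ≤ 30 * n)
    (hrk : IsRank (s l) (σ.arr 2 l) (σ.arr 8)) :
    Tri liftLoop (5004 * (al + 2) * (30 * n) + 10) σ fun τ => IsRank (s 0) n (τ.arr 8) := by
  have hpos : ∀ i ≤ l, 0 < σ.arr 2 i := fun i hi => hT.pos (h0 ▸ hn) hi
  refine Tri.le (Tri.loop (fun τ => τ.reg 11 ≤ l ∧ IsRank (s (τ.reg 11)) (σ.arr 2 (τ.reg 11))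
    (τ.arr 8)) (fun τ => 5004 * (al + 2) * σ.arr 3 (τ.reg 11)) ?_ ?_ ?_) ?_
  · rw [h11]; exact ⟨le_rfl, hrk⟩
  · rintro τ hf ⟨h1, h2⟩ hb
    have hb' : 0 < τ.reg 11 := by
      by_contra hcon
      exact hb (by simp [hcon])
    obtain ⟨i, hi⟩ : ∃ i, τ.reg 11 = i + 1 := ⟨τ.reg 11 - 1, by omega⟩
    have hil : i < l := by omega
    rw [hi, hT.size i hil] at h2
    have a1 := hf.arr 1 rfl
    have a2 := hf.arr 2 rfl
    have a3 := hf.arr 3 rfl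
    refine ⟨_, (liftStep_spec τ (σ.arr 2 i) al _ i (s i) (s (i + 1)) hi (by rw [a2])
      (hpos i hil.le) rfl (by rw [hf.reg 3 rfl, hal]) (hT.text i hil.le)
      (by rw [a1, a3]; exact hT.holds i hil.le) (hT.bound i hil.le)
      (by rw [hf.reg 2 rfl]; have := hT.off_le hil; omega) (hT.red i hil) h2).imp ?_⟩
    rintro ρ - ⟨h3, h4⟩
    rw [h3]
    refine ⟨⟨hil.le, h4⟩, ?_⟩
    rw [hi, hT.off i hil, show (lt 0 (reg 11)).cost = 3 from rfl]
    have : σ.arr 2 i + al + 2 ≤ (al + 2) * (σ.arr 2 i + 5) := by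
      nlinarith [hpos i hil.le]
    have h6 : 5004 * (al + 2) * (σ.arr 3 i + σ.arr 2 i + 5) =
      5004 * (al + 2) * σ.arr 3 i + 5004 * ((al + 2) * (σ.arr 2 i + 5)) := by ring
    rw [h6]
    omega
  · rintro τ hf ⟨h1, h2⟩ hb
    have hb' : τ.reg 11 = 0 := by
      by_contra hcon
      exact absurd hb (by simp [Nat.pos_of_ne_zero hcon])
    rw [hb', h0] at h2
    exact h2
  · rw [h11, show (lt 0 (reg 11)).cost = 3 from rfl]
    have := Nat.mul_le_mul_left (5004 * (al + 2)) hoff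
    omega

/-! ### Ranking the suffixes of the input -/

/-- The text in array 1: the letters of the input, increased by one. -/
def textOf (n : ℕ) (u : ℕ → ℕ) (i : ℕ) : ℕ := if i < n then u i + 1 else 0

theorem isText_textOf (n : ℕ) (u : ℕ → ℕ) : IsText (textOf n u) n :=
  ⟨fun i hi => by simp [textOf, hi], fun i hi => by simp [textOf, hi]⟩

/-- Sets up the text. -/
def initText : Prog :=
  .store 2 0 (reg 0) ;; 4 ::= reg 0 ;;
  forUp 9 (reg 0) (.store 1 (reg 9) (get 0 (reg 9) + 1))

theorem initText_spec (σ : State) (n : ℕ) (h0 : σ.reg 0 = n) (ha1 : ∀ i, σ.arr 1 i = 0) :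
    Tri initText (30 * n + 40) σ fun τ => τ.arr 1 = textOf n (σ.arr 0) ∧ τ.arr 2 0 = n ∧
      τ.reg 4 = n := by
  have hle : 3 + (2 + (n + 1) * (10 + 20)) ≤ 30 * n + 40 := by omega
  refine Tri.le (Tri.seq (Tri.straight rfl (by decide) (Tri.seq (Tri.straight rfl (by decide)
    (Tri.forUp n 10 (fun v τ => ∀ i, τ.arr 1 i = if i < v then σ.arr 0 i + 1 else 0)
    (by decide) (by rfl) ?_ ?_ ?_ ?_))))) hle
  · intro τ hf
    simp [hf.reg 0 rfl, eval, h0]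
  · simp [eval, ha1]
  · intro v τ hv hi hf hI
    have e0 : τ.arr 0 = σ.arr 0 := by rw [hf.arr 0 rfl]; simp [eval]
    refine Tri.straight rfl (by decide) fun i => ?_
    simp only [eval, State.arr_setReg, State.arr_setArr, if_true, val_reg, hi, val_add, val_get,
      Function.update_apply, e0, val_ofNat, hI]
    split_ifs with h1 h2 h3
    · rw [h1]
    all_goals first | rfl | omega
  · intro τ _ hf hI
    refine ⟨funext fun i => by rw [hI, textOf], ?_, ?_⟩
    · rw [hf.arr 2 rfl]; simp [eval, h0]
    · rw [hf.reg 4 rfl]; simp [eval, h0]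

/-- Ranks the suffixes of the input. -/
def rankProg : Prog := initText ;; reduceLoop ;; baseRank ;; liftLoop

theorem rankProg_tame : rankProg.Tame 4 8 := by
  have h1 := reduceStep_tame.mono (show 2 ≤ 4 by omega)
  have h2 := baseRank_tame
  have h3 := liftStep_tame.mono (show 3 ≤ 4 by omega)
  simp [rankProg, initText, reduceLoop, liftLoop, forUp, Tame, h1, h2, h3]
  intros; omega

theorem rankProg_spec (σ : State) (n al : ℕ) (hn : 0 < n) (h0 : σ.reg 0 = n) (h3 : σ.reg 3 = al)
    (h2 : 100 * n + al + 100 ≤ σ.reg 2) (h5 : σ.reg 5 = 0) (h11 : σ.reg 11 = 0)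
    (ha1 : ∀ i, σ.arr 1 i = 0) (ha3 : σ.arr 3 0 = 0) (hu : ∀ i, σ.arr 0 i ≤ al) :
    Tri rankProg (250000 * (al + 2) * n) σ fun τ =>
      Holds (τ.arr 1) 0 n (textOf n (σ.arr 0)) ∧ IsRank (textOf n (σ.arr 0)) n (τ.arr 8) := by
  have hle : 30 * n + 40 + ((75015 * (al + 2) * n + 10) + (2000 +
      (5004 * (al + 2) * (30 * n) + 10))) ≤ 250000 * (al + 2) * n := by
    have e1 : 75015 * (al + 2) * n = 75015 * ((al + 2) * n) := by ring
    have e2 : 5004 * (al + 2) * (30 * n) = 150120 * ((al + 2) * n) := by ring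
    have e3 : 250000 * (al + 2) * n = 250000 * ((al + 2) * n) := by ring
    have e4 : 2 * n ≤ (al + 2) * n := Nat.mul_le_mul_right _ (by omega)
    rw [e1, e2, e3]
    omega
  refine Tri.le (Tri.seq ((initText_spec σ n h0 ha1).imp ?_)) hle
  rintro σ₁ hf₁ ⟨g1, g2, g4⟩
  have g3 : σ₁.arr 3 0 = 0 := by rw [hf₁.arr 3 rfl, ha3]
  have hb : ∀ i, textOf n (σ.arr 0) i < n + al + 2 := fun i => by
    have := hu i
    unfold textOf
    split_ifs <;> omega
  refine Tri.seq ((reduceLoop_spec σ₁ n al _ hn g4 (by rw [hf₁.reg 5 rfl, h5])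
    (by rw [hf₁.reg 11 rfl, h11]) (by rw [hf₁.reg 3 rfl, h3]) g2 g3 (isText_textOf n _) g1 hb
    (by rw [hf₁.reg 2 rfl]; omega)).imp ?_)
  rintro σ₂ hf₂ ⟨s, l, hs0, hT, k2, k3, k11, k4, k5, hpos, hle4, hz, hoff⟩
  have l2 : σ₂.reg 2 = σ.reg 2 := by rw [hf₂.reg 2 rfl, hf₁.reg 2 rfl]
  have l3 : σ₂.reg 3 = al := by rw [hf₂.reg 3 rfl, hf₁.reg 3 rfl, h3]
  refine Tri.seq ((baseRank_spec σ₂ (σ₂.arr 2 l) al (s l) k4 (by omega) l3 (hT.text l le_rfl)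
    (by rw [k5]; exact hT.holds l le_rfl) (hT.bound l le_rfl) (by omega)
    (by rw [← k4]; exact hz)).imp ?_)
  intro σ₃ hf₃ hrk
  have m1 := hf₃.arr 1 rfl
  have m2 := hf₃.arr 2 rfl
  have m3 := hf₃.arr 3 rfl
  refine (liftLoop_spec σ₃ n al l s (by rwa [m1, m2, m3]) (by rw [hf₃.reg 11 rfl, k11]) hn
    (by rw [m2, k2]) (by rw [hf₃.reg 3 rfl, l3]) (by rw [hf₃.reg 2 rfl]; omega)
    (by rw [m3, ← k5]; exact hoff) (by rwa [m2])).imp fun τ hτ h => ?_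
  rw [hs0] at h
  refine ⟨?_, h⟩
  have := hT.holds 0 (by omega)
  rwa [k2, k3, hs0, ← m1, ← hτ.arr 1 rfl] at this

/-! ### Longest common prefixes -/

/-- The longest common prefix of the suffixes of `s` at `i` and `j` has length `h`. -/
def IsLcp (s : ℕ → ℕ) (i j h : ℕ) : Prop := (∀ e < h, s (i + e) = s (j + e)) ∧ s (i + h) ≠ s (j + h)

theorem IsLcp.symm {s : ℕ → ℕ} {i j h : ℕ} (hl : IsLcp s i j h) : IsLcp s j i h :=
  ⟨fun e he => (hl.1 e he).symm, hl.2.symm⟩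

theorem IsLcp.lt_of_sufLt {s : ℕ → ℕ} {i j h : ℕ} (hl : IsLcp s i j h) (hij : SufLt s i j) :
    s (i + h) < s (j + h) := by
  obtain ⟨d, h1, h2⟩ := hij
  rcases lt_trichotomy d h with hd | rfl | hd
  · exact absurd (hl.1 d hd) h2.ne
  · exact h2
  · exact absurd (h1 h hd) hl.2

/-- If x = y, all three suffixes may leave the common prefix at the same place. Only the order helps
then: the letter there increases twice, so the outer suffixes differ. -/
theorem IsLcp.trans {s : ℕ → ℕ} {i j k x y : ℕ} (h1 : IsLcp s i j x) (h2 : IsLcp s j k y)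
    (hij : SufLt s i j) (hjk : SufLt s j k) : IsLcp s i k (min x y) := by
  refine ⟨fun e he => (h1.1 e (by omega)).trans (h2.1 e (by omega)), ?_⟩
  rcases lt_trichotomy x y with h | rfl | h
  · rw [min_eq_left h.le, ← h2.1 x h]
    exact h1.2
  · rw [min_self]
    exact ((h1.lt_of_sufLt hij).trans (h2.lt_of_sufLt hjk)).ne
  · rw [min_eq_right h.le, h1.1 y h]
    exact h2.2

/-- If the middle suffix left the common prefix of the outer ones, its first deviation would put it
below both or above both. -/
theorem SufLt.agree_of_between {s : ℕ → ℕ} {i j k h : ℕ} (hij : SufLt s i j) (hjk : SufLt s j k)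
    (hik : ∀ e < h, s (i + e) = s (k + e)) : ∀ e < h, s (j + e) = s (k + e) := by
  obtain ⟨d, h1, h2⟩ := hij
  obtain ⟨d', h3, h4⟩ := hjk
  intro e he
  by_contra hne
  have hd' : d' ≤ e := by
    by_contra hcon
    exact hne (h3 e (by omega))
  rcases lt_trichotomy d d' with h | rfl | h
  · have := hik d (by omega)
    rw [this, h3 d h] at h2
    omega
  · have := hik d (by omega)
    omega
  · have := hik d' (by omega)
    rw [h1 d' h] at this
    omega

/-- A common letter cannot be zero, as two different suffixes do not end at the same distance; so
agreement keeps both suffixes inside the text. -/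
theorem IsText.lt_of_agree {s : ℕ → ℕ} {n i j h : ℕ} (hs : IsText s n) (hi : i < n) (hj : j < n)
    (hij : i ≠ j) (ha : ∀ e ≤ h, s (i + e) = s (j + e)) : i + h < n ∧ j + h < n := by
  rcases Nat.lt_or_ge i j with hlt | hge
  · have : j + h < n := by
      by_contra hcon
      have h1 := ha (n - j) (by omega)
      rw [hs.zero (j + (n - j)) (by omega)] at h1
      have := hs.pos (i + (n - j)) (by omega)
      omega
    omega
  · have : i + h < n := by
      by_contra hcon
      have h1 := ha (n - i) (by omega)
      rw [hs.zero (i + (n - i)) (by omega)] at h1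
      have := hs.pos (j + (n - i)) (by omega)
      omega
    omega

/-- Inverts the ranks. -/
def suffixLoop : Prog := forUp 9 (reg 0) (10 ::= get 8 (reg 9) ;; .store 10 (reg 10) (reg 9))

theorem suffixLoop_spec (σ : State) (n : ℕ) (h0 : σ.reg 0 = n)
    (hinj : ∀ a b, a < n → b < n → σ.arr 8 a = σ.arr 8 b → a = b) :
    Tri suffixLoop (30 * (n + 1)) σ fun τ => ∀ a < n, τ.arr 10 (σ.arr 8 a) = a := by
  refine Tri.le (Tri.forUp n 10 (fun v τ => ∀ a < v, τ.arr 10 (σ.arr 8 a) = a) (by decide) (by rfl)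
    (fun τ hf => by simp [hf.reg 0 rfl, h0]) (by simp) ?_ fun τ _ _ h => h) (by omega)
  intro v τ hv hi hf hI
  have h8 : τ.arr 8 = σ.arr 8 := hf.arr 8 rfl
  refine Tri.straight rfl (by decide) ?_
  intro a ha
  have : (eval (10 ::= get 8 (reg 9) ;; .store 10 (reg 10) (reg 9)) τ).arr 10 =
    Function.update (τ.arr 10) (σ.arr 8 v) v := by simp [eval, hi, h8]
  rw [State.arr_setReg, this, Function.update_apply]
  split_ifs with h
  · exact (hinj a v (by omega) hv h).symm
  · refine hI a (lt_of_le_of_ne (by omega) ?_)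
    rintro rfl; exact h rfl

/-- Extends the current match by one letter, or stores its length and moves on. -/
def lcpStep : Prog :=
  13 ::= get 8 (reg 9) ;;
  .cond (reg 13)
    (12 ::= get 10 (reg 13 - 1) ;;
      .cond (eq (get 1 (reg 9 + reg 10)) (get 1 (reg 12 + reg 10))) (10 ::= reg 10 + 1)
        (.store 12 (reg 13) (reg 10) ;; 10 ::= reg 10 - 1 ;; 9 ::= reg 9 + 1))
    (9 ::= reg 9 + 1)

/-- Computes the longest common prefixes of suffixes of consecutive ranks. -/
def lcpLoop : Prog := 9 ::= 0 ;; 10 ::= 0 ;; .loop (lt (reg 9) (reg 0)) lcpStep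

/-- The state of the computation of longest common prefixes: those for the positions before `i` are
known, and at `i` the first `h` letters are known to match. -/
structure LcpInv (s rk sa L : ℕ → ℕ) (n i h : ℕ) : Prop where
  le : i + h ≤ n
  agree : 0 < h → i < n ∧ 0 < rk i ∧ ∀ e < h, s (i + e) = s (sa (rk i - 1) + e)
  done : ∀ j < i, 0 < rk j → IsLcp s (sa (rk j - 1)) j (L (rk j))

/-- Kasai's argument. Let p precede i in the suffix order with h common letters. Without their first
letters, p + 1 still comes before i + 1 and shares h - 1 letters with it. The immediate predecessor
of i + 1 lies at or after p + 1, hence shares at least as many. -/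
theorem LcpInv.next {s rk sa L : ℕ → ℕ} {n i h : ℕ} (hI : LcpInv s rk sa L n i h)
    (hs : IsText s n) (hrk : IsRank s n rk) (hsa : ∀ a < n, sa (rk a) = a) (hi : i < n)
    (hpos : 0 < rk i) (hne : s (i + h) ≠ s (sa (rk i - 1) + h)) :
    LcpInv s rk sa (Function.update L (rk i) h) n (i + 1) (h - 1) := by
  obtain ⟨p, hp, hpr⟩ := hrk.surj hs (show rk i - 1 < n by have := hrk.lt i hi; omega)
  have hsp : sa (rk i - 1) = p := by rw [← hpr, hsa p hp]
  have hag := hI.agree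
  rw [hsp] at hne hag
  have hpi : p ≠ i := by rintro rfl; omega
  have hlt : SufLt s p i := (hrk.lt_iff hs hp hi).1 (by omega)
  have hle := hI.le
  refine ⟨by omega, fun h1 => ?_, fun j hj hj0 => ?_⟩
  · obtain ⟨-, -, ha⟩ := hag (by omega)
    have hb := hs.lt_of_agree hi hp hpi.symm (h := 1) fun e he => ha e (by omega)
    have hlt' : SufLt s (p + 1) (i + 1) := by
      rcases sufLt_iff.1 hlt with h2 | ⟨-, h2⟩
      · have := ha 0 (by omega)
        rw [add_zero, add_zero] at this
        omega
      · exact h2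
    have hr := hrk.mono _ _ hb.2 hb.1 hlt'
    refine ⟨hb.1, by omega, ?_⟩
    obtain ⟨p', hp', hpr'⟩ := hrk.surj hs
      (show rk (i + 1) - 1 < n by have := hrk.lt _ hb.1; omega)
    rw [← hpr', hsa p' hp']
    have ha' : ∀ e < h - 1, s (p + 1 + e) = s (i + 1 + e) := fun e he => by
      have := ha (e + 1) (by omega)
      rw [show p + 1 + e = p + (e + 1) by omega, show i + 1 + e = i + (e + 1) by omega, this]
    -- The predecessor p' is either strictly between p + 1 and i + 1, or it is p + 1 itself.
    rcases Nat.lt_or_ge (rk (p + 1)) (rk p') with h3 | h3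
    · intro e he
      exact (((hrk.lt_iff hs hb.2 hp').1 h3).agree_of_between
        ((hrk.lt_iff hs hp' hb.1).1 (by omega)) ha' e he).symm
    · have : p + 1 = p' := hrk.inj hs hb.2 hp' (by omega)
      subst this
      exact fun e he => (ha' e he).symm
  · rcases Nat.lt_or_ge j i with h1 | h1
    · have : rk j ≠ rk i := fun h => by have := hrk.inj hs (by omega) hi h; omega
      rw [Function.update_of_ne this]
      exact hI.done j h1 hj0
    · obtain rfl : j = i := by omega
      rw [Function.update_self, hsp]
      refine ⟨fun e he => ((hag (by omega)).2.2 e he).symm, hne.symm⟩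

/-- The potential counts what is left of i and of i + h. A match advances i + h; a mismatch advances
i while i + h does not decrease. So there are at most 2n rounds. -/
theorem lcpLoop_spec (σ : State) (n : ℕ) (s : ℕ → ℕ) (h0 : σ.reg 0 = n) (hs : IsText s n)
    (hh : Holds (σ.arr 1) 0 n s) (hrk : IsRank s n (σ.arr 8))
    (hsa : ∀ a < n, σ.arr 10 (σ.arr 8 a) = a) :
    Tri lcpLoop (200 * (n + 1)) σ fun τ =>
      ∀ j < n, 0 < σ.arr 8 j → IsLcp s (σ.arr 10 (σ.arr 8 j - 1)) j (τ.arr 12 (σ.arr 8 j)) := by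
  have hle : 2 + (2 + (80 * (n + n) + 4)) ≤ 200 * (n + 1) := by omega
  refine Tri.le (Tri.seq (Tri.straight rfl (by decide) (Tri.seq (Tri.straight rfl (by decide)
    (Tri.le (Tri.loop (fun τ => LcpInv s (σ.arr 8) (σ.arr 10) (τ.arr 12) n (τ.reg 9) (τ.reg 10))
      (fun τ => 80 * ((n - τ.reg 9) + (n - (τ.reg 9 + τ.reg 10)))) ?_ ?_ ?_) ?_))))) hle
  · exact ⟨by simp [eval], by simp [eval], by simp [eval]⟩
  · intro τ hf hI hb
    have e0 : τ.reg 0 = n := by rw [hf.reg 0 rfl]; simp [eval, h0]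
    have e8 : τ.arr 8 = σ.arr 8 := by rw [hf.arr 8 rfl]; simp [eval]
    have e10 : τ.arr 10 = σ.arr 10 := by rw [hf.arr 10 rfl]; simp [eval]
    have e1 : τ.arr 1 = σ.arr 1 := by rw [hf.arr 1 rfl]; simp [eval]
    have hi : τ.reg 9 < n := by
      by_contra hcon
      exact hb (by simp [e0, hcon])
    have hle := hI.le
    refine ⟨70, Tri.straight rfl (by decide) ?_⟩
    rw [show (lt (reg 9) (reg 0)).cost = 3 from rfl]
    by_cases hr : σ.arr 8 (τ.reg 9) = 0
    · simp only [lcpStep, eval, val_get, val_reg, State.reg_setReg, if_true, e8, hr,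
        State.arr_setReg, ne_eq, not_true, if_false, val_add, val_ofNat]
      simp only [show (9 : ℕ) ≠ 13 by decide, show (10 : ℕ) ≠ 9 by decide,
        show (10 : ℕ) ≠ 13 by decide, if_false]
      -- A positive match length presupposes a predecessor, which the suffix of rank 0 does not
      -- have.
      have hh0 : τ.reg 10 = 0 := by
        by_contra hcon
        have := (hI.agree (by omega)).2.1
        omega
      refine ⟨⟨by omega, by omega, fun j hj hj0 => hI.done j ?_ hj0⟩, by omega⟩
      refine lt_of_le_of_ne (by omega) ?_
      rintro rfl; omega
    · obtain ⟨p, hp, hpr⟩ := hrk.surj hs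
        (show σ.arr 8 (τ.reg 9) - 1 < n by have := hrk.lt _ hi; omega)
      have hsp : σ.arr 10 (σ.arr 8 (τ.reg 9) - 1) = p := by rw [← hpr, hsa p hp]
      have hpi : p ≠ τ.reg 9 := by rintro rfl; omega
      have hx : ∀ x ≤ n, σ.arr 1 x = s x := fun x hx => by
        have := hh x (by omega); rwa [zero_add] at this
      have hag : ∀ e < τ.reg 10, s (τ.reg 9 + e) = s (p + e) := fun e he => by
        rw [(hI.agree (by omega)).2.2 e he, hsp]
      have hpn : p + τ.reg 10 ≤ n := by
        rcases Nat.eq_zero_or_pos (τ.reg 10) with h | h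
        · omega
        · have := hs.lt_of_agree hi hp hpi.symm (h := τ.reg 10 - 1) fun e he => hag e (by omega)
          omega
      by_cases heq : s (τ.reg 9 + τ.reg 10) = s (p + τ.reg 10)
      · have he : eval lcpStep τ = ((τ.setReg 13 (σ.arr 8 (τ.reg 9))).setReg 12 p).setReg 10
            (τ.reg 10 + 1) := by
          simp [lcpStep, eval, e8, e10, e1, hr, hsp, hx _ hpn, hx _ hle, heq]
        have ha : ∀ e ≤ τ.reg 10, s (τ.reg 9 + e) = s (p + e) := fun e he => by
          rcases he.lt_or_eq with h | h
          · exact hag e h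
          · rw [h, heq]
        have hb := hs.lt_of_agree hi hp hpi.symm ha
        rw [he]
        simp only [State.reg_setReg, State.arr_setReg]
        simp only [show (9 : ℕ) ≠ 13 by decide, show (9 : ℕ) ≠ 10 by decide,
          show (9 : ℕ) ≠ 12 by decide, if_false, if_true]
        refine ⟨⟨by omega, fun _ => ⟨hi, by omega, fun e he => ?_⟩, hI.done⟩, by omega⟩
        rw [hsp]
        exact ha e (by omega)
      · have he : eval lcpStep τ = ((((τ.setReg 13 (σ.arr 8 (τ.reg 9))).setReg 12 p).setArr 12
            (σ.arr 8 (τ.reg 9)) (τ.reg 10)).setReg 10 (τ.reg 10 - 1)).setReg 9 (τ.reg 9 + 1) := by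
          simp [lcpStep, eval, e8, e10, e1, hr, hsp, hx _ hpn, hx _ hle, heq]
        rw [he]
        simp only [State.reg_setReg, State.arr_setReg, State.arr_setArr, if_true]
        simp only [show (10 : ℕ) ≠ 9 by decide, if_false]
        refine ⟨hI.next hs hrk hsa hi (by omega) (by rwa [hsp]), by omega⟩
  · intro τ hf hI hb
    have e0 : τ.reg 0 = n := by rw [hf.reg 0 rfl]; simp [eval, h0]
    have hi : n ≤ τ.reg 9 := by
      by_contra hcon
      simp [e0, not_le.1 hcon] at hb
    exact fun j hj => hI.done j (hj.trans_le hi)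
  · rw [show (lt (reg 9) (reg 0)).cost = 3 from rfl]
    simp [eval]

theorem lcpProg_tame : (suffixLoop ;; lcpLoop).Tame 1 8 := by
  simp [suffixLoop, lcpLoop, lcpStep, forUp, Tame]
  constructorm* _ ∧ _ <;> intros <;> omega

/-! ### Range minima and common prefixes -/

/-- The minimum of `L` over the positions from `l` to `r`, without `r`, is `v`. -/
def IsMin (L : ℕ → ℕ) (l r v : ℕ) : Prop :=
  (∀ t, l ≤ t → t < r → v ≤ L t) ∧ ∃ t, l ≤ t ∧ t < r ∧ L t = v

theorem IsMin.single (L : ℕ → ℕ) (l : ℕ) : IsMin L l (l + 1) (L l) :=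
  ⟨fun t h1 h2 => by rw [show t = l by omega], l, le_rfl, by omega, rfl⟩

theorem IsMin.union {L : ℕ → ℕ} {l m m' r v w : ℕ} (h : IsMin L l m v) (h' : IsMin L m' r w)
    (h1 : l ≤ m') (h2 : m' ≤ m) (h3 : m ≤ r) : IsMin L l r (min v w) := by
  obtain ⟨ha, t, ht1, ht2, ht3⟩ := h
  obtain ⟨hb, t', ht1', ht2', ht3'⟩ := h'
  refine ⟨fun x hx1 hx2 => ?_, ?_⟩
  · rcases Nat.lt_or_ge x m with hx | hx
    · exact (min_le_left _ _).trans (ha x hx1 hx)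
    · exact (min_le_right _ _).trans (hb x (by omega) hx2)
  · rcases le_total v w with hvw | hvw
    · exact ⟨t, ht1, by omega, by rw [ht3, min_eq_left hvw]⟩
    · exact ⟨t', by omega, ht2', by rw [ht3', min_eq_right hvw]⟩

theorem IsMin.unique {L : ℕ → ℕ} {l r v w : ℕ} (h : IsMin L l r v) (h' : IsMin L l r w) :
    v = w := by
  obtain ⟨ha, t, ht1, ht2, rfl⟩ := h
  obtain ⟨hb, t', ht1', ht2', rfl⟩ := h'
  exact le_antisymm (ha _ ht1' ht2') (hb _ ht1 ht2)

/-- The longest common prefix of two suffixes is a minimum over a range of ranks. -/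
theorem isLcp_of_isMin {s rk L : ℕ → ℕ} {n : ℕ} (hs : IsText s n) (hrk : IsRank s n rk)
    (hL : ∀ i j, i < n → j < n → rk j = rk i + 1 → IsLcp s i j (L (rk j))) {i j v : ℕ}
    (hi : i < n) (hj : j < n) (hij : rk i < rk j) (hv : IsMin L (rk i + 1) (rk j + 1) v) :
    IsLcp s i j v := by
  -- Induction on the distance of the ranks. The suffix just before j is inserted, and `IsLcp.trans`
  -- matches the extension of the range by one entry.
  suffices H : ∀ d j v, j < n → rk j = rk i + 1 + d → IsMin L (rk i + 1) (rk j + 1) v →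
      IsLcp s i j v from H (rk j - (rk i + 1)) j v hj (by omega) hv
  clear hv hij hj
  intro d
  induction d with
  | zero =>
    intro j v hj hd hv
    obtain ⟨-, t, h1, h2, rfl⟩ := hv
    rw [show t = rk j by omega]
    exact hL i j hi hj (by omega)
  | succ d ih =>
    intro j v hj hd hv
    obtain ⟨p, hp, hpr⟩ := hrk.surj hs (show rk j - 1 < n by have := hrk.lt _ hj; omega)
    obtain ⟨w, hw⟩ : ∃ w, IsMin L (rk i + 1) (rk p + 1) w := by
      have hne : ((Finset.Ico (rk i + 1) (rk p + 1)).image L).Nonempty :=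
        (Finset.nonempty_Ico.2 (by omega)).image _
      refine ⟨Finset.min' _ hne, fun t h1 h2 => Finset.min'_le _ _ (Finset.mem_image_of_mem _
        (Finset.mem_Ico.2 ⟨h1, h2⟩)), ?_⟩
      · obtain ⟨t, ht, h⟩ := Finset.mem_image.1 (Finset.min'_mem _ hne)
        exact ⟨t, (Finset.mem_Ico.1 ht).1, (Finset.mem_Ico.1 ht).2, h⟩
    have h1 := ih p w hp (by omega) hw
    have h2 := hL p j hp hj (by omega)
    have h3 : v = min w (L (rk j)) := hv.unique (hw.union (IsMin.single L (rk j)) (by omega)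
      (by omega) (by omega))
    rw [h3]
    exact h1.trans h2 ((hrk.lt_iff hs hi hp).1 (by omega)) ((hrk.lt_iff hs hp hj).1 (by omega))

/-! ### Sets of bits -/

theorem testBit_sub_two_pow_log {m : ℕ} (hm : m ≠ 0) (j : ℕ) :
    (m - 2 ^ Nat.log 2 m).testBit j = true ↔ m.testBit j = true ∧ j ≠ Nat.log 2 m := by
  have h1 := Nat.pow_log_le_self 2 hm
  have h2 := Nat.lt_pow_succ_log_self (by omega : 1 < 2) m
  obtain ⟨r, hr⟩ : ∃ r, m = 2 ^ Nat.log 2 m + r := ⟨m - 2 ^ Nat.log 2 m, by omega⟩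
  set c := Nat.log 2 m
  clear_value c
  have hrc : r < 2 ^ c := by rw [Nat.succ_eq_add_one, pow_succ] at h2; omega
  subst hr
  rw [Nat.add_sub_cancel_left]
  rcases lt_trichotomy j c with h | rfl | h
  · rw [Nat.testBit_two_pow_add_gt h]
    simp [h.ne]
  · simp [Nat.testBit_lt_two_pow hrc]
  · have h3 : 2 ^ (c + 1) ≤ 2 ^ j := Nat.pow_le_pow_right (by omega) h
    have h4 : r < 2 ^ j := by rw [pow_succ] at h3; omega
    rw [Nat.testBit_lt_two_pow h4, Nat.testBit_lt_two_pow (h2.trans_le h3)]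
    simp

theorem testBit_add_two_pow {m p : ℕ} (hm : m < 2 ^ p) (j : ℕ) :
    (m + 2 ^ p).testBit j = true ↔ m.testBit j = true ∨ j = p := by
  rw [add_comm]
  rcases lt_trichotomy j p with h | rfl | h
  · rw [Nat.testBit_two_pow_add_gt h]
    simp [h.ne]
  · simp [Nat.testBit_two_pow_add_eq, Nat.testBit_lt_two_pow hm]
  · have h3 : 2 ^ (p + 1) ≤ 2 ^ j := Nat.pow_le_pow_right (by omega) h
    rw [pow_succ] at h3
    rw [Nat.testBit_lt_two_pow (by omega), Nat.testBit_lt_two_pow (by omega)]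
    simp; omega

theorem testBit_log {m : ℕ} (hm : m ≠ 0) : m.testBit (Nat.log 2 m) = true := by
  have h1 := Nat.pow_log_le_self 2 hm
  have h2 := Nat.lt_pow_succ_log_self (by omega : 1 < 2) m
  rw [Nat.testBit_eq_decide_div_mod_eq, decide_eq_true_eq]
  have : m / 2 ^ Nat.log 2 m = 1 := by
    rw [Nat.succ_eq_add_one, pow_succ] at h2
    exact Nat.div_eq_of_lt_le (by omega) (by omega)
  rw [this]

theorem le_log_of_testBit {m j : ℕ} (h : m.testBit j = true) : j ≤ Nat.log 2 m :=
  Nat.le_log_of_pow_le (by omega) (Nat.ge_two_pow_of_testBit h)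

/-- The number of bits of `m` among the lowest `b`. -/
def bitCount (b m : ℕ) : ℕ := ((Finset.range b).filter fun j => m.testBit j = true).card

theorem bitCount_pop {b m : ℕ} (hm : m ≠ 0) (hb : m < 2 ^ b) :
    bitCount b (m - 2 ^ Nat.log 2 m) + 1 ≤ bitCount b m := by
  refine Finset.card_lt_card (Finset.ssubset_iff_of_subset ?_ |>.2 ⟨Nat.log 2 m, ?_, ?_⟩)
  · intro j hj
    simp only [Finset.mem_filter] at hj ⊢
    exact ⟨hj.1, ((testBit_sub_two_pow_log hm j).1 hj.2).1⟩
  · simp only [Finset.mem_filter, Finset.mem_range]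
    exact ⟨Nat.log_lt_of_lt_pow hm hb, testBit_log hm⟩
  · simp [testBit_sub_two_pow_log hm]

theorem bitCount_push {b m p : ℕ} (hm : m < 2 ^ p) :
    bitCount b (m + 2 ^ p) ≤ bitCount b m + 1 := by
  refine (Finset.card_le_card (t := insert p ((Finset.range b).filter fun j => m.testBit j = true))
    ?_).trans (Finset.card_insert_le _ _)
  intro j hj
  simp only [Finset.mem_filter, Finset.mem_insert] at hj ⊢
  rcases (testBit_add_two_pow hm j).1 hj.2 with h | h
  · exact Or.inr ⟨hj.1, h⟩
  · exact Or.inl h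

theorem bitCount_zero (b : ℕ) : bitCount b 0 = 0 := by simp [bitCount]

/-- The lowest bit of `v` is at `d`. -/
def IsLowBit (v d : ℕ) : Prop := v.testBit d = true ∧ ∀ j < d, v.testBit j = false

theorem IsLowBit.of_odd {v : ℕ} (h : v % 2 = 1) : IsLowBit v 0 :=
  ⟨by simp [h], by simp⟩

theorem IsLowBit.of_even {v d : ℕ} (h : v % 2 = 0) (hd : IsLowBit (v / 2) d) :
    IsLowBit v (d + 1) := by
  refine ⟨by rw [Nat.testBit_succ]; exact hd.1, fun j hj => ?_⟩
  rcases j with _ | j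
  · simp [h]
  · rw [Nat.testBit_succ]; exact hd.2 j (by omega)

/-! ### Minima within a block -/

/-- In the block of `i`, the `j`-th entry is at most all later ones before `i`. -/
def BlockLe (L : ℕ → ℕ) (b i j : ℕ) : Prop :=
  j < i % b ∧ ∀ t, i - i % b + j ≤ t → t < i → L (i - i % b + j) ≤ L t

/-- The bits of `M` mark the entries in the block of `i` that are at most all later ones up to
`i`. -/
def IsMask (L : ℕ → ℕ) (b i M : ℕ) : Prop :=
  ∀ j, M.testBit j = true ↔
    j ≤ i % b ∧ ∀ t, i - i % b + j ≤ t → t ≤ i → L (i - i % b + j) ≤ L t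

/-- The bits of `m` mark entries in the block of `i` that are at most all later ones before `i`, and
those that are not marked exceed the entry `i`. -/
structure MaskInv (L : ℕ → ℕ) (b i m : ℕ) : Prop where
  sound : ∀ j, m.testBit j = true → BlockLe L b i j
  compl : ∀ j, BlockLe L b i j → ¬ m.testBit j = true → L i < L (i - i % b + j)

section

variable {L : ℕ → ℕ} {b i m : ℕ}

theorem MaskInv.zero (h : i % b = 0) : MaskInv L b i 0 :=
  ⟨by simp, fun j hj => by have := hj.1; omega⟩

theorem MaskInv.lt (h : MaskInv L b i m) : m < 2 ^ (i % b) := by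
  refine Nat.lt_pow_two_of_testBit _ fun j hj => ?_
  by_contra hcon
  have := (h.sound j (by simpa using hcon)).1
  omega

theorem MaskInv.pop (h : MaskInv L b i m) (hm : m ≠ 0)
    (hL : L i < L (i - i % b + Nat.log 2 m)) : MaskInv L b i (m - 2 ^ Nat.log 2 m) := by
  refine ⟨fun j hj => h.sound j ((testBit_sub_two_pow_log hm j).1 hj).1, fun j hj hne => ?_⟩
  by_cases h1 : m.testBit j = true
  · rw [testBit_sub_two_pow_log hm] at hne
    have : j = Nat.log 2 m := by
      by_contra hcon
      exact hne ⟨h1, hcon⟩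
    rwa [this]
  · exact h.compl j hj h1

/-- The marked entries form a stack with values that do not decrease towards the top. Once the top
is at most the entry i, so are all others, and nothing more has to be unmarked. -/
theorem MaskInv.isMask (h : MaskInv L b i m)
    (hL : m = 0 ∨ L (i - i % b + Nat.log 2 m) ≤ L i) : IsMask L b i (m + 2 ^ (i % b)) := by
  intro j
  rw [testBit_add_two_pow h.lt]
  constructor
  · rintro (h1 | rfl)
    · have h2 := h.sound j h1
      refine ⟨h2.1.le, fun t ht1 ht2 => ?_⟩
      rcases ht2.lt_or_eq with h3 | rfl
      · exact h2.2 t ht1 h3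
      · have hm : m ≠ 0 := by rintro rfl; simp at h1
        have h4 := (h.sound _ (testBit_log hm)).1
        exact (h2.2 (t - t % b + Nat.log 2 m) (by have := le_log_of_testBit h1; omega)
          (by have := Nat.mod_le t b; omega)).trans (hL.resolve_left hm)
    · refine ⟨le_rfl, fun t ht1 ht2 => ?_⟩
      have := Nat.mod_le i b
      rw [show t = i - i % b + i % b by omega]
  · rintro ⟨h1, h2⟩
    rcases h1.lt_or_eq with h3 | h3
    · left
      by_contra hcon
      have := h.compl j ⟨h3, fun t ht1 ht2 => h2 t ht1 ht2.le⟩ hcon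
      have h4 := h2 i (by have := Nat.mod_le i b; omega) le_rfl
      omega
    · exact Or.inr h3

theorem IsMask.next {M : ℕ} (h : IsMask L b i M) (hi : (i + 1) % b ≠ 0) :
    MaskInv L b (i + 1) M := by
  have h1 : (i + 1) % b = i % b + 1 := by
    rw [Nat.add_mod_eq_ite] at hi ⊢
    split_ifs at hi ⊢ with h2
    · rcases Nat.lt_or_ge 1 b with hb | hb
      · rw [Nat.mod_eq_of_lt hb] at hi h2
        have := Nat.mod_lt i (by omega : 0 < b)
        omega
      · interval_cases b <;> simp at hi h2 ⊢; omega
    · rcases Nat.lt_or_ge 1 b with hb | hb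
      · rw [Nat.mod_eq_of_lt hb]
      · interval_cases b <;> simp at hi h2 ⊢; omega
  have h2 : i + 1 - (i + 1) % b = i - i % b := by rw [h1]; omega
  have key : ∀ j, M.testBit j = true ↔ BlockLe L b (i + 1) j := by
    intro j
    rw [h j, BlockLe, h2, h1]
    simp only [Nat.lt_add_one_iff]
  exact ⟨fun j hj => (key j).1 hj, fun j hj hn => absurd ((key j).2 hj) hn⟩

theorem IsMask.lt {M : ℕ} (h : IsMask L b i M) (hb : 0 < b) : M < 2 ^ b := by
  refine Nat.lt_pow_two_of_testBit _ fun j hj => ?_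
  by_contra hcon
  have := ((h j).1 (by simpa using hcon)).1
  have := Nat.mod_lt i hb
  omega

/-- Any place of a minimum between l and i is marked. The first mark from l on is therefore no later
than such a place, and being marked its value is at most the minimum. Dividing by a power of two
removes the marks before l. -/
theorem IsMask.isMin {M l d : ℕ} (h : IsMask L b i M) (hl : l ≤ i) (hb : l / b = i / b)
    (hd : IsLowBit (M / 2 ^ (l % b)) d) : IsMin L l (i + 1) (L (l + d)) := by
  have h1 := Nat.div_add_mod l b
  have h2 := Nat.div_add_mod i b
  rw [hb] at h1
  obtain ⟨h3, h4⟩ := hd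
  rw [Nat.testBit_div_two_pow, h] at h3
  have e : i - i % b + (d + l % b) = l + d := by omega
  rw [e] at h3
  obtain ⟨h5, h6⟩ := h3
  refine ⟨fun t ht1 ht2 => ?_, l + d, by omega, by omega, rfl⟩
  by_contra! hcon
  have hne : ((Finset.Icc l i).image L).Nonempty := (Finset.nonempty_Icc.2 hl).image _
  obtain ⟨x, hx, hxm⟩ := Finset.mem_image.1 (Finset.min'_mem _ hne)
  rw [Finset.mem_Icc] at hx
  have hmin : ∀ y, l ≤ y → y ≤ i → L x ≤ L y := fun y hy1 hy2 => by
    rw [hxm]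
    exact Finset.min'_le _ _ (Finset.mem_image_of_mem _ (Finset.mem_Icc.2 ⟨hy1, hy2⟩))
  have hx1 := hmin t ht1 (by omega)
  have hxd : x < l + d := by
    by_contra hge
    have := h6 x (by omega) hx.2
    omega
  have := h4 (x - l) (by omega)
  rw [Nat.testBit_div_two_pow] at this
  have h7 := (h (x - l + l % b)).2 ⟨by omega, fun y hy1 hy2 => by
    have e2 : i - i % b + (x - l + l % b) = x := by omega
    rw [e2] at hy1 ⊢
    exact hmin y (by omega) hy2⟩
  rw [this] at h7
  exact absurd h7 (by simp)

theorem IsMask.ne_zero {M l : ℕ} (h : IsMask L b i M) (hl : l ≤ i) (hb : l / b = i / b) :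
    M / 2 ^ (l % b) ≠ 0 := by
  have h1 := Nat.div_add_mod l b
  have h2 := Nat.div_add_mod i b
  rw [hb] at h1
  intro h0
  have h3 := (h (i % b)).2 ⟨le_rfl, fun t ht1 ht2 => by
    rw [show t = i - i % b + i % b by omega]⟩
  have h4 := Nat.testBit_div_two_pow (n := l % b) M (i % b - l % b)
  rw [h0, show i % b - l % b + l % b = i % b by omega, h3] at h4
  simp at h4

end

/-! ### Preparing for range minimum queries -/

/-- Tabulates the powers of two up to the length of the text in array 14; the last exponent goes to
register 4. -/
def powLoop : Prog :=
  .store 14 0 1 ;; 4 ::= 0 ;;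
  .loop (lt (2 * get 14 (reg 4)) (reg 0 + 2))
    (.store 14 (reg 4 + 1) (cap (2 * get 14 (reg 4))) ;; 4 ::= reg 4 + 1)

/-- The final exponent is the logarithm of n + 1, rounded down. It becomes the block length b, so
that a mask of b bits is at most n and can index tables with n + 1 entries. -/
theorem powLoop_spec (σ : State) (n : ℕ) (h0 : σ.reg 0 = n) (hlim : 2 * n + 2 ≤ σ.reg 2) :
    Tri powLoop (40 * (n + 2)) σ fun τ =>
      (∀ j ≤ τ.reg 4, τ.arr 14 j = 2 ^ j) ∧ 2 ^ τ.reg 4 ≤ n + 1 ∧ n + 1 < 2 ^ (τ.reg 4 + 1) := by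
  have hle : 3 + (2 + (30 * (n + 1) + 8 + 1)) ≤ 40 * (n + 2) := by omega
  have hc : (lt (2 * get 14 (reg 4)) (reg 0 + 2)).cost = 8 := rfl
  refine Tri.le (Tri.seq (Tri.straight rfl (by decide) (Tri.seq (Tri.straight rfl (by decide)
    (Tri.le (Tri.loop (fun τ => (∀ j ≤ τ.reg 4, τ.arr 14 j = 2 ^ j) ∧ 2 ^ τ.reg 4 ≤ n + 1)
      (fun τ => 30 * (n + 1 - τ.reg 4)) ?_ ?_ ?_) ?_))))) hle
  · simp [eval]
  · rintro τ hf ⟨h1, h2⟩ hb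
    have e0 : τ.reg 0 = n := by rw [hf.reg 0 rfl]; simp [eval, h0]
    have e2 : τ.reg 2 = σ.reg 2 := by rw [hf.reg 2 rfl]; simp [eval]
    rw [val_lt_ne_zero] at hb
    simp only [val_mul, val_ofNat, val_get, val_reg, val_add, h1 _ le_rfl, e0] at hb
    have h3 : τ.reg 4 + 1 < 2 ^ (τ.reg 4 + 1) := Nat.lt_two_pow_self
    have h4 : 2 ^ (τ.reg 4 + 1) ≤ n + 1 := by rw [pow_succ]; omega
    have h5 : min (σ.reg 2) (2 * 2 ^ τ.reg 4) = 2 ^ (τ.reg 4 + 1) := by rw [pow_succ]; omega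
    refine ⟨16, Tri.straight rfl (by decide) ?_⟩
    rw [hc]
    simp only [eval, val_cap, val_mul, val_ofNat, val_get, val_reg, h1 _ le_rfl, e2, h5, val_add,
      State.reg_setReg, State.reg_setArr, if_true, State.arr_setReg, State.arr_setArr]
    refine ⟨⟨fun j hj => ?_, h4⟩, by omega⟩
    rw [Function.update_apply]
    split_ifs with h
    · rw [h]
    · exact h1 j (by omega)
  · rintro τ hf ⟨h1, h2⟩ hb
    have e0 : τ.reg 0 = n := by rw [hf.reg 0 rfl]; simp [eval, h0]
    refine ⟨h1, h2, ?_⟩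
    by_contra hcon
    have := (val_lt_ne_zero (σ := τ) (e := 2 * get 14 (reg 4)) (f := reg 0 + 2)).2 (by
      simp only [val_mul, val_ofNat, val_get, val_reg, val_add, h1 _ le_rfl, e0]
      rw [pow_succ] at hcon
      omega)
    exact this hb
  · rw [hc]
    simp [eval]

/-- Tabulates the lowest bits in array 15 and the highest bits in array 16. -/
def bitLoop : Prog :=
  forUp 9 (reg 0 + 1) (.cond (lt (reg 9) 2) (.store 16 (reg 9) 0 ;; .store 15 (reg 9) 0)
    (.store 16 (reg 9) (get 16 (reg 9 / 2) + 1) ;;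
      .cond (reg 9 % 2) (.store 15 (reg 9) 0) (.store 15 (reg 9) (get 15 (reg 9 / 2) + 1))))

theorem bitLoop_spec (σ : State) (n : ℕ) (h0 : σ.reg 0 = n) :
    Tri bitLoop (100 * (n + 2)) σ fun τ =>
      ∀ v ≤ n, τ.arr 16 v = Nat.log 2 v ∧ (v ≠ 0 → IsLowBit v (τ.arr 15 v)) := by
  refine Tri.le (Tri.forUp (n + 1) 60 (fun k τ => ∀ v < k, τ.arr 16 v = Nat.log 2 v ∧
    (v ≠ 0 → IsLowBit v (τ.arr 15 v))) (by decide) (by rfl)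
    (fun τ hf => by simp [hf.reg 0 rfl, h0]) (by simp) ?_
    fun τ _ _ h v hv => h v (by omega)) (by omega)
  intro k τ hk hi hf hI
  refine Tri.straight rfl (by decide) ?_
  suffices H : ∀ τ' : State, τ' = eval (.cond (lt (reg 9) 2) (.store 16 (reg 9) 0 ;;
      .store 15 (reg 9) 0) (.store 16 (reg 9) (get 16 (reg 9 / 2) + 1) ;;
      .cond (reg 9 % 2) (.store 15 (reg 9) 0) (.store 15 (reg 9) (get 15 (reg 9 / 2) + 1)))) τ →
      ∃ a c, τ'.arr 16 = Function.update (τ.arr 16) k a ∧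
        τ'.arr 15 = Function.update (τ.arr 15) k c ∧ a = Nat.log 2 k ∧
        (k ≠ 0 → IsLowBit k c) by
    obtain ⟨a, c, h1, h2, h3, h4⟩ := H _ rfl
    intro v hv
    rw [State.arr_setReg, h1, h2, Function.update_apply, Function.update_apply]
    split_ifs with h
    · subst h; exact ⟨h3, h4⟩
    · exact hI v (by omega)
  rintro _ rfl
  by_cases h2 : k < 2
  · refine ⟨0, 0, by simp [eval, hi, h2], by simp [eval, hi, h2], (Nat.log_of_lt h2).symm, ?_⟩
    intro h
    exact .of_odd (by omega)
  · obtain ⟨h3, h4⟩ := hI (k / 2) (by omega)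
    by_cases ho : k % 2 = 0
    · refine ⟨τ.arr 16 (k / 2) + 1, τ.arr 15 (k / 2) + 1, by simp [eval, hi, h2, ho],
        by simp [eval, hi, h2, ho], ?_, fun _ => .of_even ho (h4 (by omega))⟩
      rw [h3, Nat.log_of_one_lt_of_le (n := k) (by omega) (by omega)]
    · refine ⟨τ.arr 16 (k / 2) + 1, 0, by simp [eval, hi, h2, ho],
        by simp [eval, hi, h2, ho], ?_, fun _ => .of_odd (by omega)⟩
      rw [h3, Nat.log_of_one_lt_of_le (n := k) (by omega) (by omega)]

/-- Unmarks the last marked entry if it exceeds the current one; otherwise marks the current one,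
stores the mask and moves on. -/
def maskStep : Prog :=
  13 ::= reg 9 % reg 4 ;; 12 ::= get 16 (reg 10) ;;
  .cond (lt 0 (reg 10) * lt (get 12 (reg 9)) (get 12 (reg 9 - reg 13 + reg 12)))
    (10 ::= reg 10 - get 14 (reg 12))
    (10 ::= cap (reg 10 + get 14 (reg 13)) ;; .store 13 (reg 9) (reg 10) ;; 9 ::= reg 9 + 1 ;;
      .cond (reg 9 % reg 4) .skip (10 ::= 0))

/-- Computes the masks for the blocks of the length in register 4. -/
def maskLoop : Prog := 9 ::= 0 ;; 10 ::= 0 ;; .loop (lt (reg 9) (reg 0)) maskStep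

/-- Amortised as for a stack: unmarking removes one bit, and moving on adds at most one bit while i
advances. The weight 2 on the remaining entries pays for the move and for a later removal. -/
theorem maskLoop_spec (σ : State) (n b : ℕ) (h0 : σ.reg 0 = n) (h4 : σ.reg 4 = b) (hb : 0 < b)
    (hbn : 2 ^ b ≤ n + 1) (hlim : 2 * n + 2 ≤ σ.reg 2) (hpow : ∀ j ≤ b, σ.arr 14 j = 2 ^ j)
    (hlog : ∀ v ≤ n, σ.arr 16 v = Nat.log 2 v) :
    Tri maskLoop (300 * (n + 1)) σ fun τ => ∀ i < n, IsMask (σ.arr 12) b i (τ.arr 13 i) := by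
  have hle : 2 + (2 + (100 * (2 * n) + 4)) ≤ 300 * (n + 1) := by omega
  have hc : (lt (reg 9) (reg 0)).cost = 3 := rfl
  refine Tri.le (Tri.seq (Tri.straight rfl (by decide) (Tri.seq (Tri.straight rfl (by decide)
    (Tri.le (Tri.loop (fun τ => τ.reg 9 ≤ n ∧
        MaskInv (σ.arr 12) b (τ.reg 9) (τ.reg 10) ∧
        ∀ i < τ.reg 9, IsMask (σ.arr 12) b i (τ.arr 13 i))
      (fun τ => 100 * (2 * (n - τ.reg 9) + bitCount b (τ.reg 10))) ?_ ?_ ?_) ?_))))) hle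
  · exact ⟨by simp [eval], by simpa [eval] using MaskInv.zero (by simp), by simp [eval]⟩
  · rintro τ hf ⟨hin, hI, hM⟩ hb'
    have e0 : τ.reg 0 = n := by rw [hf.reg 0 rfl]; simp [eval, h0]
    have e2 : τ.reg 2 = σ.reg 2 := by rw [hf.reg 2 rfl]; simp [eval]
    have e4 : τ.reg 4 = b := by rw [hf.reg 4 rfl]; simp [eval, h4]
    have e12 : τ.arr 12 = σ.arr 12 := by rw [hf.arr 12 rfl]; simp [eval]
    have e14 : τ.arr 14 = σ.arr 14 := by rw [hf.arr 14 rfl]; simp [eval]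
    have e16 : τ.arr 16 = σ.arr 16 := by rw [hf.arr 16 rfl]; simp [eval]
    rw [val_lt_ne_zero] at hb'
    simp only [val_reg, e0] at hb'
    have hmod := Nat.mod_lt (τ.reg 9) hb
    have hmlt := hI.lt
    have hmb : τ.reg 10 < 2 ^ b := hmlt.trans (Nat.pow_lt_pow_right (by omega) hmod)
    have hl : σ.arr 16 (τ.reg 10) = Nat.log 2 (τ.reg 10) := hlog _ (by omega)
    refine ⟨90, Tri.straight rfl (by decide) ?_⟩
    rw [hc]
    by_cases hpop : τ.reg 10 ≠ 0 ∧ σ.arr 12 (τ.reg 9) <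
        σ.arr 12 (τ.reg 9 - τ.reg 9 % b + Nat.log 2 (τ.reg 10))
    · obtain ⟨hm, hL⟩ := hpop
      have hlb : Nat.log 2 (τ.reg 10) ≤ b := (Nat.log_lt_of_lt_pow hm hmb).le
      have he : eval maskStep τ = ((τ.setReg 13 (τ.reg 9 % b)).setReg 12
          (Nat.log 2 (τ.reg 10))).setReg 10 (τ.reg 10 - 2 ^ Nat.log 2 (τ.reg 10)) := by
        simp [maskStep, eval, e4, e16, hl, e12, hL, Nat.pos_of_ne_zero hm, e14, hpow _ hlb]
      rw [he]
      have hpc := bitCount_pop hm hmb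
      simp only [State.reg_setReg, State.arr_setReg]
      simp only [show (9 : ℕ) ≠ 13 by decide, show (9 : ℕ) ≠ 10 by decide,
          show (9 : ℕ) ≠ 12 by decide, if_false, if_true]
      exact ⟨⟨hin, hI.pop hm hL, hM⟩, by omega⟩
    · have hcond : (lt 0 (reg 10) * lt (get 12 (reg 9)) (get 12 (reg 9 - reg 13 + reg 12))).val
          ((τ.setReg 13 (τ.reg 9 % b)).setReg 12 (Nat.log 2 (τ.reg 10))) = 0 := by
        by_contra hcon
        have h := mul_ne_zero_iff.1 hcon
        rw [val_lt_ne_zero, val_lt_ne_zero] at h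
        simp [e12] at h
        exact hpop ⟨by omega, h.2⟩
      have hL : τ.reg 10 = 0 ∨ σ.arr 12 (τ.reg 9 - τ.reg 9 % b + Nat.log 2 (τ.reg 10)) ≤
          σ.arr 12 (τ.reg 9) := by
        by_contra! hcon
        exact hpop hcon
      have hmask := hI.isMask hL
      set M := τ.reg 10 + 2 ^ (τ.reg 9 % b) with hMdef
      have hMb := hmask.lt hb
      have hpc : bitCount b M ≤ bitCount b (τ.reg 10) + 1 := bitCount_push hmlt
      have hcap : min (σ.reg 2) M = M := by omega
      have he : (eval maskStep τ).reg 9 = τ.reg 9 + 1 ∧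
          (eval maskStep τ).reg 10 = (if (τ.reg 9 + 1) % b = 0 then 0 else M) ∧
          (eval maskStep τ).arr 13 = Function.update (τ.arr 13) (τ.reg 9) M := by
        have h1 : eval (12 ::= get 16 (reg 10)) (eval (13 ::= reg 9 % reg 4) τ) =
            (τ.setReg 13 (τ.reg 9 % b)).setReg 12 (Nat.log 2 (τ.reg 10)) := by
          simp [eval, e4, e16, hl]
        have h2 : σ.arr 14 (τ.reg 9 % b) = 2 ^ (τ.reg 9 % b) := hpow _ hmod.le
        rw [show eval maskStep τ = eval (.cond _ _ _) (eval (12 ::= get 16 (reg 10))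
          (eval (13 ::= reg 9 % reg 4) τ)) from rfl, h1]
        rw [eval, hcond]
        by_cases h : (τ.reg 9 + 1) % b = 0
        · simp [eval, e14, h2, e2, e4, ← hMdef, hcap, h]
        · simp [eval, e14, h2, e2, e4, ← hMdef, hcap, h]
      obtain ⟨he9, he10, he13⟩ := he
      rw [he9, he10, he13]
      refine ⟨⟨by omega, ?_, fun i hi => ?_⟩, ?_⟩
      · split_ifs with h
        · exact .zero h
        · exact hmask.next h
      · rw [Function.update_apply]
        split_ifs with h
        · rw [h]; exact hmask
        · exact hM i (by omega)
      · have : bitCount b (if (τ.reg 9 + 1) % b = 0 then 0 else M) ≤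
            bitCount b (τ.reg 10) + 1 := by
          split_ifs
          · rw [bitCount_zero]; omega
          · exact hpc
        omega
  · rintro τ hf ⟨hin, hI, hM⟩ hb'
    have e0 : τ.reg 0 = n := by rw [hf.reg 0 rfl]; simp [eval, h0]
    have hi : n ≤ τ.reg 9 := by
      by_contra hcon
      simp [e0, not_le.1 hcon] at hb'
    exact fun i h => hM i (h.trans_le hi)
  · rw [hc]
    simp [eval, bitCount_zero]

/-- Minima over `2 ^ j` blocks from the block `x` on are in `T (j * c + x)`, for `c` blocks of length
`b`. -/
def IsTable (L T : ℕ → ℕ) (b c : ℕ) : Prop :=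
  ∀ j x, x + 2 ^ j ≤ c → IsMin L (x * b) ((x + 2 ^ j) * b) (T (j * c + x))

@[simp] theorem Expr.lo_get (a : ℕ) (e : Expr) : (get a e).lo = 0 := rfl

/-- The smaller of two values. -/
def Expr.least (e f : Expr) : Expr := e - (e - f)

@[simp] theorem Expr.val_least (σ : State) (e f : Expr) :
    (least e f).val σ = min (e.val σ) (f.val σ) := by
  simp only [least, val_sub]
  omega

@[simp] theorem Expr.bd_least (e f : Expr) (M : ℕ) : (least e f).bd M = e.bd M := rfl

@[simp] theorem Expr.safe_least (e f : Expr) (L : ℕ) :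
    (least e f).Safe L ↔ e.Safe L ∧ f.Safe L := by
  simp [least]

/-- Computes the number of blocks and the table of minima over blocks in array 17. -/
def tableLoop : Prog :=
  5 ::= reg 0 / reg 4 ;; 6 ::= cap (reg 5 * (get 16 (reg 5) + 1)) ;;
  forUp 9 (reg 6) (10 ::= reg 9 / reg 5 ;; 12 ::= reg 9 - reg 5 ;;
    .cond (reg 10)
      (.store 17 (reg 9) (least (get 17 (reg 12)) (get 17 (reg 12 + get 14 (reg 10 - 1)))))
      (12 ::= cap (reg 9 * reg 4) ;;
        .store 17 (reg 9) (get 12 (reg 12 + get 15 (get 13 (reg 12 + reg 4 - 1))))))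

/-- The tables for the bits of numbers up to `n`, and the length `b` of the blocks. -/
structure IsBitTable (pow low log : ℕ → ℕ) (n b : ℕ) : Prop where
  pos : 0 < b
  le : 2 ^ b ≤ n + 1
  lt : n + 1 < 2 ^ (b + 1)
  pow : ∀ j ≤ b, pow j = 2 ^ j
  log : ∀ v ≤ n, log v = Nat.log 2 v
  low : ∀ v ≤ n, v ≠ 0 → IsLowBit v (low v)

/-- The table is filled row by row, row j holding the minima over 2 ^ j blocks. Cells whose range
would pass the last whole block may hold anything, and `IsTable` is silent about them. -/
theorem tableLoop_spec (σ : State) (n b : ℕ) (h0 : σ.reg 0 = n) (h4 : σ.reg 4 = b)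
    (hB : IsBitTable (σ.arr 14) (σ.arr 15) (σ.arr 16) n b) (hlim : 3 * n + 10 ≤ σ.reg 2)
    (hM : ∀ i < n, IsMask (σ.arr 12) b i (σ.arr 13 i)) :
    Tri tableLoop (300 * (n + 1)) σ fun τ => τ.reg 5 = n / b ∧
      IsTable (σ.arr 12) (τ.arr 17) b (n / b) := by
  have hb := hB.pos
  set c := n / b with hc
  have hcb : c * b ≤ n := Nat.div_mul_le_self n b
  have hcn : c ≤ n := Nat.div_le_self n b
  have hlogb : Nat.log 2 c ≤ b := by
    have := Nat.log_mono_right (b := 2) (show c ≤ n + 1 by omega)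
    have h2 := Nat.log_lt_of_lt_pow (by omega) hB.lt
    omega
  set N := c * (Nat.log 2 c + 1) with hN
  -- The reason for blocks of logarithmic length: c blocks with log c + 1 ≤ b + 1 rows give at most
  -- c b + c ≤ 2n cells.
  have hN2 : N ≤ 2 * n := by
    have h1 : N ≤ c * (b + 1) := Nat.mul_le_mul_left _ (by omega)
    have h2 : c * (b + 1) = c * b + c := by ring
    omega
  have hle : 4 + (20 + (N + 1) * (100 + 20)) ≤ 300 * (n + 1) := by omega
  refine Tri.le (Tri.seq (Tri.straight rfl (by decide) (Tri.seq (Tri.straight rfl (by decide)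
    ?_)))) hle
  set σ₁ := eval (6 ::= cap (reg 5 * (get 16 (reg 5) + 1))) (eval (5 ::= reg 0 / reg 4) σ) with hσ₁
  have e5 : σ₁.reg 5 = c := by simp [hσ₁, eval, h0, h4, hc]
  have e4 : σ₁.reg 4 = b := by simp [hσ₁, eval, h4]
  have e2 : σ₁.reg 2 = σ.reg 2 := by simp [hσ₁, eval]
  have e6 : σ₁.reg 6 = N := by
    simp [hσ₁, eval, h0, h4, ← hc, hB.log c hcn, ← hN]; omega
  have ea : σ₁.arr = σ.arr := by simp [hσ₁, eval]
  clear_value σ₁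
  refine Tri.forUp N 100 (fun v τ => ∀ j x, x + 2 ^ j ≤ c → j * c + x < v →
    IsMin (σ.arr 12) (x * b) ((x + 2 ^ j) * b) (τ.arr 17 (j * c + x))) (by decide) (by rfl)
    (fun τ hf => by simp [hf.reg 6 rfl, e6]) (by intros; omega) ?_ ?_
  · intro v τ hv hi hf hI
    have f5 : τ.reg 5 = c := by rw [hf.reg 5 rfl, e5]
    have f4 : τ.reg 4 = b := by rw [hf.reg 4 rfl, e4]
    have f2 : τ.reg 2 = σ.reg 2 := by rw [hf.reg 2 rfl, e2]
    have f12 : τ.arr 12 = σ.arr 12 := by rw [hf.arr 12 rfl, ea]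
    have f13 : τ.arr 13 = σ.arr 13 := by rw [hf.arr 13 rfl, ea]
    have f14 : τ.arr 14 = σ.arr 14 := by rw [hf.arr 14 rfl, ea]
    have f15 : τ.arr 15 = σ.arr 15 := by rw [hf.arr 15 rfl, ea]
    refine Tri.straight rfl (by decide) ?_
    suffices H : ∀ τ' : State, τ' = eval (10 ::= reg 9 / reg 5 ;; 12 ::= reg 9 - reg 5 ;;
        .cond (reg 10)
          (.store 17 (reg 9) (least (get 17 (reg 12)) (get 17 (reg 12 + get 14 (reg 10 - 1)))))
          (12 ::= cap (reg 9 * reg 4) ;;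
            .store 17 (reg 9) (get 12 (reg 12 + get 15 (get 13 (reg 12 + reg 4 - 1)))))) τ →
        ∃ w, τ'.arr 17 = Function.update (τ.arr 17) v w ∧ ∀ j x, x + 2 ^ j ≤ c → j * c + x = v →
          IsMin (σ.arr 12) (x * b) ((x + 2 ^ j) * b) w by
      obtain ⟨w, h1, h2⟩ := H _ rfl
      intro j x hjx hlt
      rw [State.arr_setReg, h1, Function.update_apply]
      split_ifs with h
      · exact h2 j x hjx h
      · exact hI j x hjx (by omega)
    rintro _ rfl
    by_cases h : v / c = 0
    -- Row 0: the lowest bit in the mask of the last entry of a block points to the minimum of the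
    -- whole block.
    · refine ⟨σ.arr 12 (v * b + σ.arr 15 (σ.arr 13 (v * b + b - 1))), ?_, ?_⟩
      · rcases Nat.div_eq_zero_iff.1 h with h' | h'
        · rw [h', zero_mul] at hN; omega
        have : v * b ≤ c * b := Nat.mul_le_mul_right _ h'.le
        have hm : min (σ.reg 2) (v * b) = v * b := by omega
        simp [eval, hi, f5, f4, f2, f12, f13, f15, h, hm]
      · intro j x hjx hv'
        have hp := Nat.one_le_two_pow (n := j)
        have hj : j = 0 := by
          rw [← hv', add_comm, Nat.add_mul_div_right _ _ (by omega : 0 < c)] at h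
          exact (Nat.add_eq_zero_iff.1 h).2
        subst hj
        have hv'' : x = v := by omega
        subst hv''
        have h1 : (x + 1) * b ≤ c * b := Nat.mul_le_mul_right _ (by simpa using hjx)
        have h2 : (x + 1) * b = x * b + b := by ring
        have h3 : x * b / b = (x * b + b - 1) / b := by
          rw [Nat.mul_div_cancel _ hb]
          refine (Nat.div_eq_of_lt_le (by omega) ?_).symm
          rw [h2]
          omega
        have hmk := hM (x * b + b - 1) (by omega)
        have h5 := hmk.ne_zero (by omega) h3
        have h6 := hmk.lt hb
        have hle := hB.le
        rw [Nat.mul_mod_left, pow_zero, Nat.div_one] at h5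
        have h7 := hmk.isMin (l := x * b) (by omega) h3 (d := σ.arr 15 (σ.arr 13 (x * b + b - 1))) (by
          rw [Nat.mul_mod_left, pow_zero, Nat.div_one]
          exact hB.low _ (by omega) h5)
        rw [pow_zero, h2]
        rwa [show x * b + b - 1 + 1 = x * b + b by omega] at h7
    -- Row j + 1 joins two adjacent ranges of row j, the second one 2 ^ j blocks further on.
    · refine ⟨min (τ.arr 17 (v - c)) (τ.arr 17 (v - c + σ.arr 14 (v / c - 1))), ?_, ?_⟩
      · simp [eval, hi, f5, f14, h]
      · intro j x hjx hv'
        rcases j with _ | j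
        · exfalso
          apply h
          rw [Nat.div_eq_zero_iff]
          right
          simp at hjx hv'
          omega
        have hp := Nat.one_le_two_pow (n := j)
        have hpw : 2 ^ (j + 1) = 2 * 2 ^ j := by ring
        have hv2 : v / c = j + 1 := by
          rw [← hv', add_comm, Nat.add_mul_div_right _ _ (by omega : 0 < c),
            Nat.div_eq_of_lt (by omega)]
          omega
        have hv3 : (j + 1) * c + x = j * c + x + c := by ring
        have hjb : j ≤ b := by
          by_contra hcon
          have : 2 ^ (b + 1) ≤ 2 ^ j := Nat.pow_le_pow_right (by omega) (by omega)
          have := hB.lt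
          omega
        rw [hv2, Nat.add_sub_cancel, hB.pow j hjb, show v - c = j * c + x by omega]
        have h1 := hI j x (by omega) (by omega)
        have h2 := hI j (x + 2 ^ j) (by omega) (by omega)
        rw [← add_assoc] at h2
        rw [show x + 2 ^ (j + 1) = x + 2 ^ j + 2 ^ j by omega]
        exact h1.union h2 (Nat.mul_le_mul_right _ (by omega)) le_rfl
          (Nat.mul_le_mul_right _ (by omega))
  · intro τ _ hf hI
    refine ⟨by rw [hf.reg 5 rfl, e5], fun j x hjx => hI j x hjx ?_⟩
    have hp := Nat.one_le_two_pow (n := j)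
    have hj : j ≤ Nat.log 2 c := Nat.le_log_of_pow_le (by omega) (by omega)
    calc j * c + x < j * c + c := by omega
      _ = c * (j + 1) := by ring
      _ ≤ N := Nat.mul_le_mul_left _ (by omega)

/-! ### Range minimum queries in constant time -/

/-- The minimum from the position in register `x` to the one in register `y`, both in one block. -/
def Expr.blockMin (x y : ℕ) : Expr :=
  get 12 (reg x + get 15 (get 13 (reg y) / get 14 (reg x % reg 4)))

theorem blockMin_val (σ : State) (n b x y : ℕ) (h4 : σ.reg 4 = b)
    (hB : IsBitTable (σ.arr 14) (σ.arr 15) (σ.arr 16) n b)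
    (hM : ∀ i < n, IsMask (σ.arr 12) b i (σ.arr 13 i)) (hxy : σ.reg x ≤ σ.reg y)
    (hy : σ.reg y < n) (hb : σ.reg x / b = σ.reg y / b) :
    IsMin (σ.arr 12) (σ.reg x) (σ.reg y + 1) ((blockMin x y).val σ) := by
  have h1 := hM _ hy
  have h2 := Nat.mod_lt (σ.reg x) hB.pos
  have h3 := h1.lt hB.pos
  have h5 := hB.le
  simp only [blockMin, val_get, val_add, val_reg, val_div, val_mod, h4, hB.pow _ h2.le]
  refine h1.isMin hxy hb (hB.low _ ?_ (h1.ne_zero hxy hb))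
  have := Nat.div_le_self (σ.arr 13 (σ.reg y)) (2 ^ (σ.reg x % b))
  omega

theorem Prog.eval_cond_of_eq {b : Expr} {p q : Prog} {σ : State} (h : b.val σ = 0) :
    (Prog.cond b p q).eval σ = q.eval σ := by simp [eval, h]

/-- The minimum if the positions are in different blocks, with the end of the first block in register
22 and the start of the last one in register 23. -/
def farQuery : Prog :=
  28 ::= least (blockMin 24 22) (blockMin 23 25) ;; 29 ::= reg 27 - reg 26 - 1 ;;
    .cond (reg 29)
      (29 ::= get 16 (reg 29) ;;
        28 ::= least (reg 28) (least (get 17 (cap (reg 29 * reg 5) + reg 26 + 1))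
          (get 17 (cap (reg 29 * reg 5) + reg 27 - get 14 (reg 29))))) .skip

/-- The minimum from the position in register 24 to the one in register 25 goes to register 28. -/
def minQuery : Prog :=
  26 ::= reg 24 / reg 4 ;; 27 ::= reg 25 / reg 4 ;;
  .cond (eq (reg 26) (reg 27)) (28 ::= blockMin 24 25)
    (22 ::= cap (reg 26 * reg 4 + reg 4 - 1) ;; 23 ::= cap (reg 27 * reg 4) ;; farQuery)

theorem minQuery_tame : minQuery.Tame 0 8 := by
  simp [minQuery, farQuery, blockMin, Tame]
  constructorm* _ ∧ _ <;> intros <;> omega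

/-- A range across blocks consists of the end of the first block, the start of the last one, and
whole blocks in between. The whole blocks, if any, are covered by two ranges of 2 ^ j blocks each,
which may overlap since only a minimum is wanted. -/
theorem minQuery_spec (σ : State) (n b l r : ℕ) (h4 : σ.reg 4 = b) (h5 : σ.reg 5 = n / b)
    (hB : IsBitTable (σ.arr 14) (σ.arr 15) (σ.arr 16) n b) (hlim : 3 * n + 10 ≤ σ.reg 2)
    (hM : ∀ i < n, IsMask (σ.arr 12) b i (σ.arr 13 i))
    (hT : IsTable (σ.arr 12) (σ.arr 17) b (n / b)) (h24 : σ.reg 24 = l) (h25 : σ.reg 25 = r)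
    (hlr : l ≤ r) (hr : r < n) :
    Tri minQuery 200 σ fun τ => IsMin (σ.arr 12) l (r + 1) (τ.reg 28) := by
  have hb := hB.pos
  have hl1 := Nat.div_add_mod' l b
  have hr1 := Nat.div_add_mod' r b
  have hl2 := Nat.mod_lt l hb
  have hr2 := Nat.mod_lt r hb
  have hle : 4 + (4 + 150) ≤ 200 := by omega
  refine Tri.le (Tri.seq (Tri.straight rfl (by decide) (Tri.seq (Tri.straight rfl (by decide)
    (Tri.straight rfl (by decide) ?_))))) hle
  set σ₁ := eval (27 ::= reg 25 / reg 4) (eval (26 ::= reg 24 / reg 4) σ) with hσ₁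
  have e26 : σ₁.reg 26 = l / b := by simp [hσ₁, eval, h24, h4]
  have e27 : σ₁.reg 27 = r / b := by simp [hσ₁, eval, h25, h4]
  have e24 : σ₁.reg 24 = l := by simp [hσ₁, eval, h24]
  have e25 : σ₁.reg 25 = r := by simp [hσ₁, eval, h25]
  have e4 : σ₁.reg 4 = b := by simp [hσ₁, eval, h4]
  have e5 : σ₁.reg 5 = n / b := by simp [hσ₁, eval, h5]
  have e2 : σ₁.reg 2 = σ.reg 2 := by simp [hσ₁, eval]
  have ea : σ₁.arr = σ.arr := by simp [hσ₁, eval]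
  clear_value σ₁
  rw [← ea] at hB hM hT ⊢
  by_cases heq : l / b = r / b
  · have h1 := blockMin_val σ₁ n b 24 25 e4 hB hM (by omega) (by omega) (by rw [e24, e25, heq])
    rw [e24, e25] at h1
    simpa [eval, e26, e27, heq] using h1
  have hlt : l / b < r / b := lt_of_le_of_ne (Nat.div_le_div_right hlr) heq
  have hmul : (l / b + 1) * b ≤ r / b * b := Nat.mul_le_mul_right _ hlt
  have hmul' : (l / b + 1) * b = l / b * b + b := by ring
  have hrn : r / b ≤ n / b := Nat.div_le_div_right hr.le
  set σ₂ := eval (23 ::= cap (reg 27 * reg 4)) (eval (22 ::= cap (reg 26 * reg 4 + reg 4 - 1)) σ₁)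
    with hσ₂
  have f22 : σ₂.reg 22 = l / b * b + b - 1 := by simp [hσ₂, eval, e26, e4]; omega
  have f23 : σ₂.reg 23 = r / b * b := by simp [hσ₂, eval, e27, e4]; omega
  have f4 : σ₂.reg 4 = b := by simp [hσ₂, eval, e4]
  have f5 : σ₂.reg 5 = n / b := by simp [hσ₂, eval, e5]
  have f2 : σ₂.reg 2 = σ.reg 2 := by simp [hσ₂, eval, e2]
  have f24 : σ₂.reg 24 = l := by simp [hσ₂, eval, e24]
  have f25 : σ₂.reg 25 = r := by simp [hσ₂, eval, e25]
  have f26 : σ₂.reg 26 = l / b := by simp [hσ₂, eval, e26]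
  have f27 : σ₂.reg 27 = r / b := by simp [hσ₂, eval, e27]
  have fa : σ₂.arr = σ₁.arr := by simp [hσ₂, eval]
  have hne : (eq (reg 26) (reg 27)).val σ₁ = 0 := by simp [e26, e27, heq]
  rw [Prog.eval_cond_of_eq hne, show ∀ p, eval (22 ::= cap (reg 26 * reg 4 + reg 4 - 1) ;;
    23 ::= cap (reg 27 * reg 4) ;; p) σ₁ = eval p σ₂ from fun p => rfl]
  clear_value σ₂
  rw [← fa] at hB hM hT ⊢
  have g1 := blockMin_val σ₂ n b 24 22 f4 hB hM (by omega) (by omega) (by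
    rw [f24, f22]
    symm
    refine Nat.div_eq_of_lt_le (by omega) ?_
    rw [hmul']
    omega)
  have g2 := blockMin_val σ₂ n b 23 25 f4 hB hM (by omega) (by omega) (by
    rw [f23, f25, Nat.mul_div_cancel _ hb])
  rw [f24, f22] at g1
  rw [f23, f25] at g2
  set w₁ := (blockMin 24 22).val σ₂
  set w₂ := (blockMin 23 25).val σ₂
  by_cases h29 : r / b - l / b - 1 = 0
  · have : r / b = l / b + 1 := by omega
    have h3 := g1.union g2 (by omega) (by rw [this]; omega) (by omega)
    simpa [farQuery, eval, f26, f27, h29] using h3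
  · set d := r / b - l / b - 1 with hd
    have hdn : d ≤ n := (Nat.sub_le _ _).trans ((Nat.sub_le _ _).trans (Nat.div_le_self _ _) |>.trans
      hr.le)
    have hlog := hB.log d hdn
    set j := Nat.log 2 d with hj
    have hj1 : 2 ^ j ≤ d := Nat.pow_log_le_self 2 h29
    have hj2 : d < 2 ^ (j + 1) := Nat.lt_pow_succ_log_self (by omega) d
    rw [pow_succ] at hj2
    have hjb : j ≤ b := by
      by_contra hcon
      have : 2 ^ (b + 1) ≤ 2 ^ j := Nat.pow_le_pow_right (by omega) (by omega)
      have := hB.lt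
      omega
    have t1 := hT j (l / b + 1) (by omega)
    have t2 := hT j (r / b - 2 ^ j) (by omega)
    have t3 := t1.union t2 (Nat.mul_le_mul_right _ (by omega)) (Nat.mul_le_mul_right _ (by omega))
      (Nat.mul_le_mul_right _ (by omega))
    rw [show r / b - 2 ^ j + 2 ^ j = r / b by omega] at t3
    have t4 := (g1.union t3 (by omega) (by omega) (by omega)).union g2 (by omega) (by omega)
      (by omega)
    -- The cap on the row offset has no effect: j ≤ b, and b (n / b) ≤ n.
    have hjn : j * (n / b) ≤ σ.reg 2 := by
      have h6 : j * (n / b) ≤ b * (n / b) := Nat.mul_le_mul_right _ hjb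
      have h7 := Nat.mul_div_le n b
      omega
    have key : (eval farQuery σ₂).reg 28 =
        min (min w₁ w₂) (min (σ₂.arr 17 (j * (n / b) + l / b + 1))
          (σ₂.arr 17 (j * (n / b) + r / b - 2 ^ j))) := by
      simp [farQuery, eval, f26, f27, ← hd, h29, hlog, f5, hB.pow j hjb, f2, hjn, w₁, w₂]
    rw [key, add_assoc, Nat.add_sub_assoc (by omega)]
    convert t4 using 1
    omega

/-! ### Longest common prefixes in constant time -/

/-- The memory is ready for queries about the text `s` of length `n`. -/
structure IsReady (σ : State) (s : ℕ → ℕ) (n : ℕ) : Prop where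
  len : σ.reg 0 = n
  lim : 3 * n + 10 ≤ σ.reg 2
  blocks : σ.reg 5 = n / σ.reg 4
  text : IsText s n
  rank : IsRank s n (σ.arr 8)
  lcp : ∀ i j, i < n → j < n → σ.arr 8 j = σ.arr 8 i + 1 → IsLcp s i j (σ.arr 12 (σ.arr 8 j))
  bits : IsBitTable (σ.arr 14) (σ.arr 15) (σ.arr 16) n (σ.reg 4)
  mask : ∀ i < n, IsMask (σ.arr 12) (σ.reg 4) i (σ.arr 13 i)
  table : IsTable (σ.arr 12) (σ.arr 17) (σ.reg 4) (n / σ.reg 4)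

theorem IsReady.congr {σ τ : State} {s : ℕ → ℕ} {n : ℕ} (h : IsReady σ s n) (ha : τ.arr = σ.arr)
    (h0 : τ.reg 0 = σ.reg 0) (h2 : τ.reg 2 = σ.reg 2) (h4 : τ.reg 4 = σ.reg 4)
    (h5 : τ.reg 5 = σ.reg 5) : IsReady τ s n := by
  refine ⟨h0 ▸ h.len, h2 ▸ h.lim, ?_, h.text, ?_, ?_, ?_, ?_, ?_⟩
  · rw [h4, h5]; exact h.blocks
  · rw [ha]; exact h.rank
  · rw [ha]; exact h.lcp
  · rw [ha, h4]; exact h.bits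
  · rw [ha, h4]; exact h.mask
  · rw [ha, h4]; exact h.table

/-- Prepares the memory for queries. -/
def prepare : Prog :=
  rankProg ;; suffixLoop ;; lcpLoop ;; powLoop ;; bitLoop ;; maskLoop ;; tableLoop

theorem prepare_tame : prepare.Tame 4 8 := by
  have h1 := rankProg_tame
  have h2 := lcpProg_tame.mono (show 1 ≤ 4 by omega)
  refine ⟨h1, h2.1, h2.2, ?_⟩
  simp [powLoop, bitLoop, maskLoop, maskStep, tableLoop, forUp, Tame]
  constructorm* _ ∧ _ <;> intros <;> omega

theorem prepare_spec (σ : State) (n al : ℕ) (hn : 0 < n) (h0 : σ.reg 0 = n) (h3 : σ.reg 3 = al)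
    (h2 : 100 * n + al + 100 ≤ σ.reg 2) (h5 : σ.reg 5 = 0) (h11 : σ.reg 11 = 0)
    (ha1 : ∀ i, σ.arr 1 i = 0) (ha3 : σ.arr 3 0 = 0) (hu : ∀ i, σ.arr 0 i ≤ al) :
    Tri prepare (260000 * (al + 2) * n) σ fun τ => IsReady τ (textOf n (σ.arr 0)) n := by
  have hle : 250000 * (al + 2) * n + (30 * (n + 1) + (200 * (n + 1) + (40 * (n + 2) +
      (100 * (n + 2) + (300 * (n + 1) + 300 * (n + 1)))))) ≤ 260000 * (al + 2) * n := by
    have e1 : 250000 * (al + 2) * n = 250000 * ((al + 2) * n) := by ring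
    have e3 : 260000 * (al + 2) * n = 260000 * ((al + 2) * n) := by ring
    have e4 : 2 * n ≤ (al + 2) * n := Nat.mul_le_mul_right _ (by omega)
    rw [e1, e3]
    omega
  set s := textOf n (σ.arr 0)
  have hs : IsText s n := isText_textOf n _
  refine Tri.le (Tri.seq ((rankProg_spec σ n al hn h0 h3 h2 h5 h11 ha1 ha3 hu).imp ?_)) hle
  rintro σ₁ hf₁ ⟨hh, hrk⟩
  have a0 : σ₁.reg 0 = n := by rw [hf₁.reg 0 rfl, h0]
  have a2 : σ₁.reg 2 = σ.reg 2 := hf₁.reg 2 rfl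
  refine Tri.seq ((suffixLoop_spec σ₁ n a0 fun a b ha hb h => hrk.inj hs ha hb h).imp ?_)
  intro σ₂ hf₂ hsa
  have b8 : σ₂.arr 8 = σ₁.arr 8 := hf₂.arr 8 rfl
  rw [← b8] at hrk hsa
  have b0 : σ₂.reg 0 = n := by rw [hf₂.reg 0 rfl, a0]
  have b2 : σ₂.reg 2 = σ.reg 2 := by rw [hf₂.reg 2 rfl, a2]
  refine Tri.seq ((lcpLoop_spec σ₂ n s b0 hs (by rwa [hf₂.arr 1 rfl]) hrk hsa).imp ?_)
  intro σ₃ hf₃ hlcp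
  have c0 : σ₃.reg 0 = n := by rw [hf₃.reg 0 rfl, b0]
  have c2 : σ₃.reg 2 = σ.reg 2 := by rw [hf₃.reg 2 rfl, b2]
  have c8 : σ₃.arr 8 = σ₂.arr 8 := hf₃.arr 8 rfl
  refine Tri.seq ((powLoop_spec σ₃ n c0 (by omega)).imp ?_)
  rintro σ₄ hf₄ ⟨hpow, hb1, hb2⟩
  have d0 : σ₄.reg 0 = n := by rw [hf₄.reg 0 rfl, c0]
  have d2 : σ₄.reg 2 = σ.reg 2 := by rw [hf₄.reg 2 rfl, c2]
  refine Tri.seq ((bitLoop_spec σ₄ n d0).imp ?_)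
  intro σ₅ hf₅ hbit
  have e0 : σ₅.reg 0 = n := by rw [hf₅.reg 0 rfl, d0]
  have e2 : σ₅.reg 2 = σ.reg 2 := by rw [hf₅.reg 2 rfl, d2]
  have e4 : σ₅.reg 4 = σ₄.reg 4 := hf₅.reg 4 rfl
  have hB : IsBitTable (σ₅.arr 14) (σ₅.arr 15) (σ₅.arr 16) n (σ₅.reg 4) := by
    rw [e4, hf₅.arr 14 rfl]
    refine ⟨?_, hb1, hb2, hpow, fun v hv => (hbit v hv).1, fun v hv => (hbit v hv).2⟩
    by_contra hcon
    rw [show σ₄.reg 4 = 0 by omega] at hb2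
    omega
  refine Tri.seq ((maskLoop_spec σ₅ n _ e0 rfl hB.pos hB.le (by omega) hB.pow hB.log).imp ?_)
  intro σ₆ hf₆ hmask
  have f0 : σ₆.reg 0 = n := by rw [hf₆.reg 0 rfl, e0]
  have f2 : σ₆.reg 2 = σ.reg 2 := by rw [hf₆.reg 2 rfl, e2]
  have f12 : σ₆.arr 12 = σ₅.arr 12 := hf₆.arr 12 rfl
  have f4 : σ₆.reg 4 = σ₅.reg 4 := hf₆.reg 4 rfl
  rw [← f12, ← f4] at hmask
  rw [← hf₆.arr 14 rfl, ← hf₆.arr 15 rfl, ← hf₆.arr 16 rfl, ← f4] at hB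
  refine (tableLoop_spec σ₆ n _ f0 rfl hB (by omega) hmask).imp ?_
  rintro τ hf ⟨h5', htab⟩
  have g8 : τ.arr 8 = σ₂.arr 8 := by rw [hf.arr 8 rfl, hf₆.arr 8 rfl, hf₅.arr 8 rfl,
    hf₄.arr 8 rfl, c8]
  have g12 : τ.arr 12 = σ₃.arr 12 := by
    rw [hf.arr 12 rfl, f12, hf₅.arr 12 rfl, hf₄.arr 12 rfl]
  have g4 : τ.reg 4 = σ₆.reg 4 := hf.reg 4 rfl
  refine ⟨by rw [hf.reg 0 rfl, f0], by rw [hf.reg 2 rfl, f2]; omega, by rw [h5', g4], hs,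
    by rwa [g8], ?_, ?_, ?_, ?_⟩
  · intro i j hi hj hij
    rw [g8] at hij ⊢
    rw [g12]
    have := hlcp j hj (by omega)
    rwa [hij, Nat.add_sub_cancel, hsa i hi, ← hij] at this
  · rw [hf.arr 14 rfl, hf.arr 15 rfl, hf.arr 16 rfl, g4]
    exact hB
  · rw [hf.arr 12 rfl, hf.arr 13 rfl, g4]
    exact hmask
  · rw [hf.arr 12 rfl, g4]
    exact htab

/-- The length of the longest common prefix of the suffixes at the registers 20 and 21 goes to
register 28. -/
def lcpQuery : Prog :=
  22 ::= get 8 (reg 20) ;; 23 ::= get 8 (reg 21) ;;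
  .cond (lt (reg 22) (reg 23)) (24 ::= cap (reg 22 + 1) ;; 25 ::= reg 23)
    (24 ::= cap (reg 23 + 1) ;; 25 ::= reg 22) ;; minQuery

/-- Entry r of array 12 belongs to the suffixes of ranks r - 1 and r, so the range starts just
behind the smaller rank. By symmetry the order of i and j does not matter. -/
theorem lcpQuery_spec (σ : State) (s : ℕ → ℕ) (n i j : ℕ) (h : IsReady σ s n)
    (h20 : σ.reg 20 = i) (h21 : σ.reg 21 = j) (hi : i < n) (hj : j < n) (hij : i ≠ j) :
    Tri lcpQuery 300 σ fun τ => IsLcp s i j (τ.reg 28) := by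
  have hle : 3 + (3 + (40 + 200)) ≤ 300 := by omega
  refine Tri.le (Tri.seq (Tri.straight rfl (by decide) (Tri.seq (Tri.straight rfl (by decide)
    (Tri.seq (Tri.straight rfl (by decide) ?_)))))) hle
  have hri := h.rank.lt i hi
  have hrj := h.rank.lt j hj
  have hlim := h.lim
  set σ₁ := eval (23 ::= get 8 (reg 21)) (eval (22 ::= get 8 (reg 20)) σ) with hσ₁
  have e22 : σ₁.reg 22 = σ.arr 8 i := by simp [hσ₁, eval, h20]
  have e23 : σ₁.reg 23 = σ.arr 8 j := by simp [hσ₁, eval, h21]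
  have hR : IsReady σ₁ s n := h.congr (by simp [hσ₁, eval]) (by simp [hσ₁, eval])
    (by simp [hσ₁, eval]) (by simp [hσ₁, eval]) (by simp [hσ₁, eval])
  have ea : σ₁.arr = σ.arr := by simp [hσ₁, eval]
  clear_value σ₁
  set σ₂ := eval (.cond (lt (reg 22) (reg 23)) (24 ::= cap (reg 22 + 1) ;; 25 ::= reg 23)
    (24 ::= cap (reg 23 + 1) ;; 25 ::= reg 22)) σ₁ with hσ₂
  have hlim₁ := hR.lim
  have key : σ₂.reg 24 = min (σ.arr 8 i) (σ.arr 8 j) + 1 ∧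
      σ₂.reg 25 = max (σ.arr 8 i) (σ.arr 8 j) ∧ IsReady σ₂ s n ∧ σ₂.arr = σ.arr := by
    by_cases hlt : σ.arr 8 i < σ.arr 8 j
    · refine ⟨?_, ?_, hR.congr ?_ ?_ ?_ ?_ ?_, ?_⟩ <;> simp [hσ₂, eval, e22, e23, hlt, ea] <;> omega
    · refine ⟨?_, ?_, hR.congr ?_ ?_ ?_ ?_ ?_, ?_⟩ <;> simp [hσ₂, eval, e22, e23, hlt, ea] <;> omega
  obtain ⟨g24, g25, hR₂, ga⟩ := key
  clear_value σ₂
  have hne : σ.arr 8 i ≠ σ.arr 8 j := fun h' => hij (h.rank.inj h.text hi hj h')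
  refine (minQuery_spec σ₂ n _ _ _ rfl hR₂.blocks hR₂.bits hR₂.lim hR₂.mask hR₂.table g24 g25
    (by omega) (by omega)).imp fun τ _ hmin => ?_
  rw [ga] at hmin
  rcases lt_or_gt_of_ne hne with hlt | hlt
  · rw [min_eq_left hlt.le, max_eq_right hlt.le] at hmin
    exact isLcp_of_isMin h.text h.rank h.lcp hi hj hlt hmin
  · rw [min_eq_right hlt.le, max_eq_left hlt.le] at hmin
    exact (isLcp_of_isMin h.text h.rank h.lcp hj hi hlt hmin).symm

/-! ### Counting mismatches -/

/-- The number of positions before `i` with a letter that differs from the one `p` places later. -/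
def mismatches (s : ℕ → ℕ) (p i : ℕ) : ℕ :=
  ((Finset.range i).filter fun x => s x ≠ s (x + p)).card

theorem mismatches_zero (s : ℕ → ℕ) (p : ℕ) : mismatches s p 0 = 0 := by simp [mismatches]

theorem mismatches_succ (s : ℕ → ℕ) (p i : ℕ) :
    mismatches s p (i + 1) = mismatches s p i + if s i ≠ s (i + p) then 1 else 0 := by
  unfold mismatches
  rw [Finset.range_add_one, Finset.filter_insert]
  split_ifs with h
  · rw [Finset.card_insert_of_notMem (by simp)]
  · rfl

theorem mismatches_mono (s : ℕ → ℕ) (p : ℕ) {i j : ℕ} (h : i ≤ j) :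
    mismatches s p i ≤ mismatches s p j :=
  Finset.card_le_card (Finset.filter_subset_filter _ (Finset.range_mono h))

theorem mismatches_of_agree {s : ℕ → ℕ} {p i h : ℕ} (ha : ∀ e < h, s (i + e) = s (i + p + e)) :
    mismatches s p (i + h) = mismatches s p i := by
  induction h with
  | zero => rfl
  | succ h ih =>
    rw [← add_assoc, mismatches_succ, ih fun e he => ha e (by omega)]
    have := ha h (by omega)
    rw [show i + p + h = i + h + p by omega] at this
    simp [this]

/-- Jumps to the next mismatch, and behind it. -/
def jumpStep : Prog :=
  lcpQuery ;; 20 ::= cap (reg 20 + reg 28) ;; 21 ::= cap (reg 21 + reg 28) ;;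
  .cond (lt (reg 21) (reg 0))
    (18 ::= cap (reg 18 + 1) ;; 20 ::= cap (reg 20 + 1) ;; 21 ::= cap (reg 21 + 1)) .skip

/-- Counts the mismatches, but only until there are more than allowed. -/
def jumpLoop : Prog := .loop (lt (reg 21) (reg 0) * lt (reg 18) (reg 1 + 1)) jumpStep

/-- Counts the mismatches with the shift in register 17. -/
def shiftStep : Prog :=
  18 ::= 0 ;; 20 ::= 0 ;; 21 ::= reg 17 ;; jumpLoop ;;
  .cond (eq (reg 18) (reg 1)) (19 ::= cap 1) .skip ;; 17 ::= cap (reg 17 + 1)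

/-- Tries all shifts. -/
def search : Prog :=
  17 ::= cap 1 ;; 19 ::= 0 ;; .loop (lt (reg 17) (reg 0)) shiftStep ;; 0 ::= reg 19

/-- The search takes about kn steps, so a growth of even one per step would spoil the linear space
bound. For this reason counters and positions are capped, and even the constant 1 is written as `cap
1`: an empty memory bounds nothing but 0. -/
theorem search_tame : search.Tame 0 8 := by
  have h := minQuery_tame
  simp [search, shiftStep, jumpLoop, jumpStep, lcpQuery, Tame, h]
  intros; omega

/-- Up to the end of the common prefix nothing is counted. There, either the text is over, or the
letters differ and one mismatch is counted and passed. So a step that does not finish the shift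
raises the count. -/
theorem jumpStep_spec (σ : State) (s : ℕ → ℕ) (n p i : ℕ) (hR : IsReady σ s n)
    (h20 : σ.reg 20 = i) (h21 : σ.reg 21 = i + p) (hp : 0 < p) (hi : i + p < n)
    (h18 : σ.reg 18 = mismatches s p i) :
    Tri jumpStep 400 σ fun τ => ∃ i', τ.reg 20 = i' ∧ τ.reg 21 = i' + p ∧ i' + p ≤ n ∧
      τ.reg 18 = mismatches s p i' ∧ (i' + p < n → τ.reg 18 = σ.reg 18 + 1) ∧
      (σ.reg 18 ≤ τ.reg 18 ∧ τ.reg 18 ≤ σ.reg 18 + 1) ∧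
      (τ.reg 18 = σ.reg 18 → i' + p = n) := by
  have hle : 300 + (9 + (9 + 40)) ≤ 400 := by omega
  have hlim := hR.lim
  refine Tri.le (Tri.seq ((lcpQuery_spec σ s n i (i + p) hR h20 h21 (by omega) hi
    (by omega)).imp ?_)) hle
  intro τ hf hl
  set h := τ.reg 28
  have hle : i + p + h ≤ n := by
    rcases Nat.eq_zero_or_pos h with h0 | h0
    · omega
    · have := hR.text.lt_of_agree (i := i) (j := i + p) (h := h - 1) (by omega) hi (by omega)
        fun e he => hl.1 e (by omega)
      omega
  have hm := mismatches_of_agree hl.1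
  have e0 : τ.reg 0 = n := by rw [hf.reg 0 rfl, hR.len]
  have e2 : τ.reg 2 = σ.reg 2 := hf.reg 2 rfl
  have e18 : τ.reg 18 = mismatches s p i := by rw [hf.reg 18 rfl, h18]
  have e20 : τ.reg 20 = i := by rw [hf.reg 20 rfl, h20]
  have e21 : τ.reg 21 = i + p := by rw [hf.reg 21 rfl, h21]
  have hmle : mismatches s p i ≤ i := (Finset.card_filter_le _ _).trans (by simp)
  refine Tri.seq (Tri.straight rfl (by decide) (Tri.seq (Tri.straight rfl (by decide)
    (Tri.straight rfl (by decide) ?_))))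
  set ρ := eval (21 ::= cap (reg 21 + reg 28)) (eval (20 ::= cap (reg 20 + reg 28)) τ) with hρ
  have f0 : ρ.reg 0 = n := by simp [hρ, eval, e0]
  have f2 : ρ.reg 2 = σ.reg 2 := by simp [hρ, eval, e2]
  have f18 : ρ.reg 18 = mismatches s p i := by simp [hρ, eval, e18]
  have f20 : ρ.reg 20 = i + h := by simp [hρ, eval, e20, e2, h]; omega
  have f21 : ρ.reg 21 = i + h + p := by simp [hρ, eval, e21, e2, h]; omega
  clear_value ρ
  rw [h18]
  by_cases hlt : i + h + p < n
  · have hs := mismatches_succ s p (i + h)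
    have hne := hl.2
    rw [show i + p + h = i + h + p by omega] at hne
    rw [if_pos hne, hm] at hs
    have k1 : min (σ.reg 2) (mismatches s p i + 1) = mismatches s p i + 1 := by omega
    have k2 : min (σ.reg 2) (i + h + 1) = i + h + 1 := by omega
    have k3 : min (σ.reg 2) (i + h + p + 1) = i + h + p + 1 := by omega
    refine ⟨i + h + 1, ?_⟩
    rw [hs]
    simp [eval, f0, f18, f20, f21, hlt, f2, k1, k2, k3]
    omega
  · refine ⟨i + h, ?_⟩
    rw [hm]
    simp [eval, f0, f18, f20, f21, hlt]
    omega

/-- At most k + 1 steps raise the count, and one more may reach the end; 500 per step exceeds the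
cost of a jump and of the test. -/
theorem jumpLoop_spec (σ : State) (s : ℕ → ℕ) (n p : ℕ) (hR : IsReady σ s n)
    (h20 : σ.reg 20 = 0) (h21 : σ.reg 21 = p) (hp : 0 < p) (hpn : p < n) (h18 : σ.reg 18 = 0) :
    Tri jumpLoop (500 * (σ.reg 1 + 3)) σ fun τ =>
      (τ.reg 18 = σ.reg 1 ↔ mismatches s p (n - p) = σ.reg 1) := by
  have hc : (lt (reg 21) (reg 0) * lt (reg 18) (reg 1 + 1)).cost = 9 := rfl
  refine Tri.le (Tri.loop (fun τ => ∃ i, τ.reg 20 = i ∧ τ.reg 21 = i + p ∧ i + p ≤ n ∧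
      τ.reg 18 = mismatches s p i)
    (fun τ => 500 * ((σ.reg 1 + 1 - τ.reg 18) + if τ.reg 21 < n then 1 else 0)) ?_ ?_ ?_) ?_
  · exact ⟨0, h20, by omega, by omega, by rw [h18, mismatches_zero]⟩
  · rintro τ hf ⟨i, g20, g21, hi, g18⟩ hb
    have hR' : IsReady τ s n := hR.congr (funext fun a => hf.arr a rfl) (hf.reg 0 rfl)
      (hf.reg 2 rfl) (hf.reg 4 rfl) (hf.reg 5 rfl)
    have h := mul_ne_zero_iff.1 hb
    rw [val_lt_ne_zero, val_lt_ne_zero] at h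
    simp only [val_reg, val_add, val_ofNat, hR'.len, hf.reg 1 rfl] at h
    refine ⟨_, (jumpStep_spec τ s n p i hR' g20 g21 hp (by omega) g18).imp ?_⟩
    rintro ρ - ⟨i', k20, k21, k1, k18, k2, k3, k4⟩
    refine ⟨⟨i', k20, k21, k1, k18⟩, ?_⟩
    rw [hc, if_pos h.1, k21]
    split_ifs <;> omega
  · rintro τ hf ⟨i, g20, g21, hi, g18⟩ hb
    have hlen : τ.reg 0 = n := by rw [hf.reg 0 rfl, hR.len]
    have h : ¬ (i + p < n ∧ τ.reg 18 < σ.reg 1 + 1) := by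
      rintro ⟨h1, h2⟩
      refine (mul_ne_zero_iff.2 ⟨val_lt_ne_zero.2 ?_, val_lt_ne_zero.2 ?_⟩ :
        (lt (reg 21) (reg 0)).val τ * (lt (reg 18) (reg 1 + 1)).val τ ≠ 0) hb
      · simp only [val_reg, g21, hlen, h1]
      · simp only [val_reg, val_add, val_ofNat, hf.reg 1 rfl, h2]
    by_cases hin : i + p < n
    -- The loop was left early with more than k mismatches, and the total is at least the partial
    -- count; neither equals k.
    · have h1 : σ.reg 1 < τ.reg 18 := by
        by_contra hcon
        exact h ⟨hin, by omega⟩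
      have h2 := mismatches_mono s p (show i ≤ n - p by omega)
      omega
    · rw [g18, show i = n - p by omega]
  · rw [hc]
    split_ifs <;> omega

theorem shiftStep_spec (σ : State) (s : ℕ → ℕ) (n p : ℕ) (hR : IsReady σ s n)
    (h17 : σ.reg 17 = p) (hp : 0 < p) (hpn : p < n) :
    Tri shiftStep (500 * (σ.reg 1 + 4)) σ fun τ => τ.reg 17 = p + 1 ∧
      τ.reg 19 = if mismatches s p (n - p) = σ.reg 1 then 1 else σ.reg 19 := by
  have hle : 2 + (2 + (2 + (500 * (σ.reg 1 + 3) + (20 + 10)))) ≤ 500 * (σ.reg 1 + 4) := by omega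
  have hlim := hR.lim
  refine Tri.le (Tri.seq (Tri.straight rfl (by decide) (Tri.seq (Tri.straight rfl (by decide)
    (Tri.seq (Tri.straight rfl (by decide) (Tri.seq ?_))))))) hle
  set σ₁ := eval (21 ::= reg 17) (eval (20 ::= 0) (eval (18 ::= 0) σ)) with hσ₁
  have e1 : σ₁.reg 1 = σ.reg 1 := by simp [hσ₁, eval]
  have e2 : σ₁.reg 2 = σ.reg 2 := by simp [hσ₁, eval]
  have e19 : σ₁.reg 19 = σ.reg 19 := by simp [hσ₁, eval]
  have e17 : σ₁.reg 17 = p := by simp [hσ₁, eval, h17]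
  have := jumpLoop_spec σ₁ s n p (hR.congr (by simp [hσ₁, eval]) (by simp [hσ₁, eval])
    (by simp [hσ₁, eval]) (by simp [hσ₁, eval]) (by simp [hσ₁, eval])) (by simp [hσ₁, eval])
    (by simp [hσ₁, eval, h17]) hp hpn (by simp [hσ₁, eval])
  rw [e1] at this
  refine this.imp fun τ hf h => ?_
  have f1 : τ.reg 1 = σ.reg 1 := by rw [hf.reg 1 rfl, e1]
  have f2 : τ.reg 2 = σ.reg 2 := by rw [hf.reg 2 rfl, e2]
  have f17 : τ.reg 17 = p := by rw [hf.reg 17 rfl, e17]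
  have f19 : τ.reg 19 = σ.reg 19 := by rw [hf.reg 19 rfl, e19]
  refine Tri.seq (Tri.straight rfl (by decide) (Tri.straight rfl (by decide) ?_))
  have k1 : min (σ.reg 2) 1 = 1 := by omega
  have k2 : min (σ.reg 2) (p + 1) = p + 1 := by omega
  by_cases hm : mismatches s p (n - p) = σ.reg 1
  · have h' := h.2 hm
    simp [eval, h', f1, f2, f17, hm, k1, k2]
  · have h' : τ.reg 18 ≠ σ.reg 1 := fun hc => hm (h.1 hc)
    simp [eval, h', f1, f2, f17, hm, k2, f19]

/-- Register 19 is a flag that is set but never cleared. It records whether a shift tried so far has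
exactly k mismatches. -/
theorem search_spec (σ : State) (s : ℕ → ℕ) (n : ℕ) (hR : IsReady σ s n) :
    Tri search (500 * (σ.reg 1 + 5) * (n + 1)) σ fun τ =>
      (((∃ p, 0 < p ∧ p < n ∧ mismatches s p (n - p) = σ.reg 1) → τ.reg 0 = 1) ∧
        (¬ (∃ p, 0 < p ∧ p < n ∧ mismatches s p (n - p) = σ.reg 1) → τ.reg 0 = 0)) := by
  have hc : (lt (reg 17) (reg 0)).cost = 3 := rfl
  have hlim := hR.lim
  set k := σ.reg 1
  have hle : 10 + (2 + ((500 * (k + 5) * n + 4) + 2)) ≤ 500 * (k + 5) * (n + 1) := by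
    rw [Nat.mul_add (500 * (k + 5)) n 1]
    omega
  refine Tri.le (Tri.seq (Tri.straight rfl (by decide) (Tri.seq (Tri.straight rfl (by decide)
    (Tri.seq (Tri.le (Tri.loop (fun τ => 0 < τ.reg 17 ∧
      (τ.reg 19 = 0 ∨ τ.reg 19 = 1) ∧
      (τ.reg 19 = 1 ↔ ∃ p, 0 < p ∧ p < n ∧ p < τ.reg 17 ∧ mismatches s p (n - p) = k))
      (fun τ => 500 * (k + 5) * (n - τ.reg 17)) ?_ ?_ ?_) ?_)))))) hle
  · have : 1 ≤ σ.reg 2 := by omega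
    simp [eval, this]
  · rintro τ hf ⟨hI1, hI2, hI3⟩ hb
    have e1 : τ.reg 1 = k := by rw [hf.reg 1 rfl]; simp [eval, k]
    have hR' : IsReady τ s n := hR.congr
      (funext fun a => by rw [hf.arr a rfl]; simp [eval])
      (by rw [hf.reg 0 rfl]; simp [eval]) (by rw [hf.reg 2 rfl]; simp [eval])
      (by rw [hf.reg 4 rfl]; simp [eval]) (by rw [hf.reg 5 rfl]; simp [eval])
    rw [val_lt_ne_zero] at hb
    simp only [val_reg, hR'.len] at hb
    refine ⟨_, (shiftStep_spec τ s n _ hR' rfl hI1 hb).imp ?_⟩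
    rintro ρ - ⟨h17, h19⟩
    rw [e1] at h19
    have hex : (∃ p, 0 < p ∧ p < n ∧ p < τ.reg 17 + 1 ∧ mismatches s p (n - p) = k) ↔
        mismatches s (τ.reg 17) (n - τ.reg 17) = k ∨
        ∃ p, 0 < p ∧ p < n ∧ p < τ.reg 17 ∧ mismatches s p (n - p) = k := by
      constructor
      · rintro ⟨p, h1, h2, h3, h4⟩
        rcases (Nat.lt_add_one_iff.1 h3).lt_or_eq with h5 | rfl
        · exact Or.inr ⟨p, h1, h2, h5, h4⟩
        · exact Or.inl h4
      · rintro (h | ⟨p, h1, h2, h3, h4⟩)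
        · exact ⟨_, hI1, hb, by omega, h⟩
        · exact ⟨p, h1, h2, by omega, h4⟩
    rw [h17, h19, hex, e1, hc]
    refine ⟨⟨by omega, ?_, ?_⟩, ?_⟩
    · split_ifs
      · exact Or.inr rfl
      · exact hI2
    · rw [← hI3]
      split_ifs with h
      · simp [h]
      · simp [h]
    · have : n - τ.reg 17 = (n - (τ.reg 17 + 1)) + 1 := by omega
      rw [this, Nat.mul_add (500 * (k + 5)) _ 1]
      omega
  · rintro τ hf ⟨hI1, hI2, hI3⟩ hb
    have e0 : τ.reg 0 = n := by rw [hf.reg 0 rfl]; simp [eval, hR.len]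
    have hge : n ≤ τ.reg 17 := by
      by_contra hcon
      simp [e0, not_le.1 hcon] at hb
    refine Tri.straight rfl (by decide) ?_
    simp only [eval, State.reg_setReg, if_true, val_reg]
    have hex : (∃ p, 0 < p ∧ p < n ∧ mismatches s p (n - p) = k) ↔ τ.reg 19 = 1 := by
      rw [hI3]
      exact ⟨fun ⟨p, h1, h2, h3⟩ => ⟨p, h1, h2, by omega, h3⟩,
        fun ⟨p, h1, h2, _, h3⟩ => ⟨p, h1, h2, h3⟩⟩
    rw [hex]
    exact ⟨id, fun h => hI2.resolve_right h⟩
  · rw [hc]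
    have : 500 * (k + 5) * (n - (eval (19 ::= 0) (eval (17 ::= cap 1) σ)).reg 17) ≤
      500 * (k + 5) * n := Nat.mul_le_mul_left _ (by omega)
    omega

/-! ### Error borders -/

theorem mismatches_shift_zero (s : ℕ → ℕ) (i : ℕ) : mismatches s 0 i = 0 := by simp [mismatches]

theorem textOf_input {A : Type*} (f : A → ℕ) (u : List A) (k : ℕ) {i : ℕ} (hi : i < u.length) :
    textOf u.length ((input (u.map f) k).arr 0) i = f u[i] + 1 := by
  simp [textOf, input, hi]

section

variable {A : Type*} [DecidableEq A] {f : A → ℕ} (u : List A) (k : ℕ)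

/-- The suffix of length m starts at n - m, so its letters face those of the prefix at this shift.
An injective coding of the letters preserves equality. -/
theorem hammingDist_eq_mismatches (hf : Function.Injective f) {m : ℕ} (hm : m ≤ u.length)
    {v w : Fin m → A}
    (hv : ∀ i : Fin m, v i = u[u.length - m + i]'(by omega))
    (hw : ∀ i : Fin m, w i = u[i]'(by omega)) :
    hammingDist v w =
      mismatches (textOf u.length ((input (u.map f) k).arr 0)) (u.length - m) m := by
  rw [hammingDist, mismatches, Finset.card_filter, Finset.card_filter, Finset.sum_range]
  refine Finset.sum_congr rfl fun i _ => ?_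
  rw [textOf_input f u k (show (i : ℕ) < u.length by omega),
    textOf_input f u k (show (i : ℕ) + (u.length - m) < u.length by omega), hv, hw]
  have : u[u.length - m + (i : ℕ)]'(by omega) = u[(i : ℕ) + (u.length - m)]'(by omega) := by
    congr 1
    omega
  rw [this]
  refine if_congr (not_congr ?_) rfl rfl
  rw [Nat.add_right_cancel_iff, hf.eq_iff]
  exact eq_comm

theorem hasErrorBorder_iff (hf : Function.Injective f) {k' : ℕ} : HasErrorBorder k' u ↔
    ∃ m ≤ u.length, mismatches (textOf u.length ((input (u.map f) k).arr 0)) (u.length - m) m =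
      k' := by
  constructor
  · rintro ⟨m, v, w, hv, hw, h⟩
    have hm : m ≤ u.length := by simpa using hv.length_le
    refine ⟨m, hm, ?_⟩
    rw [← h, hammingDist_eq_mismatches u k hf hm (fun i => ?_) fun i => ?_]
    · have h1 := List.suffix_iff_eq_drop.1 hv
      have h2 : (List.ofFn v)[(i : ℕ)]'(by simp) = (u.drop (u.length - (List.ofFn v).length))[(i : ℕ)]'(by
        rw [← h1]; simp) := by
        congr 1
      simpa using h2
    · have h1 := List.prefix_iff_eq_take.1 hw
      have h2 : (List.ofFn w)[(i : ℕ)]'(by simp) = (u.take (List.ofFn w).length)[(i : ℕ)]'(by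
        rw [← h1]; simp) := by
        congr 1
      simpa using h2
  · rintro ⟨m, hm, h⟩
    refine ⟨m, fun i => u[u.length - m + i]'(by omega), fun i => u[i]'(by omega), ?_, ?_, ?_⟩
    · rw [List.suffix_iff_eq_drop]
      refine List.ext_getElem (by simp; omega) fun i h1 h2 => ?_
      simp
    · rw [List.prefix_iff_eq_take]
      refine List.ext_getElem (by simp; omega) fun i h1 h2 => ?_
      simp
    · rw [← h]
      exact hammingDist_eq_mismatches u k hf hm (fun _ => rfl) fun _ => rfl

theorem hasErrorBorder_zero : HasErrorBorder 0 u :=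
  ⟨0, Fin.elim0, Fin.elim0, by simp, by simp, by simp [hammingDist]⟩

theorem not_hasErrorBorder (h : u.length < k) : ¬ HasErrorBorder k u := by
  rintro ⟨m, v, w, hv, -, hd⟩
  have hm : m ≤ u.length := by simpa using hv.length_le
  have := hammingDist_le_card_fintype (x := v) (y := w)
  simp at this
  omega

/-- The shift 0 and the empty border have no mismatches, so for k > 0 both extremes may be left out.
Then every query of the search concerns two different positions inside the text. -/
theorem hasErrorBorder_iff_exists_shift (hf : Function.Injective f) (hk : 0 < k) :
    HasErrorBorder k u ↔ ∃ p, 0 < p ∧ p < u.length ∧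
      mismatches (textOf u.length ((input (u.map f) k).arr 0)) p (u.length - p) = k := by
  rw [hasErrorBorder_iff u k hf]
  constructor
  · rintro ⟨m, hm, h⟩
    refine ⟨u.length - m, ?_, ?_, by rwa [Nat.sub_sub_self hm]⟩
    · by_contra hcon
      rw [show u.length - m = 0 by omega, mismatches_shift_zero] at h
      omega
    · by_contra hcon
      rw [show m = 0 by omega, mismatches_zero] at h
      omega
  · rintro ⟨p, h1, h2, h⟩
    exact ⟨u.length - p, by omega, by rwa [Nat.sub_sub_self h2.le]⟩

end

/-! ### The complete program and its bounds -/

/-- The program for the words with at least as many letters as errors, on an alphabet of size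
`al`. -/
def longProg (al : ℕ) : Prog :=
  2 ::= const 100 * reg 0 + const (al + 100) ;; (3 ::= const al ;; prepare) ;; search

/-- The program that decides whether there is an error border. -/
def borderProg (al : ℕ) : Prog :=
  .cond (eq (reg 1) 0) (0 ::= 1) (.cond (lt (reg 0) (reg 1)) (0 ::= 0) (longProg al))

/-- A factor that bounds all numbers in the memory. -/
def memFactor (al : ℕ) : ℕ := al + 300 + (al + 4) * (2 + 260000 * (al + 2))

/-- The two phases are bounded separately. The preparation may let numbers grow by al + 4 per step,
since it takes O(n) steps; the search starts from the resulting bound and keeps it. -/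
theorem longProg_exec (σ : State) (n k al W S : ℕ) (h0 : σ.reg 0 = n) (h1 : σ.reg 1 = k)
    (hk : 0 < k) (hkn : k ≤ n) (hb : Bounded σ (2 * n + al)) (h5 : σ.reg 5 = 0)
    (h11 : σ.reg 11 = 0)
    (ha1 : ∀ i, σ.arr 1 i = 0) (ha3 : σ.arr 3 0 = 0) (hu : ∀ i, σ.arr 0 i ≤ al)
    (hW : ∀ e ≤ (longProg al).wt, (memFactor al * (n + 1) + 2) ^ e < W)
    (hS : 8 * (memFactor al * (n + 1) + 1) < S) :
    ∃ t τ, Exec W S (longProg al) σ t τ ∧ t ≤ 270000 * (al + 2) * (k * n + 1) ∧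
      ((∃ p, 0 < p ∧ p < n ∧ mismatches (textOf n (σ.arr 0)) p (n - p) = k) → τ.reg 0 = 1) ∧
      (¬ (∃ p, 0 < p ∧ p < n ∧ mismatches (textOf n (σ.arr 0)) p (n - p) = k) → τ.reg 0 = 0) := by
  set M := memFactor al * (n + 1) with hM
  set e₀ := const 100 * reg 0 + const (al + 100) with he₀
  set M₁ := 100 * n + (2 * n + al + 100) with hM₁
  set T := 2 + 260000 * (al + 2) * n with hT
  have hMM : M₁ + (al + 4) * T ≤ M := by
    have e1 : M = (al + 300) * n + (al + 300) + ((al + 4) * (2 + 260000 * (al + 2) * n) +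
        (al + 4) * (2 * n + 260000 * (al + 2))) := by
      rw [hM, memFactor]; ring
    have e2 : (al + 300) * n = al * n + 300 * n := by ring
    rw [e1, hM₁, hT, e2]
    have := Nat.zero_le (al * n)
    have := Nat.zero_le ((al + 4) * (2 * n + 260000 * (al + 2)))
    omega
  have hwt : (longProg al).wt = e₀.wt + (((3 ::= const al) ;; prepare).wt + search.wt) := rfl
  -- Setting the cap multiplies a number in memory by 100 and is not tame with an additive constant,
  -- so this single assignment is run by hand.
  have hok : e₀.Ok W S σ := Expr.ok_of_safe (L := 8) hb e₀ (by simp [he₀])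
    (lt_of_le_of_lt (Nat.pow_le_pow_left (by omega) _) (hW _ (by omega))) (by omega)
  have x₁ := Exec.assign σ 2 e₀ hok
  have hval : e₀.val σ = 100 * n + (al + 100) := by simp [he₀, h0]
  rw [hval] at x₁
  set σ₁ := σ.setReg 2 (100 * n + (al + 100)) with hσ₁
  have hb₁ : Bounded σ₁ M₁ := State.bounded_setReg (hb.mono (by omega)) (by omega)
  have hp := (prepare_spec (σ₁.setReg 3 al) n al (by omega) (by simp [hσ₁, h0]) (by simp)
    (by simp [hσ₁]; omega) (by simp [hσ₁, h5]) (by simp [hσ₁, h11]) (by simpa [hσ₁] using ha1)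
    (by simpa [hσ₁] using ha3) (by simpa [hσ₁] using hu))
  obtain ⟨t₂, σ₂, r₂, ht₂, hR⟩ := hp
  have r₂' : Run ((3 ::= const al) ;; prepare) σ₁ (2 + t₂) σ₂ :=
    .seq _ _ _ _ _ _ _ (.assign σ₁ 3 (const al)) r₂
  have f1 : σ₂.reg 1 = k := by
    rw [r₂.frame.reg 1 rfl]; simp [hσ₁, h1]
  have hleM : M₁ + (al + 4) * (2 + t₂) ≤ M :=
    (Nat.add_le_add_left (Nat.mul_le_mul_left _ (by omega)) _).trans hMM
  obtain ⟨x₂, hb₂⟩ := r₂'.exec (g := al + 4) (L := 8) (M := M₁) (M' := M) (W := W) (S := S)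
    ⟨⟨trivial, fun M => by simp only [bd_const]; omega⟩, prepare_tame.mono (by omega)⟩ hb₁ hleM
    (hW _ (by omega)) (by omega)
  obtain ⟨t₃, σ₃, r₃, ht₃, hQ⟩ := search_spec σ₂ _ n hR
  rw [f1] at ht₃ hQ
  obtain ⟨x₃, -⟩ := r₃.exec (g := 0) (L := 8) (M := M) (M' := M) (W := W) (S := S) search_tame
    (hb₂.mono hleM) (by omega) (hW _ (by omega)) (by omega)
  refine ⟨_, σ₃, .seq _ _ _ _ _ _ _ x₁ (.seq _ _ _ _ _ _ _ x₂ x₃), ?_, ?_⟩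
  · have hc : e₀.cost = 5 := rfl
    rw [hc]
    have e1 : 500 * (k + 5) * (n + 1) = 500 * (k * n) + 500 * k + 2500 * n + 2500 := by ring
    -- Here k > 0 matters: the linear preparation is absorbed in the term kn.
    have e2 : n ≤ k * n := Nat.le_mul_of_pos_left _ hk
    have e3 : 270000 * (al + 2) * (k * n + 1) =
      260000 * ((al + 2) * (k * n)) + 10000 * ((al + 2) * (k * n)) + 270000 * (al + 2) := by ring
    have e4 : 260000 * (al + 2) * n ≤ 260000 * ((al + 2) * (k * n)) := by
      rw [mul_assoc]
      exact Nat.mul_le_mul_left _ (Nat.mul_le_mul_left _ e2)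
    have e5 : 2 * (k * n) ≤ (al + 2) * (k * n) := Nat.mul_le_mul_right _ (by omega)
    rw [e3]
    omega
  · simpa [hσ₁] using hQ

theorem bounded_input {A : Type*} (f : A → ℕ) (al : ℕ) (hf : ∀ a, f a ≤ al) (u : List A) (k : ℕ) :
    Bounded (input (u.map f) k) (u.length + k + al) := by
  refine ⟨fun j => ?_, fun a i => ?_⟩
  · simp only [input, List.length_map]
    split_ifs <;> omega
  · simp only [input]
    split_ifs
    · rcases Nat.lt_or_ge i u.length with h | h
      · have := hf u[i]
        simp [h]
        omega
      · simp [h]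
    · omega

/-- Besides being trivial, the cases k = 0 and n < k have to be split off for the bounds: for k = 0
linear time would exceed O(kn + 1), and for n < k the number k in memory would not be O(n). In the
remaining case the initial memory is bounded linearly in n. -/
theorem borderProg_exec {A : Type*} [DecidableEq A] {f : A → ℕ} {al : ℕ}
    (hinj : Function.Injective f) (hfal : ∀ a, f a ≤ al) :
    ∃ C, ∀ (u : List A) (k : ℕ), ∃ S t τ,
      Exec ((u.length + k + 2) ^ C) S (borderProg al) (input (u.map f) k) t τ ∧
      t ≤ C * (k * u.length + 1) ∧ (borderProg al).space S ≤ C * (u.length + 1) ∧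
      (HasErrorBorder k u → τ.reg 0 = 1) ∧ (¬ HasErrorBorder k u → τ.reg 0 = 0) := by
  set P := borderProg al with hP
  set c := memFactor al with hc
  set C := (c + 3) * P.wt + 1 + (P.numRegs + P.numArrs * (8 * (c + 1) + 1)) +
    (270000 * (al + 2) + 20) with hC
  refine ⟨C, fun u k => ?_⟩
  set n := u.length with hn
  set W := (n + k + 2) ^ C with hWdef
  -- A constant factor is turned into an exponent by means of c + 2 ≤ 2 ^ (c + 2) and the base being
  -- at least 2. The word bound thus remains a fixed power of n + k + 2.
  have hW : ∀ M, M + 2 ≤ (c + 2) * (n + k + 2) → ∀ e ≤ P.wt, (M + 2) ^ e < W := by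
    intro M hM e he
    have h1 : M + 2 ≤ (n + k + 2) ^ (c + 3) := by
      calc M + 2 ≤ (c + 2) * (n + k + 2) := hM
        _ ≤ 2 ^ (c + 2) * (n + k + 2) := Nat.mul_le_mul_right _ Nat.lt_two_pow_self.le
        _ ≤ (n + k + 2) ^ (c + 2) * (n + k + 2) :=
          Nat.mul_le_mul_right _ (Nat.pow_le_pow_left (by omega) _)
        _ = _ := by rw [← pow_succ]
    calc (M + 2) ^ e ≤ (M + 2) ^ P.wt := Nat.pow_le_pow_right (by omega) he
      _ ≤ ((n + k + 2) ^ (c + 3)) ^ P.wt := Nat.pow_le_pow_left h1 _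
      _ = (n + k + 2) ^ ((c + 3) * P.wt) := by rw [← pow_mul]
      _ < _ := Nat.pow_lt_pow_right (by omega) (by omega)
  have hspace : P.space (8 * (c * (n + 1) + 1) + 1) ≤ C * (n + 1) := by
    have h1 : 8 * (c * (n + 1) + 1) + 1 ≤ (8 * (c + 1) + 1) * (n + 1) := by
      have : (8 * (c + 1) + 1) * (n + 1) = 8 * (c * (n + 1)) + 9 * n + 9 := by ring
      omega
    have h2 := Nat.mul_le_mul_left P.numArrs h1
    have h3 : C * (n + 1) = ((c + 3) * P.wt + 1 + (270000 * (al + 2) + 20)) * (n + 1) +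
        P.numRegs * n + P.numRegs + P.numArrs * ((8 * (c + 1) + 1) * (n + 1)) := by
      rw [hC]; ring
    rw [Prog.space, h3]
    omega
  have hc2 : al + 2 ≤ c := by rw [hc, memFactor]; omega
  have hb := bounded_input f al hfal u k
  have hbW : ∀ e ≤ P.wt, (n + k + al + 2) ^ e < W := hW _ (by nlinarith)
  have htime : ∀ t, t ≤ 270000 * (al + 2) * (k * n + 1) + 20 → t ≤ C * (k * n + 1) := by
    intro t ht
    calc t ≤ 270000 * (al + 2) * (k * n + 1) + 20 * (k * n + 1) := by omega
      _ = (270000 * (al + 2) + 20) * (k * n + 1) := (Nat.add_mul _ _ _).symm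
      _ ≤ C * (k * n + 1) := Nat.mul_le_mul_right _ (Nat.le_add_left _ _)
  set σ := input (u.map f) k with hσ
  set S := 8 * (c * (n + 1) + 1) + 1 with hS
  -- The tests in front access no arrays, so the factor 0 for the indices suffices and k does not
  -- enter the space.
  have hok : ∀ e : Expr, e.Safe 0 → e.wt ≤ P.wt → e.Ok W S σ := fun e h1 h2 =>
    Expr.ok_of_safe hb e h1 (hbW _ h2) (by omega)
  have h0 : σ.reg 0 = n := by simp [hσ, input, hn]
  have h1 : σ.reg 1 = k := by simp [hσ, input]
  have hwt : P.wt = 2 + 2 + (2 + 1 + (longProg al).wt) := by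
    simp only [hP, borderProg, Prog.wt, eq, lt, Expr.wt]
  have w₁ : (eq (reg 1) 0).wt = 2 := rfl
  have w₂ : (lt (reg 0) (reg 1)).wt = 2 := rfl
  have ok₁ : (eq (reg 1) 0).Ok W S σ := hok _ (by simp) (by omega)
  by_cases hk : k = 0
  · refine ⟨S, _, _, .condTrue _ _ _ _ _ _ ok₁ (by simp [h1, hk]) (.assign σ 0 1
      (hok _ trivial (show 2 ≤ P.wt by omega))), htime _ (Nat.le_add_left_of_le (by decide)), hspace,
      fun _ => by simp, fun h => absurd ?_ h⟩
    rw [hk]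
    exact hasErrorBorder_zero u
  have ok₂ : (lt (reg 0) (reg 1)).Ok W S σ := hok _ (by simp) (by omega)
  have v₁ : (eq (reg 1) 0).val σ = 0 := by simp [h1, hk]
  by_cases hkn : n < k
  · exact ⟨S, _, _, .condFalse _ _ _ _ _ _ ok₁ v₁ (.condTrue _ _ _ _ _ _ ok₂ (by simp [h0, h1, hkn])
      (.assign σ 0 0 (hok _ trivial (show 1 ≤ P.wt by omega)))),
      htime _ (Nat.le_add_left_of_le (by decide)), hspace,
      fun h => absurd h (not_hasErrorBorder u k hkn), fun _ => by simp⟩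
  have v₂ : (lt (reg 0) (reg 1)).val σ = 0 := by simp [h0, h1, hkn]
  have hu : ∀ i, σ.arr 0 i ≤ al := fun i => by
    rcases Nat.lt_or_ge i u.length with h | h
    · simpa [hσ, input, h] using hfal u[i]
    · simp [hσ, input, h]
  obtain ⟨t, τ, hx, ht, hyes, hno⟩ := longProg_exec σ n k al W S h0 h1 (by omega) (by omega)
    (hb.mono (by omega)) (by simp [hσ, input]) (by simp [hσ, input]) (by simp [hσ, input])
    (by simp [hσ, input]) hu (fun e he => hW _ (by nlinarith) e (by omega))
    (Nat.lt_succ_self _)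
  rw [← hasErrorBorder_iff_exists_shift u k hinj (by omega)] at hyes hno
  refine ⟨S, _, τ, .condFalse _ _ _ _ _ _ ok₁ v₁ (.condFalse _ _ _ _ _ _ ok₂ v₂ hx), ?_, hspace,
    hyes, hno⟩
  refine htime _ ?_
  have c₁ : (eq (reg 1) 0).cost = 3 := rfl
  have c₂ : (lt (reg 0) (reg 1)).cost = 3 := rfl
  omega

end WordRAM

theorem proposition2 (A : Type*) [Fintype A] [DecidableEq A] (num : A ≃ Fin (Fintype.card A)) :
    ∃ (P : WordRAM.Prog) (C : ℕ), ∀ (u : List A) (k : ℕ),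
      ∃ (S t : ℕ) (σ : WordRAM.State),
        WordRAM.Exec ((u.length + k + 2) ^ C) S P
          (WordRAM.input (u.map fun a => (num a : ℕ)) k) t σ ∧
        t ≤ C * (k * u.length + 1) ∧
        P.space S ≤ C * (u.length + 1) ∧
        (HasErrorBorder k u → σ.reg 0 = 1) ∧
        (¬ HasErrorBorder k u → σ.reg 0 = 0) :=
  ⟨WordRAM.borderProg (Fintype.card A), WordRAM.borderProg_exec
    (fun _ _ h => num.injective (Fin.ext h)) fun a => (num a).2.le⟩
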